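/- **Setting.** A safety specification is a complete deterministic automaton $\varphi=(Q,q_0,\Sigma,\delta,F)$ with $Q$ finite, $\Sigma=\Sigma_I\times\Sigma_O$, and $\Sigma_I,\Sigma_O$ finite and nonempty; a word satisfies $\varphi$ if the run on it (from $q_0$, including $q_0$) stays in $F$. Let $W\subseteq F$ be the winning region of $\varphi$ as a safety game, i.e. the largest $W\subseteq F$ such that for all $q\in W$, $\sigma_I\in\Sigma_I$ there is $\sigma_O\in\Sigma_O$ with $\delta(q,(\sigma_I,\sigma_O))\in W$. A design is a finite Mealy machine from $\Sigma_I$ to $\Sigma_O$. A *shield* is a finite Mealy machine $\mathcal S$ reading $\Sigma_I\times\Sigma_O$ (the input and the output of the design) and producing a letter of $\Sigma_O$, such that $(\mathcal D\circ\mathcal S)\models\varphi$ for every design $\mathcal D$. It *deviates* in a time step if its output letter differs from that of the design. The monitored set $u\subseteq Q$ of a trace (a finite word over $\Sigma$, produced by a design) starts as $\{q_0\}$. A letter $(\sigma_I,\sigma_O)$ is a *violation* at $u$ if $\delta(q,(\sigma_I,\sigma_O))\notin W$ for all $q\in u$. The next monitored set is $\{\delta(q,(\sigma_I,\sigma_O)):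 q\in u\}\cap W$ if there is no violation, and $\{\delta(q,(\sigma_I,\sigma_O')): q\in u,\ \sigma_O'\in\Sigma_O\}\cap W$ otherwise. A shield *adversely $k$-stabilizes* a trace $\tau$ if, along every continuation of $\tau$ without a further violation, it deviates at most in the $k$ consecutive time steps beginning with the last step of $\tau$. It *collaboratively $k$-stabilizes* $\tau$ if there is a continuation of $\tau$ by $k$ letters without a further violation, such that in the last step of this continuation, and from then on until the next violation, whatever the design does, the shield does not deviate. A shield $\mathcal S$ is *admissible* if it does not deviate in any step of a trace that contains no violation and if, for every trace $\tau$, where $\mathcal S'$ ranges over the shields that answer like $\mathcal S$ in all steps of $\tau$ before the last: (i) for every $k$, if some $\mathcal S'$ adversely $k$-stabilizes $\tau$, then so does $\mathcal S$; (ii) if no $\mathcal S'$ adversely $k$-stabilizes $\tau$ for any $k$, then $\mathcal S$ collaboratively $k$-stabilizes $\tau$ for every $k$ for which some $\mathcal S'$ does, in particular for the minimal one. The machine model is a unit-cost random access machine: a fixed program built by sequencing, branching and looping (on a register being nonzero) from the elementary operations constant, addition, truncated subtraction, and indirect reading and writing of arrays; every elementary operation and every test counts as one step. The input is $|Q|,|\Sigma_I|,|\Sigma_O|,q_0$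 together with the table of $\delta$ and the indicator table of $F$; a shield is output by its number of states, its initial state and its complete transition and output tables. **Theorem.** There are a program $P$ and a constant $c$ such that, for every safety specification $\varphi$, the program $P$ halts on input $\varphi$ after at most $$c\cdot\bigl(|Q|+|\Sigma_I|+|\Sigma_O|\bigr)^{c}\cdot 2^{|Q|}$$ steps (i.e. time $O(2^{|Q|})$ up to factors polynomial in $|Q|$, $|\Sigma_I|$, $|\Sigma_O|$). If an admissible shield with respect to $\varphi$ exists, it outputs one, with at most $(2\cdot 2^{|Q|}+|Q|)\cdot 2\cdot|Q|$ states; if none exists, it reports this. -/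

import Mathlib

namespace Shielding

/-! ### Mealy machines and safety automata -/

/-- A Mealy machine (reactive system) with states `S`, input alphabet `A`, output alphabet `B`. -/
structure Mealy (S A B : Type) where
  init : S
  next : S → A → S
  out : S → A → B

namespace Mealy

variable {S T A B I O : Type}

/-- The state reached after reading the input word `w`. -/
def stateAfter (M : Mealy S A B) (w : List A) : S :=
  w.foldl M.next M.init

/-- The output letter produced when `x` is read after the input word `w`. -/
def response (M : Mealy S A B) (w : List A) (x : A) : B :=
  M.out (M.stateAfter w) x

/-- The input/output word produced from state `s` on an input word. -/
def traceFrom (M : Mealy S A B) : S → List A → List (A × B)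
  | _, [] => []
  | s, x :: w => (x, M.out s x) :: traceFrom M (M.next s x) w

/-- The input/output word produced on an input word. -/
def trace (M : Mealy S A B) (w : List A) : List (A × B) :=
  M.traceFrom M.init w

/-- The serial composition `D ∘ S` of a design `D` with a machine that reads the inputs of the
design together with its outputs, and replaces the latter. -/
def comp (D : Mealy S I O) (M : Mealy T (I × O) O) : Mealy (S × T) I O where
  init := (D.init, M.init)
  next s i := (D.next s.1 i, M.next s.2 (i, D.out s.1 i))
  out s i := M.out s.2 (i, D.out s.1 i)

end Mealy

/-- A safety specification `(Q, q₀, Σ, δ, F)` over the alphabet `Σ = I × O`, given as a complete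
deterministic automaton; a word satisfies it if the run on it never leaves `safe`. -/
structure SafetyAutomaton (Q I O : Type) where
  init : Q
  next : Q → I × O → Q
  safe : Finset Q

namespace SafetyAutomaton

variable {Q I O S T : Type} (φ : SafetyAutomaton Q I O)

/-- The state reached after reading a word. -/
def stateAfter (w : List (I × O)) : Q :=
  w.foldl φ.next φ.init

/-- `D ⊨ φ`: on every input sequence, all states that the run of `φ` visits are safe.  As this is
a safety property, it is stated over all finite prefixes. -/
def SatisfiedBy (D : Mealy S I O) : Prop :=
  ∀ w : List I, φ.stateAfter (D.trace w) ∈ φ.safe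

/-- The winning region of `φ` as a safety game (the environment picks the input, then the system
picks the output): the largest set of safe states in which the system can stay. -/
def winning : Set Q :=
  {q | ∃ X : Set Q, q ∈ X ∧ ∀ p ∈ X, p ∈ φ.safe ∧ ∀ i : I, ∃ o : O, φ.next p (i, o) ∈ X}

/-- The letter `x` is a violation if the design is monitored to be in one of the states in `u`:
each of these states is left by `x` to a state outside the winning region. -/
def Violates (u : Set Q) (x : I × O) : Prop :=
  ∀ q ∈ u, φ.next q x ∉ φ.winning

/-- The subset construction of the violation monitor.  Without a violation, follow the letter from
all monitored states and keep the winning successors.  After a violation, keep all the winning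
states reachable under the same input and some other output. -/
def monitorStep (u : Set Q) (x : I × O) : Set Q :=
  {q' | q' ∈ φ.winning ∧
    ((¬ φ.Violates u x ∧ ∃ q ∈ u, φ.next q x = q') ∨
      (φ.Violates u x ∧ ∃ q ∈ u, ∃ o : O, φ.next q (x.1, o) = q'))}

/-- The set of states monitored after the design has produced the word `w`. -/
def monitor (w : List (I × O)) : Set Q :=
  w.foldl φ.monitorStep {φ.init}

/-- The continuation `v` of the design word `w` contains no violation (violations in `w` itself
are allowed). -/
def NoViolation (w v : List (I × O)) : Prop :=
  ∀ v₁ x v₂, v = v₁ ++ x :: v₂ → ¬ φ.Violates (φ.monitor (w ++ v₁)) x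

/-! ### Shields

A shield reads the letters `(input, output of the design)`, so that a trace of the design is a word
over `I × O`, and outputs the corrected letter. -/

/-- `M` is a shield: combined with any finite-state design it satisfies the specification. -/
def IsShield (M : Mealy T (I × O) O) : Prop :=
  ∀ (S : Type) [Finite S] (D : Mealy S I O), φ.SatisfiedBy (D.comp M)

/-- In the last time step of the trace `w`, the shield changes the output of the design. -/
def Deviates (M : Mealy T (I × O) O) (w : List (I × O)) : Prop :=
  ∃ v x, w = v ++ [x] ∧ M.response v x ≠ x.2

/-- The shield keeps the output of the design as long as the trace is not wrong. -/
def NoUnnecessaryDeviation (M : Mealy T (I × O) O) : Prop :=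
  ∀ w, φ.NoViolation [] w → ¬ Deviates M w

/-- `M` adversely `k`-stabilizes the trace `w`: whatever happens after `w`, as long as it contains
no new violation, `M` deviates at most in `k` consecutive time steps, the first of which is the
last time step of `w`. -/
def AdverselyStabilizes (M : Mealy T (I × O) O) (k : ℕ) (w : List (I × O)) : Prop :=
  ∀ v, φ.NoViolation w v → k ≤ v.length → ¬ Deviates M (w ++ v)

/-- `M` collaboratively `k`-stabilizes the trace `w`: for some continuation of `w` by `k` letters
without a new violation, the recovery is over after these `k` steps, i.e. from then on `M` does not
deviate until the next violation. -/
def CollaborativelyStabilizes (M : Mealy T (I × O) O) (k : ℕ) (w : List (I × O)) : Prop :=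
  ∃ v, φ.NoViolation w v ∧ v.length = k ∧ φ.AdverselyStabilizes M 0 (w ++ v)

/-- The two shields have answered alike in all time steps of `w` before the last one. -/
def AgreeBefore (M : Mealy S (I × O) O) (N : Mealy T (I × O) O) (w : List (I × O)) : Prop :=
  ∀ v₁ x v₂, w = v₁ ++ x :: v₂ → v₂ ≠ [] → M.response v₁ x = N.response v₁ x

/-- Some shield that shares the past of `M` on `w` adversely `k`-stabilizes `w`. -/
def CanAdverselyStabilize (M : Mealy T (I × O) O) (k : ℕ) (w : List (I × O)) : Prop :=
  ∃ (S : Type) (_ : Finite S) (N : Mealy S (I × O) O),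
    φ.IsShield N ∧ AgreeBefore M N w ∧ φ.AdverselyStabilizes N k w

/-- Some shield that shares the past of `M` on `w` collaboratively `k`-stabilizes `w`. -/
def CanCollaborativelyStabilize (M : Mealy T (I × O) O) (k : ℕ) (w : List (I × O)) : Prop :=
  ∃ (S : Type) (_ : Finite S) (N : Mealy S (I × O) O),
    φ.IsShield N ∧ AgreeBefore M N w ∧ φ.CollaborativelyStabilizes N k w

/-- Admissible shields. -/
def IsAdmissible (M : Mealy T (I × O) O) : Prop :=
  φ.IsShield M ∧ φ.NoUnnecessaryDeviation M ∧
    ∀ w : List (I × O),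
      (∀ k, φ.CanAdverselyStabilize M k w → φ.AdverselyStabilizes M k w) ∧
      ((¬ ∃ k, φ.CanAdverselyStabilize M k w) →
        ∀ k, φ.CanCollaborativelyStabilize M k w → φ.CollaborativelyStabilizes M k w)

end SafetyAutomaton

/-! ### Random access machines with unit cost

Programs are structured (sequence, branch, loop) over the elementary operations of a random access
machine: constants, addition, truncated subtraction, and indirect addressing.  There is no
multiplication and no bitwise operation. -/

namespace RAM

/-- Registers and arrays, both numbered; a program can name only finitely many of them. -/
@[ext] structure Store where
  reg : ℕ → ℕ
  arr : ℕ → ℕ → ℕ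

inductive Instr where
  /-- `x := c` -/
  | const (x c : ℕ)
  /-- `x := y + z` -/
  | add (x y z : ℕ)
  /-- `x := y - z`, which is `0` if `y < z` -/
  | sub (x y z : ℕ)
  /-- `x := A[y]` -/
  | load (x A y : ℕ)
  /-- `A[x] := y` -/
  | store (A x y : ℕ)

/-- Write a register. -/
def Store.setReg (σ : Store) (x v : ℕ) : Store :=
  { σ with reg := Function.update σ.reg x v }

/-- The effect of an elementary operation. -/
def Instr.run : Instr → Store → Store
  | .const x c, σ => σ.setReg x c
  | .add x y z, σ => σ.setReg x (σ.reg y + σ.reg z)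
  | .sub x y z, σ => σ.setReg x (σ.reg y - σ.reg z)
  | .load x A y, σ => σ.setReg x (σ.arr A (σ.reg y))
  | .store A x y, σ =>
      { σ with arr := Function.update σ.arr A (Function.update (σ.arr A) (σ.reg x) (σ.reg y)) }

inductive Prog where
  | op (i : Instr)
  | seq (p q : Prog)
  /-- run `p` if register `x` is nonzero, else `q` -/
  | branch (x : ℕ) (p q : Prog)
  /-- run `p` as long as register `x` is nonzero -/
  | loop (x : ℕ) (p : Prog)

/-- `Exec p σ t τ`: started in `σ`, the program `p` halts in `τ` after exactly `t` steps.  Each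
elementary operation and each test of a register is one step. -/
inductive Exec : Prog → Store → ℕ → Store → Prop
  | op (i : Instr) (σ : Store) : Exec (.op i) σ 1 (i.run σ)
  | seq {p q : Prog} {σ₁ σ₂ σ₃ : Store} {s t : ℕ} :
      Exec p σ₁ s σ₂ → Exec q σ₂ t σ₃ → Exec (.seq p q) σ₁ (s + t) σ₃
  | branch_pos {x : ℕ} {p q : Prog} {σ₁ σ₂ : Store} {t : ℕ} :
      σ₁.reg x ≠ 0 → Exec p σ₁ t σ₂ → Exec (.branch x p q) σ₁ (t + 1) σ₂
  | branch_zero {x : ℕ} {p q : Prog} {σ₁ σ₂ : Store} {t : ℕ} :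
      σ₁.reg x = 0 → Exec q σ₁ t σ₂ → Exec (.branch x p q) σ₁ (t + 1) σ₂
  | loop_pos {x : ℕ} {p : Prog} {σ₁ σ₂ σ₃ : Store} {s t : ℕ} :
      σ₁.reg x ≠ 0 → Exec p σ₁ s σ₂ → Exec (.loop x p) σ₂ t σ₃ →
      Exec (.loop x p) σ₁ (s + t + 1) σ₃
  | loop_zero {x : ℕ} {p : Prog} {σ : Store} :
      σ.reg x = 0 → Exec (.loop x p) σ 1 σ

/-- Execution is deterministic, in the result and in the number of steps. -/
theorem Exec.deterministic {p : Prog} {σ τ τ' : Store} {t t' : ℕ}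
    (h : Exec p σ t τ) (h' : Exec p σ t' τ') : t = t' ∧ τ = τ' := by
  induction h generalizing t' τ' with
  | op i σ => cases h'; exact ⟨rfl, rfl⟩
  | seq _ _ ih₁ ih₂ =>
    cases h' with
    | seq a b =>
      obtain ⟨rfl, rfl⟩ := ih₁ a
      obtain ⟨rfl, rfl⟩ := ih₂ b
      exact ⟨rfl, rfl⟩
  | branch_pos hx _ ih =>
    cases h' with
    | branch_pos _ a => obtain ⟨rfl, rfl⟩ := ih a; exact ⟨rfl, rfl⟩
    | branch_zero hx' _ => exact absurd hx' hx
  | branch_zero hx _ ih =>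
    cases h' with
    | branch_zero _ a => obtain ⟨rfl, rfl⟩ := ih a; exact ⟨rfl, rfl⟩
    | branch_pos hx' _ => exact absurd hx hx'
  | loop_pos hx _ _ ih₁ ih₂ =>
    cases h' with
    | loop_pos _ a b =>
      obtain ⟨rfl, rfl⟩ := ih₁ a
      obtain ⟨rfl, rfl⟩ := ih₂ b
      exact ⟨rfl, rfl⟩
    | loop_zero hx' => exact absurd hx' hx
  | loop_zero hx =>
    cases h' with
    | loop_pos hx' _ _ => exact absurd hx hx'
    | loop_zero _ => exact ⟨rfl, rfl⟩

end RAM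

/-! ### Input and output of the synthesis problem -/

/-- The position of the entry `(s, i, o)` in a table with `a` inputs and `b` outputs. -/
def tableIndex (a b s i o : ℕ) : ℕ :=
  (s * a + i) * b + o

/-- The initial store for a specification with `n` states, `a` input and `b` output letters:
registers 0 to 3 hold `n`, `a`, `b` and the initial state, array 0 holds the indicator function of
the safe states, array 1 holds the transition table, and everything else is 0. -/
def inputStore {n a b : ℕ} (φ : SafetyAutomaton (Fin n) (Fin a) (Fin b)) : RAM.Store where
  reg x := if x = 0 then n else if x = 1 then a else if x = 2 then b
    else if x = 3 then (φ.init : ℕ) else 0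
  arr A y :=
    if A = 0 then (if ∃ q ∈ φ.safe, (q : ℕ) = y then 1 else 0)
    else if A = 1 then
      ∑ q : Fin n, ∑ i : Fin a, ∑ o : Fin b,
        if tableIndex a b q i o = y then (φ.next q (i, o) : ℕ) else 0
    else 0

/-- The store describes the machine `M`: register 0 holds the number of states, register 1 the
initial state, array 0 the transition table and array 1 the output table. -/
def StoreDescribes {a b K : ℕ} (σ : RAM.Store)
    (M : Mealy (Fin K) (Fin a × Fin b) (Fin b)) : Prop :=
  σ.reg 0 = K ∧ σ.reg 1 = (M.init : ℕ) ∧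
    ∀ (s : Fin K) (i : Fin a) (o : Fin b),
      σ.arr 0 (tableIndex a b s i o) = (M.next s (i, o) : ℕ) ∧
      σ.arr 1 (tableIndex a b s i o) = (M.out s (i, o) : ℕ)

/-- An admissible shield exists. -/
def SafetyAutomaton.HasAdmissibleShield {Q I O : Type} (φ : SafetyAutomaton Q I O) : Prop :=
  ∃ (S : Type) (_ : Finite S) (M : Mealy S (I × O) O), φ.IsAdmissible M

end Shielding

/-! Fix a specification with n states. After a trace of the design, all that matters for the future
is the position: the state of the specification under the corrected outputs, together with the
monitored set. There are `2 ^ n * n` positions, and they form the `Arena`. The monitored component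
depends on the design alone, the state on the answers of the shield. A machine is a shield iff all
positions that it reaches are winning (`isShield_iff`), since every word is the trace of some finite
design.

The notions in the definition of admissibility become fixed points over pairs of a position and a
letter, called entries. `Copy` says that the shield may repeat the design from now on until the next
violation; it is the complement of a least fixed point (`escape`). `Adv k` and `Col k` say that the
corrections can be ended after k steps against every design, or with the help of the design. They
are the stages of the systems `adverse` and `collab`. Stabilization by any shield implies membership
in these stages. Conversely, membership is realized by a finite machine that imitates the given one
on the past and then lowers the rank at every step (`canAdverselyStabilize_of_adv`,
`canCollaborativelyStabilize_of_col`). Hence what other shields with the same past can achieve is a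
property of the entry.

Condition (i) is then a local restriction on the outputs: they have to be `Allowed`. Condition (ii)
is not local. At an entry without an adverse rank but with a collaborative one, the shield has to
commit itself to a shortest collaborative path, and on this path it may meet entries with an adverse
rank, where (i) restricts it further. The two demands can be incompatible, so a winning initial
state does not by itself settle whether an admissible shield exists. Whether they can be met forever
is a safety question, with two kinds of obligation: continue admissibly from a position (`Viable`),
and continue along a shortest path from an entry (`Tight`). The failures form the least fixed point
`blocked`. The traces of an admissible shield never meet it (`viable_of_isAdmissible`). Conversely,
if the initial position avoids it, the positional strategy that prefers tight outputs to merely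
viable ones is admissible (`isAdmissible_machine`). So the positions themselves suffice as states of
the shield, and `2 ^ n * n` is below the bound of the theorem.

All five fixed points (losing states, `escape`, `adverse`, `collab`, `blocked`) are systems of Horn
clauses. Counting the pending premises of each rule and processing derived elements in breadth-first
order gives the round of derivation of every element in time linear in the size of the system
(`Propagation`, `run_propagate`). The rounds are exactly the minimal k, so optimality of an output
is a comparison of two ranks (`forall_imp_iff`). The systems have `2 ^ n` times polynomially many
edges.

For the running time on the random access machine, the program is written in a language whose loops
are bounded by parameters, so that its cost is a syntactic function of the parameters. Parameters
below 10 are polynomial in the input size, the others are polynomial times `2 ^ n`. If no loop over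
a large parameter is inside another one, and products are formed with small parameters only, the
total cost is polynomial times `2 ^ n` (`Stmt.linearCost`); for the concrete program this is checked
by evaluation. -/

namespace Shielding

namespace RAM

/-! ### A small language with bounded loops, compiled to random access machines

Registers below 20 hold parameters, which bound the loops; registers from 20 to 59 hold the local
variables, and the compiler keeps its temporaries in the registers from 60 on. -/

/-- Expressions; `mulv e P` is `e` times parameter `P`, and `sum x P e` is the sum of `e` over all
values of `x` below parameter `P`. -/
inductive Exp where
  | lit (c : ℕ)
  | var (x : ℕ)
  | add (e f : Exp)
  | sub (e f : Exp)
  | mulv (e : Exp) (P : ℕ)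
  | get (A : ℕ) (e : Exp)
  | ite (c e f : Exp)
  | sum (x P : ℕ) (e : Exp)

/-- Statements; `forv x P s` runs `s` for all values of `x` below parameter `P`, and `letv x e s`
runs `s` with `x` bound to `e`. -/
inductive Stmt where
  | put (A : ℕ) (e f : Exp)
  | seq (s t : Stmt)
  | ite (c : Exp) (s t : Stmt)
  | forv (x P : ℕ) (s : Stmt)
  | letv (x : ℕ) (e : Exp) (s : Stmt)

namespace Exp

/-- The value of an expression in an environment and a memory. -/
def eval : Exp → (ℕ → ℕ) → (ℕ → ℕ → ℕ) → ℕ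
  | lit c, _, _ => c
  | var x, ρ, _ => ρ x
  | add e f, ρ, m => e.eval ρ m + f.eval ρ m
  | sub e f, ρ, m => e.eval ρ m - f.eval ρ m
  | mulv e P, ρ, m => e.eval ρ m * ρ P
  | get A e, ρ, m => m A (e.eval ρ m)
  | ite c e f, ρ, m => if c.eval ρ m ≠ 0 then e.eval ρ m else f.eval ρ m
  | sum x P e, ρ, m => ∑ i ∈ Finset.range (ρ P), e.eval (Function.update ρ x i) m

/-- Well-formedness, where `s` lists the bound variables. -/
def wf : List ℕ → Exp → Bool
  | _, lit _ => true
  | s, var x => decide (x < 20 ∨ x ∈ s)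
  | s, add e f => wf s e && wf s f
  | s, sub e f => wf s e && wf s f
  | s, mulv e P => wf s e && decide (P < 20)
  | s, get _ e => wf s e
  | s, ite c e f => wf s c && (wf s e && wf s f)
  | s, sum x P e => decide (20 ≤ x ∧ x < 60 ∧ P < 20 ∧ x ∉ s) && wf (x :: s) e

/-- A bound for the number of steps of the compiled expression. -/
def cost : Exp → (ℕ → ℕ) → ℕ
  | lit _, _ => 1
  | var _, _ => 2
  | add e f, ρ => e.cost ρ + f.cost ρ + 1
  | sub e f, ρ => e.cost ρ + f.cost ρ + 1
  | mulv e P, ρ => e.cost ρ + (ρ P * 3 + 7)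
  | get _ e, ρ => e.cost ρ + 1
  -- Both branches are charged, so that the bound depends on the parameters only and not on the
  -- memory.
  | ite c e f, ρ => c.cost ρ + (e.cost ρ + f.cost ρ) + 1
  | sum _ P e, ρ => ρ P * (e.cost ρ + 5) + 5

/-- The program that leaves the value of an expression in the register `d`. -/
def compile : ℕ → Exp → Prog
  | d, lit c => .op (.const d c)
  | d, var x => .seq (.op (.const d 0)) (.op (.add d d x))
  | d, add e f => .seq (compile d e) (.seq (compile (d + 1) f) (.op (.add d d (d + 1))))
  | d, sub e f => .seq (compile d e) (.seq (compile (d + 1) f) (.op (.sub d d (d + 1))))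
  -- Repeated addition: `d + 1` accumulates, `d + 2` counts down from the parameter, `d + 3` holds
  -- the constant one.
  | d, mulv e P =>
    .seq (compile d e) (.seq (.op (.const (d + 1) 0)) (.seq (.op (.const (d + 2) 0))
      (.seq (.op (.add (d + 2) (d + 2) P)) (.seq (.op (.const (d + 3) 1))
        (.seq (.loop (d + 2) (.seq (.op (.add (d + 1) (d + 1) d))
          (.op (.sub (d + 2) (d + 2) (d + 3)))))
          (.seq (.op (.const d 0)) (.op (.add d d (d + 1)))))))))
  | d, get A e => .seq (compile d e) (.op (.load d A d))
  | d, ite c e f => .seq (compile d c) (.branch d (compile d e) (compile d f))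
  -- Register `d + 1` serves both as the loop test and as the target of the summand. The summand
  -- destroys the counter, so it is restored as `P - x` at the end of each round.
  | d, sum x P e =>
    .seq (.op (.const d 0)) (.seq (.op (.const x 0)) (.seq (.op (.const (d + 1) 0))
      (.seq (.op (.add (d + 1) (d + 1) P))
        (.loop (d + 1) (.seq (compile (d + 1) e) (.seq (.op (.add d d (d + 1)))
          (.seq (.op (.const (d + 1) 1)) (.seq (.op (.add x x (d + 1)))
            (.op (.sub (d + 1) P x))))))))))

end Exp

namespace Stmt

/-- The memory after the execution of a statement. -/
def run : Stmt → (ℕ → ℕ) → (ℕ → ℕ → ℕ) → (ℕ → ℕ → ℕ)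
  | put A e f, ρ, m => Function.update m A (Function.update (m A) (e.eval ρ m) (f.eval ρ m))
  | seq s t, ρ, m => t.run ρ (s.run ρ m)
  | ite c s t, ρ, m => if c.eval ρ m ≠ 0 then s.run ρ m else t.run ρ m
  | forv x P s, ρ, m => Nat.rec m (fun i m' => s.run (Function.update ρ x i) m') (ρ P)
  | letv x e s, ρ, m => s.run (Function.update ρ x (e.eval ρ m)) m

/-- Well-formedness, where `s` lists the bound variables. -/
def wf : List ℕ → Stmt → Bool
  | s, put _ e f => e.wf s && f.wf s
  | s, seq p q => wf s p && wf s q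
  | s, ite c p q => c.wf s && (wf s p && wf s q)
  | s, forv x P p => decide (20 ≤ x ∧ x < 60 ∧ P < 20 ∧ x ∉ s) && wf (x :: s) p
  | s, letv x e p => decide (20 ≤ x ∧ x < 60 ∧ x ∉ s) && (e.wf s && wf (x :: s) p)

/-- A bound for the number of steps of the compiled statement. -/
def cost : Stmt → (ℕ → ℕ) → ℕ
  | put _ e f, ρ => e.cost ρ + f.cost ρ + 1
  | seq s t, ρ => s.cost ρ + t.cost ρ
  | ite c s t, ρ => c.cost ρ + (s.cost ρ + t.cost ρ) + 1
  | forv _ P s, ρ => ρ P * (s.cost ρ + 4) + 4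
  | letv _ e s, ρ => e.cost ρ + s.cost ρ + 2

/-- The program of a statement. -/
def compile : Stmt → Prog
  | put A e f => .seq (e.compile 60) (.seq (f.compile 61) (.op (.store A 60 61)))
  | seq s t => .seq s.compile t.compile
  | ite c s t => .seq (c.compile 60) (.branch 60 s.compile t.compile)
  -- The body may overwrite every register from 60 on; only `x` and `P` survive it, and the loop
  -- test is recomputed from them as `P - x`.
  | forv x P s =>
    .seq (.op (.const x 0)) (.seq (.op (.const 60 0)) (.seq (.op (.add 60 60 P))
      (.loop 60 (.seq s.compile (.seq (.op (.const 60 1)) (.seq (.op (.add x x 60))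
        (.op (.sub 60 P x))))))))
  | letv x e s => .seq (e.compile 60) (.seq (.op (.const x 0)) (.seq (.op (.add x x 60)) s.compile))

end Stmt

/-! ### Correctness and cost of the compiled programs -/

/-- A total correctness rule for counting loops. The invariant after `i` rounds forces the test
register to be `N - i`, so there are exactly `N` rounds; each is charged one test in addition to its
body, and one more test ends the loop. -/
theorem exists_exec_loop {x : ℕ} {B : Prog} {N T : ℕ} (I : ℕ → Store → Prop)
    (hreg : ∀ i σ, i ≤ N → I i σ → σ.reg x = N - i)
    (hstep : ∀ i σ, i < N → I i σ → ∃ t σ', Exec B σ t σ' ∧ t ≤ T ∧ I (i + 1) σ')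
    (σ : Store) (h0 : I 0 σ) :
    ∃ t σ', Exec (.loop x B) σ t σ' ∧ t ≤ N * (T + 1) + 1 ∧ I N σ' := by
  have key : ∀ k i σ, i + k = N → I i σ →
      ∃ t σ', Exec (.loop x B) σ t σ' ∧ t ≤ k * (T + 1) + 1 ∧ I N σ' := by
    intro k
    induction k with
    | zero =>
      intro i σ hi h
      obtain rfl : i = N := by omega
      exact ⟨1, σ, .loop_zero (by rw [hreg i σ le_rfl h]; omega), by omega, h⟩
    | succ k ih =>
      intro i σ hi h
      obtain ⟨t, σ', he, ht, h'⟩ := hstep i σ (by omega) h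
      obtain ⟨t₂, σ₂, he₂, ht₂, h₂⟩ := ih (i + 1) σ' (by omega) h'
      refine ⟨t + t₂ + 1, σ₂, .loop_pos (by rw [hreg i σ (by omega) h]; omega) he he₂, ?_, h₂⟩
      rw [Nat.succ_mul]; omega
  exact key N 0 σ (by omega) h0

/-- The registers of the parameters and of the variables listed in `s`. -/
def InScope (s : List ℕ) (y : ℕ) : Prop := y < 20 ∨ y ∈ s

namespace Exp

/-- Well-formed loops are bounded by registers below 20, while bound variables start at 20. Binding
a variable therefore leaves the cost unchanged, and one bound serves for all rounds of a loop. -/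
theorem cost_congr {e : Exp} {ρ ρ' : ℕ → ℕ} {s : List ℕ} (hw : e.wf s = true)
    (h : ∀ P < 20, ρ P = ρ' P) : e.cost ρ = e.cost ρ' := by
  induction e generalizing s with
  | lit c => rfl
  | var x => rfl
  | add e f ihe ihf =>
    simp only [wf, Bool.and_eq_true] at hw
    simp [cost, ihe hw.1, ihf hw.2]
  | sub e f ihe ihf =>
    simp only [wf, Bool.and_eq_true] at hw
    simp [cost, ihe hw.1, ihf hw.2]
  | mulv e P ihe =>
    simp only [wf, Bool.and_eq_true, decide_eq_true_eq] at hw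
    simp [cost, ihe hw.1, h P hw.2]
  | get A e ihe => simp only [wf] at hw; simp [cost, ihe hw]
  | ite c e f ihc ihe ihf =>
    simp only [wf, Bool.and_eq_true] at hw
    simp [cost, ihc hw.1, ihe hw.2.1, ihf hw.2.2]
  | sum x P e ihe =>
    simp only [wf, Bool.and_eq_true, decide_eq_true_eq] at hw
    simp [cost, ihe hw.2, h P hw.1.2.2.1]

/-- The compiled expression computes the value of the expression and changes neither the arrays nor
the registers in use. -/
theorem exec_compile (e : Exp) : ∀ (s : List ℕ) (d : ℕ) (ρ : ℕ → ℕ) (σ : Store), (∀ y ∈ s, y < 60) →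
    e.wf s = true → 60 ≤ d → (∀ y, InScope s y → σ.reg y = ρ y) →
    ∃ t σ', Exec (e.compile d) σ t σ' ∧ t ≤ e.cost ρ ∧ σ'.arr = σ.arr ∧
      σ'.reg d = e.eval ρ σ.arr ∧ (∀ y, InScope s y → σ'.reg y = σ.reg y) ∧
      ∀ y, 60 ≤ y → y < d → σ'.reg y = σ.reg y := by
  induction e with
  | lit c =>
    intro s d ρ σ hs hw hd hρ
    have lt60 : ∀ y, InScope s y → y < 60 := fun y hy => hy.elim (by omega) (hs y)
    refine ⟨1, _, .op _ _, le_rfl, rfl, by simp [Instr.run, Store.setReg, eval], ?_, ?_⟩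
    · intro y hy; exact Function.update_of_ne (by have := lt60 y hy; omega) _ _
    · intro y _ hy; exact Function.update_of_ne (by omega) _ _
  | var x =>
    intro s d ρ σ hs hw hd hρ
    have lt60 : ∀ y, InScope s y → y < 60 := fun y hy => hy.elim (by omega) (hs y)
    simp only [wf, decide_eq_true_eq] at hw
    have hx := lt60 x hw
    refine ⟨2, _, .seq (.op _ _) (.op _ _), le_rfl, rfl, ?_, ?_, ?_⟩
    · have : x ≠ d := by omega
      simp [Instr.run, Store.setReg, eval, this, hρ x hw]
    · intro y hy
      have : y ≠ d := by have := lt60 y hy; omega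
      simp [Instr.run, Store.setReg, this]
    · intro y _ hy
      have : y ≠ d := by omega
      simp [Instr.run, Store.setReg, this]
  | add e f ihe ihf =>
    intro s d ρ σ hs hw hd hρ
    have lt60 : ∀ y, InScope s y → y < 60 := fun y hy => hy.elim (by omega) (hs y)
    simp only [wf, Bool.and_eq_true] at hw
    obtain ⟨t₁, σ₁, h₁, ht₁, ha₁, hv₁, hr₁, hs₁⟩ := ihe s d ρ σ hs hw.1 hd hρ
    obtain ⟨t₂, σ₂, h₂, ht₂, ha₂, hv₂, hr₂, hs₂⟩ := ihf s (d + 1) ρ σ₁ hs hw.2 (by omega)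
      (fun y hy => by rw [hr₁ y hy, hρ y hy])
    refine ⟨t₁ + (t₂ + 1), _, .seq h₁ (.seq h₂ (.op _ _)), by simp only [cost]; omega, ?_, ?_, ?_,
      ?_⟩
    · simp [Instr.run, Store.setReg, ha₂, ha₁]
    · simp [Instr.run, Store.setReg, eval, hv₂, ha₁, hs₂ d hd (by omega), hv₁]
    · intro y hy
      have : y ≠ d := by have := lt60 y hy; omega
      simp [Instr.run, Store.setReg, this, hr₂ y hy, hr₁ y hy]
    · intro y hy hy'
      have : y ≠ d := by omega
      simp [Instr.run, Store.setReg, this, hs₂ y hy (by omega),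
        hs₁ y hy hy']
  | sub e f ihe ihf =>
    intro s d ρ σ hs hw hd hρ
    have lt60 : ∀ y, InScope s y → y < 60 := fun y hy => hy.elim (by omega) (hs y)
    simp only [wf, Bool.and_eq_true] at hw
    obtain ⟨t₁, σ₁, h₁, ht₁, ha₁, hv₁, hr₁, hs₁⟩ := ihe s d ρ σ hs hw.1 hd hρ
    obtain ⟨t₂, σ₂, h₂, ht₂, ha₂, hv₂, hr₂, hs₂⟩ := ihf s (d + 1) ρ σ₁ hs hw.2 (by omega)
      (fun y hy => by rw [hr₁ y hy, hρ y hy])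
    refine ⟨t₁ + (t₂ + 1), _, .seq h₁ (.seq h₂ (.op _ _)), by simp only [cost]; omega, ?_, ?_, ?_,
      ?_⟩
    · simp [Instr.run, Store.setReg, ha₂, ha₁]
    · simp [Instr.run, Store.setReg, eval, hv₂, ha₁, hs₂ d hd (by omega), hv₁]
    · intro y hy
      have : y ≠ d := by have := lt60 y hy; omega
      simp [Instr.run, Store.setReg, this, hr₂ y hy, hr₁ y hy]
    · intro y hy hy'
      have : y ≠ d := by omega
      simp [Instr.run, Store.setReg, this, hs₂ y hy (by omega),
        hs₁ y hy hy']
  | mulv e P ihe =>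
    intro s d ρ σ hs hw hd hρ
    have lt60 : ∀ y, InScope s y → y < 60 := fun y hy => hy.elim (by omega) (hs y)
    simp only [wf, Bool.and_eq_true, decide_eq_true_eq] at hw
    obtain ⟨t₁, σ₁, h₁, ht₁, ha₁, hv₁, hr₁, hs₁⟩ := ihe s d ρ σ hs hw.1 hd hρ
    have hP : σ₁.reg P = ρ P := by rw [hr₁ P (.inl hw.2), hρ P (.inl hw.2)]
    obtain ⟨t₂, σ₂, h₂, ht₂, hI⟩ := exists_exec_loop (x := d + 2) (N := ρ P) (T := 2)
      (B := .seq (.op (.add (d + 1) (d + 1) d)) (.op (.sub (d + 2) (d + 2) (d + 3))))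
      (fun i τ => τ.arr = σ.arr ∧ τ.reg (d + 2) = ρ P - i ∧ τ.reg (d + 3) = 1 ∧
        τ.reg (d + 1) = e.eval ρ σ.arr * i ∧ τ.reg d = e.eval ρ σ.arr ∧
        ∀ y < d, τ.reg y = σ₁.reg y) (fun i τ _ h => h.2.1)
      (by
        rintro i τ hi ⟨g1, g2, g3, g4, g5, g6⟩
        refine ⟨2, _, .seq (.op _ _) (.op _ _), le_rfl, g1, ?_, ?_, ?_, ?_, ?_⟩
        · simp [Instr.run, Store.setReg, g2, g3]; omega
        · simp [Instr.run, Store.setReg, g3]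
        · simp [Instr.run, Store.setReg, g4, g5, mul_add]
        · simp [Instr.run, Store.setReg, g5]
        · intro y hy
          have h1 : y ≠ d + 1 := by omega
          have h2 : y ≠ d + 2 := by omega
          simp [Instr.run, Store.setReg, h1, h2, g6 y hy])
      (Instr.run (.const (d + 3) 1) (Instr.run (.add (d + 2) (d + 2) P)
        (Instr.run (.const (d + 2) 0) (Instr.run (.const (d + 1) 0) σ₁))))
      (by
        have h1 : P ≠ d + 1 := by omega
        have h2 : P ≠ d + 2 := by omega
        refine ⟨ha₁, ?_, ?_, ?_, ?_, ?_⟩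
        · simp [Instr.run, Store.setReg, h1, h2, hP]
        · simp [Instr.run, Store.setReg]
        · simp [Instr.run, Store.setReg]
        · simp [Instr.run, Store.setReg, hv₁]
        · intro y hy
          have h1 : y ≠ d + 1 := by omega
          have h2 : y ≠ d + 2 := by omega
          have h3 : y ≠ d + 3 := by omega
          simp [Instr.run, Store.setReg, h1, h2, h3])
    obtain ⟨g1, -, -, g4, -, g6⟩ := hI
    refine ⟨t₁ + (1 + (1 + (1 + (1 + (t₂ + (1 + 1)))))), _, .seq h₁ (.seq (.op _ _) (.seq (.op _ _)
      (.seq (.op _ _) (.seq (.op _ _) (.seq h₂ (.seq (.op _ _) (.op _ _))))))), ?_, ?_, ?_, ?_, ?_⟩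
    · simp only [cost]; omega
    · simpa [Instr.run, Store.setReg] using g1
    · simp [Instr.run, Store.setReg, g4, eval]
    · intro y hy
      have := lt60 y hy
      have h1 : y ≠ d := by omega
      simp [Instr.run, Store.setReg, h1, g6 y (by omega), hr₁ y hy]
    · intro y hy hy'
      have h1 : y ≠ d := by omega
      simp [Instr.run, Store.setReg, h1, g6 y (by omega), hs₁ y hy hy']
  | get A e ihe =>
    intro s d ρ σ hs hw hd hρ
    have lt60 : ∀ y, InScope s y → y < 60 := fun y hy => hy.elim (by omega) (hs y)
    simp only [wf] at hw
    obtain ⟨t₁, σ₁, h₁, ht₁, ha₁, hv₁, hr₁, hs₁⟩ := ihe s d ρ σ hs hw hd hρ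
    refine ⟨t₁ + 1, _, .seq h₁ (.op _ _), by simp only [cost]; omega, ?_, ?_, ?_, ?_⟩
    · simp [Instr.run, Store.setReg, ha₁]
    · simp [Instr.run, Store.setReg, eval, hv₁, ha₁]
    · intro y hy
      have : y ≠ d := by have := lt60 y hy; omega
      simp [Instr.run, Store.setReg, this, hr₁ y hy]
    · intro y hy hy'
      have : y ≠ d := by omega
      simp [Instr.run, Store.setReg, this, hs₁ y hy hy']
  | ite c e f ihc ihe ihf =>
    intro s d ρ σ hs hw hd hρ
    have lt60 : ∀ y, InScope s y → y < 60 := fun y hy => hy.elim (by omega) (hs y)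
    simp only [wf, Bool.and_eq_true] at hw
    obtain ⟨t₁, σ₁, h₁, ht₁, ha₁, hv₁, hr₁, hs₁⟩ := ihc s d ρ σ hs hw.1 hd hρ
    have hρ₁ : ∀ y, InScope s y → σ₁.reg y = ρ y := fun y hy => by rw [hr₁ y hy, hρ y hy]
    by_cases hc : c.eval ρ σ.arr = 0
    · obtain ⟨t₂, σ₂, h₂, ht₂, ha₂, hv₂, hr₂, hs₂⟩ := ihf s d ρ σ₁ hs hw.2.2 hd hρ₁
      refine ⟨t₁ + (t₂ + 1), σ₂, .seq h₁ (.branch_zero (by rw [hv₁, hc]) h₂),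
        by simp only [cost]; omega, by rw [ha₂, ha₁], ?_, ?_, ?_⟩
      · simp [eval, hc, hv₂, ha₁]
      · intro y hy; rw [hr₂ y hy, hr₁ y hy]
      · intro y hy hy'; rw [hs₂ y hy hy', hs₁ y hy hy']
    · obtain ⟨t₂, σ₂, h₂, ht₂, ha₂, hv₂, hr₂, hs₂⟩ := ihe s d ρ σ₁ hs hw.2.1 hd hρ₁
      refine ⟨t₁ + (t₂ + 1), σ₂, .seq h₁ (.branch_pos (by rwa [hv₁]) h₂),
        by simp only [cost]; omega, by rw [ha₂, ha₁], ?_, ?_, ?_⟩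
      · simp [eval, hc, hv₂, ha₁]
      · intro y hy; rw [hr₂ y hy, hr₁ y hy]
      · intro y hy hy'; rw [hs₂ y hy hy', hs₁ y hy hy']
  | sum x P e ihe =>
    intro s d ρ σ hs hw hd hρ
    simp only [wf, Bool.and_eq_true, decide_eq_true_eq] at hw
    obtain ⟨⟨hx20, hx, hP, hxs⟩, hwe⟩ := hw
    have lt60 : ∀ y, InScope s y → y < 60 ∧ y ≠ x := fun y hy => hy.elim (by omega)
      fun h => ⟨hs y h, fun e => hxs (e ▸ h)⟩
    have hxd : x ≠ d := by omega
    have hxd1 : x ≠ d + 1 := by omega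
    have hPd : P ≠ d := by omega
    have hPd1 : P ≠ d + 1 := by omega
    have hPx : P ≠ x := by omega
    have hρP : σ.reg P = ρ P := hρ P (.inl hP)
    obtain ⟨t₂, σ₂, h₂, ht₂, hI⟩ := exists_exec_loop (x := d + 1) (N := ρ P) (T := e.cost ρ + 4)
      (B := .seq (compile (d + 1) e) (.seq (.op (.add d d (d + 1)))
          (.seq (.op (.const (d + 1) 1)) (.seq (.op (.add x x (d + 1)))
            (.op (.sub (d + 1) P x))))))
      (fun i τ => τ.arr = σ.arr ∧ τ.reg (d + 1) = ρ P - i ∧ τ.reg x = i ∧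
        τ.reg d = ∑ j ∈ Finset.range i, e.eval (Function.update ρ x j) σ.arr ∧
        (∀ y, InScope s y → τ.reg y = σ.reg y) ∧ ∀ y, 60 ≤ y → y < d → τ.reg y = σ.reg y)
      (fun i τ _ h => h.2.1)
      (by
        rintro i τ hi ⟨g1, g2, g3, g4, g5, g6⟩
        obtain ⟨t₁, σ₁, h₁, ht₁, ha₁, hv₁, hr₁, hs₁⟩ := ihe (x :: s) (d + 1)
          (Function.update ρ x i) τ (by simpa [hx] using hs) hwe (by omega)
          (fun y hy => by
            by_cases h : y = x
            · simp [h, g3]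
            · have : InScope s y := hy.imp id fun h' => by simpa [h] using h'
              simp [h, g5 y this, hρ y this])
        rw [cost_congr hwe (ρ' := ρ) (fun P hP => by
          rw [Function.update_of_ne (by omega)])] at ht₁
        have e1 : σ₁.reg d = τ.reg d := hs₁ d hd (by omega)
        have e2 : σ₁.reg x = i := by rw [hr₁ x (.inr (by simp)), g3]
        have e3 : σ₁.reg P = ρ P := by rw [hr₁ P (.inl hP), g5 P (.inl hP), hρP]
        refine ⟨t₁ + (1 + (1 + (1 + 1))), _, .seq h₁ (.seq (.op _ _) (.seq (.op _ _)
          (.seq (.op _ _) (.op _ _)))), by omega, ?_, ?_, ?_, ?_, ?_, ?_⟩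
        · simp [Instr.run, Store.setReg, ha₁, g1]
        · simp [Instr.run, Store.setReg, hxd, hxd1, hPx, hPd, hPd1, e2, e3]
        · simp [Instr.run, Store.setReg, hxd, hxd1, e2]
        · simp [Instr.run, Store.setReg, hxd.symm, hv₁, e1, g4, g1, Finset.sum_range_succ]
        · intro y hy
          have := lt60 y hy
          have h1 : y ≠ d := by omega
          have h2 : y ≠ d + 1 := by omega
          simp [Instr.run, Store.setReg, h1, h2, this.2, g5 y hy,
            hr₁ y (hy.imp id (List.mem_cons_of_mem x))]
        · intro y hy hy'
          have h1 : y ≠ d := by omega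
          have h2 : y ≠ d + 1 := by omega
          have h3 : y ≠ x := by omega
          simp [Instr.run, Store.setReg, h1, h2, h3, g6 y hy hy', hs₁ y hy (by omega)])
      (Instr.run (.add (d + 1) (d + 1) P)
        (Instr.run (.const (d + 1) 0) (Instr.run (.const x 0) (Instr.run (.const d 0) σ))))
      (by
        refine ⟨rfl, ?_, ?_, ?_, ?_, ?_⟩
        · simp [Instr.run, Store.setReg, hPx, hPd, hPd1, hρP]
        · simp [Instr.run, Store.setReg, hxd1]
        · simp [Instr.run, Store.setReg, hxd.symm]
        · intro y hy
          have := lt60 y hy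
          have h1 : y ≠ d := by omega
          have h2 : y ≠ d + 1 := by omega
          simp [Instr.run, Store.setReg, h1, h2, this.2]
        · intro y hy hy'
          have h1 : y ≠ d := by omega
          have h2 : y ≠ d + 1 := by omega
          have h3 : y ≠ x := by omega
          simp [Instr.run, Store.setReg, h1, h2, h3])
    obtain ⟨g1, -, -, g4, g5, g6⟩ := hI
    refine ⟨1 + (1 + (1 + (1 + t₂))), σ₂, .seq (.op _ _) (.seq (.op _ _) (.seq (.op _ _)
      (.seq (.op _ _) h₂))), ?_, g1, ?_, g5, g6⟩
    · simp only [cost]; rw [add_assoc] at ht₂; norm_num at ht₂; omega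
    · simp [g4, eval]

end Exp

/-- The registers hold the environment, as far as the variables in `s` and the parameters are
concerned, and the arrays hold the memory. -/
def Store.Holds (σ : Store) (s : List ℕ) (ρ : ℕ → ℕ) (m : ℕ → ℕ → ℕ) : Prop :=
  σ.arr = m ∧ ∀ y, InScope s y → σ.reg y = ρ y

theorem Store.Holds.compile {σ : Store} {s : List ℕ} {ρ : ℕ → ℕ} {m : ℕ → ℕ → ℕ}
    (h : σ.Holds s ρ m) (hs : ∀ y ∈ s, y < 60) {e : Exp} (hw : e.wf s = true) {d : ℕ}
    (hd : 60 ≤ d) :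
    ∃ t σ', Exec (e.compile d) σ t σ' ∧ t ≤ e.cost ρ ∧ σ'.Holds s ρ m ∧ σ'.reg d = e.eval ρ m ∧
      ∀ y, 60 ≤ y → y < d → σ'.reg y = σ.reg y := by
  obtain ⟨t, σ', h₁, ht, ha, hv, hr, hd'⟩ := e.exec_compile s d ρ σ hs hw hd h.2
  exact ⟨t, σ', h₁, ht, ⟨by rw [ha, h.1], fun y hy => by rw [hr y hy, h.2 y hy]⟩,
    by rw [hv, h.1], hd'⟩

theorem Store.Holds.setReg {σ : Store} {s : List ℕ} {ρ : ℕ → ℕ} {m : ℕ → ℕ → ℕ}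
    (h : σ.Holds s ρ m) (hs : ∀ y ∈ s, y < 60) {d v : ℕ} (hd : 60 ≤ d) :
    (σ.setReg d v).Holds s ρ m := by
  refine ⟨h.1, fun y hy => ?_⟩
  have : y ≠ d := by
    have := hy.elim (fun h : y < 20 => (by omega : y < 60)) (hs y)
    omega
  simp [Store.setReg, this, h.2 y hy]

namespace Stmt

theorem cost_congr {p : Stmt} {ρ ρ' : ℕ → ℕ} {s : List ℕ} (hw : p.wf s = true)
    (h : ∀ P < 20, ρ P = ρ' P) : p.cost ρ = p.cost ρ' := by
  induction p generalizing s with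
  | put A e f =>
    simp only [wf, Bool.and_eq_true] at hw
    simp [cost, Exp.cost_congr hw.1 h, Exp.cost_congr hw.2 h]
  | seq p q ihp ihq =>
    simp only [wf, Bool.and_eq_true] at hw
    simp [cost, ihp hw.1, ihq hw.2]
  | ite c p q ihp ihq =>
    simp only [wf, Bool.and_eq_true] at hw
    simp [cost, Exp.cost_congr hw.1 h, ihp hw.2.1, ihq hw.2.2]
  | forv x P p ih =>
    simp only [wf, Bool.and_eq_true, decide_eq_true_eq] at hw
    simp [cost, ih hw.2, h P hw.1.2.2.1]
  | letv x e p ih =>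
    simp only [wf, Bool.and_eq_true, decide_eq_true_eq] at hw
    simp [cost, ih hw.2.2, Exp.cost_congr hw.2.1 h]

/-- The compiled statement has the effect of the statement on the memory and preserves the
registers in use. -/
theorem exec_compile (p : Stmt) : ∀ (s : List ℕ) (ρ : ℕ → ℕ) (m : ℕ → ℕ → ℕ) (σ : Store),
    (∀ y ∈ s, y < 60) → p.wf s = true → σ.Holds s ρ m →
    ∃ t σ', Exec p.compile σ t σ' ∧ t ≤ p.cost ρ ∧ σ'.Holds s ρ (p.run ρ m) := by
  induction p with
  | put A e f =>
    intro s ρ m σ hs hw h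
    simp only [wf, Bool.and_eq_true] at hw
    obtain ⟨t₁, σ₁, h₁, ht₁, hh₁, hv₁, hr₁⟩ := h.compile hs hw.1 le_rfl
    obtain ⟨t₂, σ₂, h₂, ht₂, hh₂, hv₂, hr₂⟩ := hh₁.compile hs hw.2 (d := 61) (by omega)
    have e1 : σ₂.reg 60 = e.eval ρ m := by rw [hr₂ 60 le_rfl (by omega), hv₁]
    refine ⟨t₁ + (t₂ + 1), _, .seq h₁ (.seq h₂ (.op _ _)), by simp only [cost]; omega, ?_, ?_⟩
    · simp [Instr.run, run, hh₂.1, e1, hv₂]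
    · exact fun y hy => hh₂.2 y hy
  | seq p q ihp ihq =>
    intro s ρ m σ hs hw h
    simp only [wf, Bool.and_eq_true] at hw
    obtain ⟨t₁, σ₁, h₁, ht₁, hh₁⟩ := ihp s ρ m σ hs hw.1 h
    obtain ⟨t₂, σ₂, h₂, ht₂, hh₂⟩ := ihq s ρ _ σ₁ hs hw.2 hh₁
    exact ⟨t₁ + t₂, σ₂, .seq h₁ h₂, by simp only [cost]; omega, hh₂⟩
  | ite c p q ihp ihq =>
    intro s ρ m σ hs hw h
    simp only [wf, Bool.and_eq_true] at hw
    obtain ⟨t₁, σ₁, h₁, ht₁, hh₁, hv₁, -⟩ := h.compile hs hw.1 le_rfl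
    by_cases hc : c.eval ρ m = 0
    · obtain ⟨t₂, σ₂, h₂, ht₂, hh₂⟩ := ihq s ρ m σ₁ hs hw.2.2 hh₁
      exact ⟨t₁ + (t₂ + 1), σ₂, .seq h₁ (.branch_zero (by rw [hv₁, hc]) h₂),
        by simp only [cost]; omega, by simpa [run, hc] using hh₂⟩
    · obtain ⟨t₂, σ₂, h₂, ht₂, hh₂⟩ := ihp s ρ m σ₁ hs hw.2.1 hh₁
      exact ⟨t₁ + (t₂ + 1), σ₂, .seq h₁ (.branch_pos (by rwa [hv₁]) h₂),
        by simp only [cost]; omega, by simpa [run, hc] using hh₂⟩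
  | letv x e p ih =>
    intro s ρ m σ hs hw h
    simp only [wf, Bool.and_eq_true, decide_eq_true_eq] at hw
    obtain ⟨⟨hx20, hx, hxs⟩, hwe, hwp⟩ := hw
    obtain ⟨t₁, σ₁, h₁, ht₁, hh₁, hv₁, -⟩ := h.compile hs hwe le_rfl
    have hx60 : x ≠ 60 := by omega
    have hne : ∀ y, InScope s y → y ≠ x := fun y hy => hy.elim (by omega)
      fun h e => hxs (e ▸ h)
    obtain ⟨t₂, σ₂, h₂, ht₂, hh₂⟩ := ih (x :: s) (Function.update ρ x (e.eval ρ m)) m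
      (Instr.run (.add x x 60) (Instr.run (.const x 0) σ₁)) (by simpa [hx] using hs) hwp
      ⟨hh₁.1, fun y hy => by
        by_cases hyx : y = x
        · subst hyx; simp [Instr.run, Store.setReg, hx60.symm, hv₁]
        · have : InScope s y := hy.imp id fun h' => by simpa [hyx] using h'
          simp [Instr.run, Store.setReg, hyx, hh₁.2 y this]⟩
    rw [cost_congr hwp (ρ' := ρ) (fun P hP => by rw [Function.update_of_ne (by omega)])] at ht₂
    refine ⟨t₁ + (1 + (1 + t₂)), σ₂, .seq h₁ (.seq (.op _ _) (.seq (.op _ _) h₂)),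
      by simp only [cost]; omega, hh₂.1, fun y hy => ?_⟩
    rw [hh₂.2 y (hy.imp id (List.mem_cons_of_mem x)), Function.update_of_ne (hne y hy)]
  | forv x P p ih =>
    intro s ρ m σ hs hw h
    simp only [wf, Bool.and_eq_true, decide_eq_true_eq] at hw
    obtain ⟨⟨hx20, hx, hP, hxs⟩, hwp⟩ := hw
    have hne : ∀ y, InScope s y → y ≠ x ∧ y ≠ 60 := fun y hy => hy.elim (by omega)
      fun h => ⟨fun e => hxs (e ▸ h), by have := hs y h; omega⟩
    have hPx : P ≠ x := by omega
    have hx60 : x ≠ 60 := by omega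
    have hP60 : P ≠ 60 := by omega
    obtain ⟨t₂, σ₂, h₂, ht₂, hI⟩ := exists_exec_loop (x := 60) (N := ρ P) (T := p.cost ρ + 3)
      (B := .seq p.compile (.seq (.op (.const 60 1)) (.seq (.op (.add x x 60))
        (.op (.sub 60 P x)))))
      (fun i τ => τ.Holds s ρ
          (Nat.rec m (fun i m' => p.run (Function.update ρ x i) m') i) ∧
        τ.reg 60 = ρ P - i ∧ τ.reg x = i) (fun i τ _ h => h.2.1)
      (by
        rintro i τ hi ⟨g1, g2, g3⟩
        obtain ⟨t₁, σ₁, h₁, ht₁, hh₁⟩ := ih (x :: s) (Function.update ρ x i) _ τ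
          (by simpa [hx] using hs) hwp ⟨g1.1, fun y hy => by
            by_cases hyx : y = x
            · subst hyx; simp [g3]
            · have : InScope s y := hy.imp id fun h' => by simpa [hyx] using h'
              simp [hyx, g1.2 y this]⟩
        rw [cost_congr hwp (ρ' := ρ) (fun P hP => by
          rw [Function.update_of_ne (by omega)])] at ht₁
        have e2 : σ₁.reg x = i := by simp [hh₁.2 x (.inr (by simp))]
        have e3 : σ₁.reg P = ρ P := by simp [hh₁.2 P (.inl hP), hPx]
        refine ⟨t₁ + (1 + (1 + 1)), _, .seq h₁ (.seq (.op _ _) (.seq (.op _ _) (.op _ _))),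
          by omega, ⟨by simpa [Instr.run, Store.setReg] using hh₁.1, fun y hy => ?_⟩, ?_, ?_⟩
        · have := hne y hy
          simp [Instr.run, Store.setReg, this, hh₁.2 y (hy.imp id (List.mem_cons_of_mem x))]
        · simp [Instr.run, Store.setReg, hx60, hPx, hP60, e2, e3]
        · simp [Instr.run, Store.setReg, hx60, e2])
      (Instr.run (.add 60 60 P) (Instr.run (.const 60 0) (Instr.run (.const x 0) σ)))
      (by
        refine ⟨⟨h.1, fun y hy => ?_⟩, ?_, ?_⟩
        · have := hne y hy
          simp [Instr.run, Store.setReg, this, h.2 y hy]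
        · simp [Instr.run, Store.setReg, hPx, hP60, h.2 P (.inl hP)]
        · simp [Instr.run, Store.setReg, hx60])
    refine ⟨1 + (1 + (1 + t₂)), σ₂, .seq (.op _ _) (.seq (.op _ _) (.seq (.op _ _) h₂)), ?_, hI.1⟩
    simp only [cost]; rw [add_assoc] at ht₂; norm_num at ht₂; omega

end Stmt

end RAM

end Shielding

namespace Shielding

namespace RAM

/-! ### Polynomial bounds for the number of steps -/

/-- A cost that is polynomial in the parameters below 10. -/
def PolyCost (f : (ℕ → ℕ) → ℕ) : Prop :=
  ∃ c, ∀ (ρ : ℕ → ℕ) (Z : ℕ), (∀ P < 10, ρ P ≤ Z) → f ρ ≤ c * (Z + 1) ^ c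

/-- A cost that is polynomial in the parameters below 10 and linear in the others. -/
def LinearCost (f : (ℕ → ℕ) → ℕ) : Prop :=
  -- In the application, `B` is `2 ^ n` and `Z` is a power of the input size.
  ∃ c, ∀ (ρ : ℕ → ℕ) (Z B : ℕ), (∀ P < 10, ρ P ≤ Z) → (∀ P < 20, ρ P ≤ Z * B) → 1 ≤ B →
    f ρ ≤ c * (Z + 1) ^ c * B

namespace PolyCost

variable {f g : (ℕ → ℕ) → ℕ}

theorem const (k : ℕ) : PolyCost fun _ => k :=
  ⟨k, fun _ Z _ => Nat.le_mul_of_pos_right _ (by positivity)⟩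

theorem param {P : ℕ} (hP : P < 10) : PolyCost fun ρ => ρ P :=
  ⟨1, fun ρ Z h => by simpa using (h P hP).trans (Nat.le_succ Z)⟩

theorem add (hf : PolyCost f) (hg : PolyCost g) : PolyCost fun ρ => f ρ + g ρ := by
  obtain ⟨c, hc⟩ := hf
  obtain ⟨c', hc'⟩ := hg
  refine ⟨c + c', fun ρ Z h => ?_⟩
  have h1 := hc ρ Z h
  have h2 := hc' ρ Z h
  have h3 : (Z + 1) ^ c ≤ (Z + 1) ^ (c + c') := Nat.pow_le_pow_right (by omega) (by omega)
  have h4 : (Z + 1) ^ c' ≤ (Z + 1) ^ (c + c') := Nat.pow_le_pow_right (by omega) (by omega)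
  calc f ρ + g ρ ≤ c * (Z + 1) ^ (c + c') + c' * (Z + 1) ^ (c + c') :=
        add_le_add (h1.trans (Nat.mul_le_mul_left _ h3)) (h2.trans (Nat.mul_le_mul_left _ h4))
    _ = _ := by ring

theorem mul (hf : PolyCost f) (hg : PolyCost g) : PolyCost fun ρ => f ρ * g ρ := by
  obtain ⟨c, hc⟩ := hf
  obtain ⟨c', hc'⟩ := hg
  -- A single constant has to dominate both the coefficient `c * c'` and the exponent `c + c'`.
  refine ⟨c + c' + c * c', fun ρ Z h => ?_⟩
  calc f ρ * g ρ ≤ (c * (Z + 1) ^ c) * (c' * (Z + 1) ^ c') := Nat.mul_le_mul (hc ρ Z h) (hc' ρ Z h)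
    _ = c * c' * (Z + 1) ^ (c + c') := by ring
    _ ≤ _ := Nat.mul_le_mul (by omega) (Nat.pow_le_pow_right (by omega) (by omega))

theorem linear (hf : PolyCost f) : LinearCost f := by
  obtain ⟨c, hc⟩ := hf
  exact ⟨c, fun ρ Z B h _ hB => (hc ρ Z h).trans (Nat.le_mul_of_pos_right _ hB)⟩

end PolyCost

namespace LinearCost

variable {f g : (ℕ → ℕ) → ℕ}

theorem add (hf : LinearCost f) (hg : LinearCost g) : LinearCost fun ρ => f ρ + g ρ := by
  obtain ⟨c, hc⟩ := hf
  obtain ⟨c', hc'⟩ := hg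
  refine ⟨c + c', fun ρ Z B h h' hB => ?_⟩
  have h1 := hc ρ Z B h h' hB
  have h2 := hc' ρ Z B h h' hB
  have h3 : (Z + 1) ^ c ≤ (Z + 1) ^ (c + c') := Nat.pow_le_pow_right (by omega) (by omega)
  have h4 : (Z + 1) ^ c' ≤ (Z + 1) ^ (c + c') := Nat.pow_le_pow_right (by omega) (by omega)
  calc f ρ + g ρ ≤ c * (Z + 1) ^ (c + c') * B + c' * (Z + 1) ^ (c + c') * B :=
        add_le_add (h1.trans (Nat.mul_le_mul_right _ (Nat.mul_le_mul_left _ h3)))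
          (h2.trans (Nat.mul_le_mul_right _ (Nat.mul_le_mul_left _ h4)))
    _ = _ := by ring

/-- Only one factor may contain `B`. This covers a loop over a large parameter with a polynomial
body as well as a loop over a small parameter with a linear body, but not two nested large loops. -/
theorem mul_poly (hf : LinearCost f) (hg : PolyCost g) : LinearCost fun ρ => f ρ * g ρ := by
  obtain ⟨c, hc⟩ := hf
  obtain ⟨c', hc'⟩ := hg
  refine ⟨c + c' + c * c', fun ρ Z B h h' hB => ?_⟩
  calc f ρ * g ρ ≤ (c * (Z + 1) ^ c * B) * (c' * (Z + 1) ^ c') :=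
        Nat.mul_le_mul (hc ρ Z B h h' hB) (hc' ρ Z h)
    _ = c * c' * (Z + 1) ^ (c + c') * B := by ring
    _ ≤ _ := Nat.mul_le_mul_right _
      (Nat.mul_le_mul (by omega) (Nat.pow_le_pow_right (by omega) (by omega)))

theorem param {P : ℕ} (hP : P < 20) : LinearCost fun ρ => ρ P :=
  ⟨1, fun ρ Z B _ h _ => (h P hP).trans (Nat.mul_le_mul_right _ (by simp))⟩

end LinearCost

/-- All loops are bounded by parameters below 10. -/
def Exp.small : Exp → Bool
  | .lit _ => true
  | .var _ => true
  | .add e f => e.small && f.small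
  | .sub e f => e.small && f.small
  | .mulv e P => decide (P < 10) && e.small
  | .get _ e => e.small
  | .ite c e f => c.small && (e.small && f.small)
  | .sum _ P e => decide (P < 10) && e.small

theorem Exp.polyCost {e : Exp} (h : e.small = true) : PolyCost e.cost := by
  induction e with
  | lit c => exact .const _
  | var x => exact .const _
  | add e f ihe ihf =>
    simp only [small, Bool.and_eq_true] at h
    exact ((ihe h.1).add (ihf h.2)).add (.const 1)
  | sub e f ihe ihf =>
    simp only [small, Bool.and_eq_true] at h
    exact ((ihe h.1).add (ihf h.2)).add (.const 1)
  | mulv e P ihe =>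
    simp only [small, Bool.and_eq_true, decide_eq_true_eq] at h
    exact (ihe h.2).add (((PolyCost.param h.1).mul (.const 3)).add (.const 7))
  | get A e ihe => simp only [small] at h; exact (ihe h).add (.const 1)
  | ite c e f ihc ihe ihf =>
    simp only [small, Bool.and_eq_true] at h
    exact ((ihc h.1).add ((ihe h.2.1).add (ihf h.2.2))).add (.const 1)
  | sum x P e ihe =>
    simp only [small, Bool.and_eq_true, decide_eq_true_eq] at h
    exact ((PolyCost.param h.1).mul ((ihe h.2).add (.const 5))).add (.const 5)

/-- All loops are bounded by parameters below 10. -/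
def Stmt.small : Stmt → Bool
  | .put _ e f => e.small && f.small
  | .seq s t => s.small && t.small
  | .ite c s t => c.small && (s.small && t.small)
  | .forv _ P s => decide (P < 10) && s.small
  | .letv _ e s => e.small && s.small

/-- Of the loops that are bounded by parameters from 10 on, none is inside another. -/
def Stmt.linear : Stmt → Bool
  | .put _ e f => e.small && f.small
  | .seq s t => s.linear && t.linear
  | .ite c s t => c.small && (s.linear && t.linear)
  | .forv _ P s => if P < 10 then s.linear else decide (P < 20) && s.small
  | .letv _ e s => e.small && s.linear

theorem Stmt.polyCost {p : Stmt} (h : p.small = true) : PolyCost p.cost := by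
  induction p with
  | put A e f =>
    simp only [small, Bool.and_eq_true] at h
    exact ((Exp.polyCost h.1).add (Exp.polyCost h.2)).add (.const 1)
  | seq s t ihs iht =>
    simp only [small, Bool.and_eq_true] at h
    exact (ihs h.1).add (iht h.2)
  | ite c s t ihs iht =>
    simp only [small, Bool.and_eq_true] at h
    exact ((Exp.polyCost h.1).add ((ihs h.2.1).add (iht h.2.2))).add (.const 1)
  | forv x P s ih =>
    simp only [small, Bool.and_eq_true, decide_eq_true_eq] at h
    exact ((PolyCost.param h.1).mul ((ih h.2).add (.const 4))).add (.const 4)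
  | letv x e s ih =>
    simp only [small, Bool.and_eq_true] at h
    exact ((Exp.polyCost h.1).add (ih h.2)).add (.const 2)

theorem Stmt.linearCost {p : Stmt} (h : p.linear = true) : LinearCost p.cost := by
  induction p with
  | put A e f =>
    simp only [linear, Bool.and_eq_true] at h
    exact (((Exp.polyCost h.1).add (Exp.polyCost h.2)).add (.const 1)).linear
  | seq s t ihs iht =>
    simp only [linear, Bool.and_eq_true] at h
    exact (ihs h.1).add (iht h.2)
  | ite c s t ihs iht =>
    simp only [linear, Bool.and_eq_true] at h
    exact ((Exp.polyCost h.1).linear.add ((ihs h.2.1).add (iht h.2.2))).add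
      (PolyCost.const 1).linear
  | forv x P s ih =>
    simp only [linear] at h
    split_ifs at h with hP
    · have := (((ih h).add (PolyCost.const 4).linear).mul_poly (PolyCost.param hP)).add
        (PolyCost.const 4).linear
      simpa only [cost, mul_comm] using this
    · simp only [Bool.and_eq_true, decide_eq_true_eq] at h
      exact ((LinearCost.param h.1).mul_poly ((Stmt.polyCost h.2).add (.const 4))).add
        (PolyCost.const 4).linear
  | letv x e s ih =>
    simp only [linear, Bool.and_eq_true] at h
    exact ((Exp.polyCost h.1).linear.add (ih h.2)).add (PolyCost.const 2).linear

/-! ### Arrays that are read and written -/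

/-- The expression reads the array `B`. -/
def Exp.reads (B : ℕ) : Exp → Bool
  | .lit _ => false
  | .var _ => false
  | .add e f => e.reads B || f.reads B
  | .sub e f => e.reads B || f.reads B
  | .mulv e _ => e.reads B
  | .get A e => decide (A = B) || e.reads B
  | .ite c e f => c.reads B || (e.reads B || f.reads B)
  | .sum _ _ e => e.reads B

theorem Exp.eval_congr_mem {e : Exp} {ρ : ℕ → ℕ} {m m' : ℕ → ℕ → ℕ}
    (h : ∀ B, e.reads B = true → m B = m' B) : e.eval ρ m = e.eval ρ m' := by
  induction e generalizing ρ with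
  | lit c => rfl
  | var x => rfl
  | add e f ihe ihf =>
    simp [eval, ihe fun B hB => h B (by simp [reads, hB]),
      ihf fun B hB => h B (by simp [reads, hB])]
  | sub e f ihe ihf =>
    simp [eval, ihe fun B hB => h B (by simp [reads, hB]),
      ihf fun B hB => h B (by simp [reads, hB])]
  | mulv e P ihe => simp [eval, ihe fun B hB => h B (by simp [reads, hB])]
  | get A e ihe =>
    simp [eval, ihe fun B hB => h B (by simp [reads, hB]), h A (by simp [reads])]
  | ite c e f ihc ihe ihf =>
    simp [eval, ihc fun B hB => h B (by simp [reads, hB]),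
      ihe fun B hB => h B (by simp [reads, hB]), ihf fun B hB => h B (by simp [reads, hB])]
  | sum x P e ihe => simp [eval, ihe fun B hB => h B (by simp [reads, hB])]

/-- The statement writes to the array `B`. -/
def Stmt.writes (B : ℕ) : Stmt → Bool
  | .put A _ _ => decide (A = B)
  | .seq s t => s.writes B || t.writes B
  | .ite _ s t => s.writes B || t.writes B
  | .forv _ _ s => s.writes B
  | .letv _ _ s => s.writes B

/-- The frame rule. As `writes` is computed by evaluation, its hypothesis is usually discharged by
`rfl` for concrete parts of the program, which carries the contents of arrays past the phases that
leave them alone. -/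
theorem Stmt.run_of_not_writes {p : Stmt} {B : ℕ} {ρ : ℕ → ℕ} {m : ℕ → ℕ → ℕ}
    (h : p.writes B = false) : p.run ρ m B = m B := by
  induction p generalizing ρ m with
  | put A e f =>
    simp only [writes, decide_eq_false_iff_not] at h
    simp [run, Function.update_of_ne (Ne.symm h)]
  | seq s t ihs iht =>
    simp only [writes, Bool.or_eq_false_iff] at h
    simp [run, iht h.2, ihs h.1]
  | ite c s t ihs iht =>
    simp only [writes, Bool.or_eq_false_iff] at h
    simp only [run]
    split_ifs
    · exact ihs h.1
    · exact iht h.2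
  | forv x P s ih =>
    simp only [writes] at h
    simp only [run]
    induction ρ P with
    | zero => rfl
    | succ n ihn => simp only [ih h, ihn]
  | letv x e s ih => simp only [writes] at h; simp [run, ih h]

/-- Reasoning on a loop by an invariant. -/
theorem Stmt.run_forv_induction {x P : ℕ} {p : Stmt} {ρ : ℕ → ℕ} {m : ℕ → ℕ → ℕ}
    (I : ℕ → (ℕ → ℕ → ℕ) → Prop) (h0 : I 0 m)
    (hs : ∀ i m', i < ρ P → I i m' → I (i + 1) (p.run (Function.update ρ x i) m')) :
    I (ρ P) ((Stmt.forv x P p).run ρ m) := by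
  simp only [run]
  have : ∀ i ≤ ρ P, I i (Nat.rec m (fun i m' => p.run (Function.update ρ x i) m') i) := by
    intro i
    induction i with
    | zero => exact fun _ => h0
    | succ i ih => exact fun hi => hs i _ (by omega) (ih (by omega))
  exact this _ le_rfl

/-! ### Tabulation -/

/-- Nested loops over the parameters `L`, with variables `k + 1`, `k + 3`, …, that enter the values
of `e` into the array `A`; the variables `k + 2`, `k + 4`, … hold the positions of the entries. -/
def Stmt.tabFrom (A : ℕ) (e : Exp) : ℕ → List ℕ → Stmt
  | k, [] => .put A (.var k) e
  | k, P :: L => .forv (k + 1) P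
      (.letv (k + 2) (.add (.mulv (.var k) P) (.var (k + 1))) (tabFrom A e (k + 2) L))

/-- Enter the values of `e` into `A`; the indices are the variables 21, 23, …. -/
def Stmt.tab (A : ℕ) : List ℕ → Exp → Stmt
  | [], e => .letv 20 (.lit 0) (.tabFrom A e 20 [])
  -- The outermost position is the index itself. The product `0 * P` that `tabFrom` would form is
  -- avoided, because `P` may be a large parameter and multiplication by it would violate the
  -- criterion for linear cost.
  | P :: L, e => .letv 20 (.lit 0) (.forv 21 P (.letv 22 (.var 21) (.tabFrom A e 22 L)))

/-- The environment in which `Stmt.tabFrom` evaluates the entry with indices `vs`. -/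
def tabEnv : ℕ → List ℕ → (ℕ → ℕ) → List ℕ → (ℕ → ℕ)
  | k, P :: L, ρ, v :: vs =>
    tabEnv (k + 2) L
      (Function.update (Function.update ρ (k + 1) v) (k + 2) (ρ k * ρ P + v)) vs
  | _, _, ρ, _ => ρ

/-- The position of the entry with indices `vs`. -/
def tabPos (ρ : ℕ → ℕ) : ℕ → List ℕ → List ℕ → ℕ
  | α, P :: L, v :: vs => tabPos ρ (α * ρ P + v) L vs
  | α, _, _ => α

/-- The number of entries. -/
def tabSize (ρ : ℕ → ℕ) (L : List ℕ) : ℕ := (L.map ρ).prod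

/-- Positions are numbers in a mixed radix system: the entries with prefix `α` fill the block from
`α * tabSize ρ L` up to the next multiple. Different prefixes therefore write into disjoint blocks.
-/
theorem tabPos_bounds {ρ : ℕ → ℕ} {L vs : List ℕ} (h : List.Forall₂ (fun P v => v < ρ P) L vs) :
    ∀ α, α * tabSize ρ L ≤ tabPos ρ α L vs ∧ tabPos ρ α L vs < (α + 1) * tabSize ρ L := by
  induction h with
  | nil => intro α; simp [tabPos, tabSize]
  | @cons P v L vs hv h ih =>
    intro α
    obtain ⟨h1, h2⟩ := ih (α * ρ P + v)
    simp only [tabPos, tabSize, List.map_cons, List.prod_cons] at *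
    constructor
    · calc _ = α * ρ P * (List.map ρ L).prod := by ring
        _ ≤ (α * ρ P + v) * (List.map ρ L).prod := Nat.mul_le_mul_right _ (by omega)
        _ ≤ _ := h1
    · calc _ < _ := h2
        _ ≤ ((α + 1) * ρ P) * (List.map ρ L).prod :=
          Nat.mul_le_mul_right _ (by rw [add_mul]; omega)
        _ = _ := by ring

theorem tabPos_congr {ρ ρ' : ℕ → ℕ} {L : List ℕ} (h : ∀ P ∈ L, ρ P = ρ' P) :
    ∀ α vs, tabPos ρ α L vs = tabPos ρ' α L vs := by
  induction L with
  | nil => intro α vs; simp [tabPos]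
  | cons P L ih =>
    intro α vs
    cases vs with
    | nil => simp [tabPos]
    | cons v vs =>
      simp only [tabPos, h P (by simp)]
      exact ih (fun P hP => h P (by simp [hP])) _ _

theorem Stmt.writes_tabFrom {A B : ℕ} (h : B ≠ A) (e : Exp) (L : List ℕ) :
    ∀ k, (tabFrom A e k L).writes B = false := by
  induction L with
  | nil => intro k; simp [tabFrom, writes, h.symm]
  | cons P L ih => intro k; simp [tabFrom, writes, ih]

/-- The two claims need each other in the induction: that nothing outside the block is changed shows
that later rounds do not overwrite the entries of earlier ones. Since `e` does not read the array
under construction, each entry has the value of `e` in the original memory. -/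
theorem Stmt.run_tabFrom {A : ℕ} {e : Exp} (he : e.reads A = false) {L : List ℕ}
    (hL : ∀ P ∈ L, P < 20) : ∀ (k : ℕ) (ρ : ℕ → ℕ) (m : ℕ → ℕ → ℕ), 20 ≤ k →
      (∀ y, (y < ρ k * tabSize ρ L ∨ (ρ k + 1) * tabSize ρ L ≤ y) →
        (tabFrom A e k L).run ρ m A y = m A y) ∧
      ∀ vs, List.Forall₂ (fun P v => v < ρ P) L vs →
        (tabFrom A e k L).run ρ m A (tabPos ρ (ρ k) L vs) = e.eval (tabEnv k L ρ vs) m := by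
  induction L with
  | nil =>
    intro k ρ m hk
    refine ⟨fun y hy => ?_, fun vs hvs => ?_⟩
    · have : y ≠ ρ k := by simp [tabSize] at hy; omega
      simp [tabFrom, run, Exp.eval, this]
    · cases hvs
      simp [tabFrom, run, Exp.eval, tabPos, tabEnv]
  | cons P L ih =>
    intro k ρ m hk
    have hP : P < 20 := hL P (by simp)
    have ih' := ih fun P hP => hL P (by simp [hP])
    have hsize : ∀ a b, tabSize (Function.update (Function.update ρ (k + 1) a) (k + 2) b) L
        = tabSize ρ L := by
      intro a b
      unfold tabSize
      congr 1
      refine List.map_congr_left fun P' hP' => ?_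
      have := hL P' (by simp [hP'])
      rw [Function.update_of_ne (by omega), Function.update_of_ne (by omega)]
    have hsz : tabSize ρ (P :: L) = ρ P * tabSize ρ L := by simp [tabSize]
    have key := run_forv_induction (x := k + 1) (P := P) (ρ := ρ) (m := m)
      (p := .letv (k + 2) (.add (.mulv (.var k) P) (.var (k + 1))) (tabFrom A e (k + 2) L))
      (fun i m' => (∀ B, B ≠ A → m' B = m B) ∧
        (∀ y, (y < ρ k * ρ P * tabSize ρ L ∨ (ρ k * ρ P + i) * tabSize ρ L ≤ y) →
          m' A y = m A y) ∧
        ∀ v < i, ∀ vs, List.Forall₂ (fun P v => v < ρ P) L vs →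
          m' A (tabPos ρ (ρ k * ρ P + v) L vs) =
            e.eval (tabEnv k (P :: L) ρ (v :: vs)) m)
      ⟨fun _ _ => rfl, fun _ _ => rfl, fun v hv => absurd hv (by omega)⟩
      (by
        rintro i m' hi ⟨h1, h2, h3⟩
        have e1 : k ≠ k + 1 := by omega
        have e2 : P ≠ k + 1 := by omega
        simp only [run, Exp.eval, Function.update_self, Function.update_of_ne e1,
          Function.update_of_ne e2]
        set ρ' := Function.update (Function.update ρ (k + 1) i) (k + 2) (ρ k * ρ P + i) with hρ'
        have hk2 : ρ' (k + 2) = ρ k * ρ P + i := by simp [hρ']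
        have hρL : ∀ P' ∈ L, ρ' P' = ρ P' := by
          intro P' hP'
          have := hL P' (by simp [hP'])
          rw [hρ', Function.update_of_ne (by omega), Function.update_of_ne (by omega)]
        obtain ⟨g1, g2⟩ := ih' (k + 2) ρ' m' (by omega)
        rw [hk2, hρ', hsize, ← hρ'] at g1
        rw [hk2] at g2
        refine ⟨fun B hB => ?_, fun y hy => ?_, fun v hv vs hvs => ?_⟩
        · rw [run_of_not_writes (writes_tabFrom hB _ _ _), h1 B hB]
        · rw [g1, h2]
          · rcases hy with hy | hy
            · exact .inl hy
            · right
              refine le_trans (Nat.mul_le_mul_right _ (by omega)) hy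
          · rcases hy with hy | hy
            · left
              exact lt_of_lt_of_le hy (Nat.mul_le_mul_right _ (by omega))
            · exact .inr hy
        · rcases Nat.lt_succ_iff_lt_or_eq.1 hv with hv | rfl
          · rw [g1, h3 v hv vs hvs]
            left
            refine lt_of_lt_of_le (tabPos_bounds hvs _).2 (Nat.mul_le_mul_right _ (by omega))
          · have := g2 vs (by
              refine List.forall₂_iff_get.2 ?_
              obtain ⟨ha, hb⟩ := List.forall₂_iff_get.1 hvs
              refine ⟨ha, fun i h₁ h₂ => ?_⟩
              rw [hρL _ (List.get_mem _ _)]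
              exact hb i h₁ h₂)
            rw [tabPos_congr hρL] at this
            rw [this]
            simp only [tabEnv]
            refine Exp.eval_congr_mem fun B hB => h1 B ?_
            rintro rfl
            simp [he] at hB)
    obtain ⟨-, h2, h3⟩ := key
    refine ⟨fun y hy => h2 y ?_, fun vs hvs => ?_⟩
    · rw [hsz] at hy
      rcases hy with hy | hy
      · left; rwa [mul_assoc]
      · right
        calc _ = (ρ k + 1) * (ρ P * tabSize ρ L) := by ring
          _ ≤ _ := hy
    · cases hvs with
      | cons hv hvs => exact h3 _ hv _ hvs

theorem Stmt.run_tab_eq (A : ℕ) (L : List ℕ) (e : Exp) (ρ : ℕ → ℕ) (m : ℕ → ℕ → ℕ) :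
    (tab A L e).run ρ m = (tabFrom A e 20 L).run (Function.update ρ 20 0) m := by
  cases L with
  | nil => rfl
  | cons P L => simp [tab, tabFrom, run, Exp.eval]

theorem Stmt.run_tab {A : ℕ} {e : Exp} (he : e.reads A = false) {L : List ℕ}
    (hL : ∀ P ∈ L, P < 20) (ρ : ℕ → ℕ) (m : ℕ → ℕ → ℕ) {vs : List ℕ}
    (hvs : List.Forall₂ (fun P v => v < ρ P) L vs) :
    (tab A L e).run ρ m A (tabPos ρ 0 L vs) =
      e.eval (tabEnv 20 L (Function.update ρ 20 0) vs) m := by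
  have hρL : ∀ P ∈ L, Function.update ρ 20 0 P = ρ P := fun P hP => by
    have := hL P hP
    rw [Function.update_of_ne (by omega)]
  have := (run_tabFrom he hL 20 (Function.update ρ 20 0) m le_rfl).2 vs (by
    refine List.forall₂_iff_get.2 ?_
    obtain ⟨ha, hb⟩ := List.forall₂_iff_get.1 hvs
    refine ⟨ha, fun i h₁ h₂ => ?_⟩
    rw [hρL _ (List.get_mem _ _)]
    exact hb i h₁ h₂)
  rwa [tabPos_congr hρL, Function.update_self, ← run_tab_eq] at this

end RAM

end Shielding

namespace Shielding

namespace RAM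

/-! ### Derived expressions -/

namespace Exp

/-- The expression is nonzero. -/
def Holds (e : Exp) (ρ : ℕ → ℕ) (m : ℕ → ℕ → ℕ) : Prop := e.eval ρ m ≠ 0

/-- Negation. -/
def not (e : Exp) : Exp := ite e (lit 0) (lit 1)

/-- Conjunction. -/
def and (e f : Exp) : Exp := ite e f (lit 0)

/-- Disjunction. -/
def or (e f : Exp) : Exp := ite e (lit 1) f

/-- Comparison. -/
def lt (e f : Exp) : Exp := sub f e

/-- Equality. -/
def eq (e f : Exp) : Exp := not (add (sub e f) (sub f e))

/-- Existential quantification over the values below a parameter. -/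
def any (x P : ℕ) (e : Exp) : Exp := sum x P e

/-- Universal quantification over the values below a parameter. -/
def all (x P : ℕ) (e : Exp) : Exp := not (sum x P (not e))

/-- The least value of `x` below `P` with `e`, or else `P`: the number of values of `y` such that
`e` fails for all `x ≤ y`. -/
def find (x y P : ℕ) (e : Exp) : Exp :=
  sum y P (all x P (or (lt (var y) (var x)) (not e)))

variable {ρ : ℕ → ℕ} {m : ℕ → ℕ → ℕ}

@[simp] theorem holds_not {e : Exp} : (not e).Holds ρ m ↔ ¬ e.Holds ρ m := by
  by_cases h : e.eval ρ m = 0 <;> simp [Holds, not, eval, h]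

@[simp] theorem holds_and {e f : Exp} : (and e f).Holds ρ m ↔ e.Holds ρ m ∧ f.Holds ρ m := by
  by_cases h : e.eval ρ m = 0 <;> simp [Holds, and, eval, h]

@[simp] theorem holds_or {e f : Exp} : (or e f).Holds ρ m ↔ e.Holds ρ m ∨ f.Holds ρ m := by
  by_cases h : e.eval ρ m = 0 <;> simp [Holds, or, eval, h]

@[simp] theorem holds_lt {e f : Exp} : (lt e f).Holds ρ m ↔ e.eval ρ m < f.eval ρ m := by
  simp only [Holds, lt, eval]; omega

@[simp] theorem holds_eq {e f : Exp} : (eq e f).Holds ρ m ↔ e.eval ρ m = f.eval ρ m := by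
  rw [eq, holds_not]; simp only [Holds, eval]; omega

@[simp] theorem holds_get {A : ℕ} {e : Exp} : (get A e).Holds ρ m ↔ m A (e.eval ρ m) ≠ 0 :=
  Iff.rfl

@[simp] theorem holds_any {x P : ℕ} {e : Exp} :
    (any x P e).Holds ρ m ↔ ∃ i < ρ P, e.Holds (Function.update ρ x i) m := by
  simp [Holds, any, eval, Finset.sum_eq_zero_iff]

@[simp] theorem holds_all {x P : ℕ} {e : Exp} :
    (all x P e).Holds ρ m ↔ ∀ i < ρ P, e.Holds (Function.update ρ x i) m := by
  rw [all, holds_not]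
  change ¬ (any x P (not e)).Holds ρ m ↔ _
  simp

theorem eval_ite_of {c e f : Exp} [Decidable (c.Holds ρ m)] :
    (ite c e f).eval ρ m = if c.Holds ρ m then e.eval ρ m else f.eval ρ m := by
  simp only [eval, Holds]
  congr

theorem eval_not_le (e : Exp) : (not e).eval ρ m ≤ 1 := by
  simp only [not, eval]; split_ifs <;> omega

/-- A property of a least number below `n` satisfying a predicate. -/
theorem _root_.Finset.card_filter_forall_le_not {n : ℕ} {p : ℕ → Prop} [DecidablePred p] {i : ℕ}
    (hi : i < n) (hp : p i) :
    p (((Finset.range n).filter fun y => ∀ x < n, x ≤ y → ¬ p x).card) ∧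
      ((Finset.range n).filter fun y => ∀ x < n, x ≤ y → ¬ p x).card < n := by
  have hex : ∃ i, p i := ⟨i, hp⟩
  have hle : Nat.find hex ≤ i := Nat.find_min' hex hp
  have : ((Finset.range n).filter fun y => ∀ x < n, x ≤ y → ¬ p x) =
      Finset.range (Nat.find hex) := by
    ext y
    simp only [Finset.mem_filter, Finset.mem_range]
    constructor
    · rintro ⟨-, h⟩
      by_contra hy
      exact h _ (by omega) (not_lt.1 hy) (Nat.find_spec hex)
    · exact fun h => ⟨by omega, fun x _ hx => Nat.find_min hex (by omega)⟩
  rw [this, Finset.card_range]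
  exact ⟨Nat.find_spec hex, by omega⟩

/-- The values of `y` that are counted are those below the least witness, so their number is this
witness. The counter is in scope while `e` is evaluated, whence the hypothesis that `e` is
insensitive to it. -/
theorem eval_find {x y P : ℕ} {e : Exp} (hxy : x ≠ y) (hPy : P ≠ y)
    (he : ∀ i < ρ P, ∀ j, e.Holds (Function.update (Function.update ρ y j) x i) m ↔
      e.Holds (Function.update ρ x i) m)
    {i : ℕ} (hi : i < ρ P) (h : e.Holds (Function.update ρ x i) m) :
    e.Holds (Function.update ρ x ((find x y P e).eval ρ m)) m ∧
      (find x y P e).eval ρ m < ρ P := by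
  classical
  have : (find x y P e).eval ρ m = ((Finset.range (ρ P)).filter fun y => ∀ x' < ρ P, x' ≤ y →
      ¬ e.Holds (Function.update ρ x x') m).card := by
    rw [Finset.card_filter]
    simp only [find, eval]
    refine Finset.sum_congr rfl fun j _ => ?_
    set E := all x P (or (lt (var y) (var x)) (not e)) with hE
    have h1 : E.eval (Function.update ρ y j) m ≤ 1 := eval_not_le _
    have h2 : E.Holds (Function.update ρ y j) m ↔ ∀ x' < ρ P, x' ≤ j →
        ¬ e.Holds (Function.update ρ x x') m := by
      simp only [hE, holds_all, holds_or, holds_lt, holds_not, eval, Function.update_self,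
        Function.update_of_ne hPy, Function.update_of_ne hxy.symm]
      refine forall_congr' fun x' => forall_congr' fun hx' => ?_
      rw [he x' hx' j, ← not_le, imp_iff_not_or]
    split_ifs with h3
    · have := h2.2 h3
      unfold Holds at this; omega
    · have := mt h2.1 h3
      unfold Holds at this; omega
  rw [this]
  exact Finset.card_filter_forall_le_not (p := fun i => e.Holds (Function.update ρ x i) m) hi h

end Exp

end RAM

end Shielding

namespace Shielding

/-! ### Propagation in a set of Horn clauses

The clauses are given by edges: a rule derives its head once the targets of all its edges are
derived.  The rules without edges are ignored. -/

namespace Propagation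

/-- The rule `r` has a body, and all elements of its body are in `S`. -/
def Fires (E : Finset ℕ) (src dst : ℕ → ℕ) (S : ℕ → Prop) (r : ℕ) : Prop :=
  (∃ e ∈ E, src e = r) ∧ ∀ e ∈ E, src e = r → S (dst e)

theorem Fires.mono {E : Finset ℕ} {src dst : ℕ → ℕ} {S S' : ℕ → Prop} {r : ℕ}
    (h : Fires E src dst S r) (hS : ∀ e ∈ E, S (dst e) → S' (dst e)) : Fires E src dst S' r :=
  ⟨h.1, fun e he hr => hS e he (h.2 e he hr)⟩

/-- The list `l` is the linked list that begins with `c`; positions are shifted by one, and `0` ends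
the list. -/
def Chain (nxt : ℕ → ℕ) : ℕ → List ℕ → Prop
  | c, [] => c = 0
  | c, e :: l => c = e + 1 ∧ Chain nxt (nxt e) l

/-- The state of the propagation: the numbers of pending edges of the rules, the ranks of the
derived elements, the queue of the derived elements with its two ends, the list of pending edges of
the last element taken from the queue, and the rank of the elements that it derives. -/
structure State where
  cnt : ℕ → ℕ
  rank : ℕ → ℕ
  queue : ℕ → ℕ
  hd : ℕ
  tl : ℕ
  cur : ℕ
  nr : ℕ

/-- Process one edge, or take one element from the queue. -/
def State.step (nxt first src head : ℕ → ℕ) (s : State) : State :=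
  if s.cur ≠ 0 then
    if s.cnt (src (s.cur - 1)) - 1 = 0 ∧ s.rank (head (src (s.cur - 1))) = 0 then
      { s with
        cnt := Function.update s.cnt (src (s.cur - 1)) (s.cnt (src (s.cur - 1)) - 1)
        rank := Function.update s.rank (head (src (s.cur - 1))) s.nr
        queue := Function.update s.queue s.tl (head (src (s.cur - 1)))
        tl := s.tl + 1
        cur := nxt (s.cur - 1) }
    else
      { s with
        cnt := Function.update s.cnt (src (s.cur - 1)) (s.cnt (src (s.cur - 1)) - 1)
        cur := nxt (s.cur - 1) }
  else if s.hd < s.tl then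
    { s with hd := s.hd + 1, cur := first (s.queue s.hd), nr := s.rank (s.queue s.hd) + 1 }
  else s

/-- The invariant of the propagation; `Dn` are the processed edges, and `l` are the pending edges of
the last element taken from the queue. -/
structure Inv (E : Finset ℕ) (src dst head nxt : ℕ → ℕ) (base : ℕ → Prop) (NV NR : ℕ)
    (s : State) (Dn : Finset ℕ) (l : List ℕ) : Prop where
  chain : Chain nxt s.cur l
  nodup : l.Nodup
  -- An edge is pending or processed exactly if its target has been taken from the queue.
  mem : ∀ e, (e ∈ l ∨ e ∈ Dn) ↔ e ∈ E ∧ ∃ i < s.hd, s.queue i = dst e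
  disj : ∀ e ∈ l, e ∉ Dn
  cnt : ∀ r < NR, s.cnt r = ((E \ Dn).filter fun e => src e = r).card
  hdtl : s.hd ≤ s.tl
  inj : ∀ i < s.tl, ∀ j < s.tl, s.queue i = s.queue j → i = j
  qlt : ∀ i < s.tl, s.queue i < NV
  ranked : ∀ v < NV, s.rank v ≠ 0 ↔ ∃ i < s.tl, s.queue i = v
  -- Breadth-first order: the queue is sorted by rank, and once an element has been taken, no rank
  -- exceeds `nr`, one more than the rank of the element taken last.
  mono : ∀ i j, i ≤ j → j < s.tl → s.rank (s.queue i) ≤ s.rank (s.queue j)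
  cur0 : s.hd = 0 → ∀ i < s.tl, s.rank (s.queue i) ≤ 1
  cur1 : 0 < s.hd → s.nr = s.rank (s.queue (s.hd - 1)) + 1 ∧
    ∀ i < s.tl, s.rank (s.queue i) ≤ s.nr
  curl : ∀ e ∈ l, 0 < s.hd ∧ dst e = s.queue (s.hd - 1)
  base1 : ∀ v < NV, base v → s.rank v = 1
  loc1 : ∀ v < NV, s.rank v = 1 → base v
  -- Ranks are characterized locally: a rank `k + 2` means that some rule fires on the elements of
  -- rank at most `k + 1`, and that none does on those of rank at most `k`. Rank one is reserved for
  -- facts, rank zero for what is not yet derived.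
  loc : ∀ v < NV, ∀ k, s.rank v = k + 2 →
    (∃ r < NR, head r = v ∧ Fires E src dst (fun w => 0 < s.rank w ∧ s.rank w ≤ k + 1) r) ∧
      ¬ ∃ r < NR, head r = v ∧ Fires E src dst (fun w => 0 < s.rank w ∧ s.rank w ≤ k) r
  fired : ∀ r < NR, (∃ e ∈ E, src e = r) → (∀ e ∈ E, src e = r → e ∈ Dn) →
    s.rank (head r) ≠ 0

variable {E : Finset ℕ} {src dst head nxt first : ℕ → ℕ} {base : ℕ → Prop} {NV NR : ℕ}
  {s : State} {Dn : Finset ℕ} {l : List ℕ}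

/-- The queue lists distinct elements below `NV`, so it has at most `NV` entries; this bounds the
number of steps that take an element. -/
theorem Inv.tl_le (h : Inv E src dst head nxt base NV NR s Dn l) : s.tl ≤ NV := by
  have := Finset.card_le_card_of_injOn (s := Finset.range s.tl) (t := Finset.range NV) s.queue
    (fun i hi => by simpa using h.qlt i (by simpa using hi))
    (fun i hi j hj e => h.inj i (by simpa using hi) j (by simpa using hj) e)
  simpa using this

/-- Processing an edge, except for the effect on the head of its rule. -/
theorem Inv.process {e : ℕ} (h : Inv E src dst head nxt base NV NR s Dn (e :: l)) :
    e ∈ E ∧ e ∉ Dn ∧ s.cur = e + 1 ∧ Chain nxt (nxt e) l ∧ l.Nodup ∧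
      (∀ e', (e' ∈ l ∨ e' ∈ insert e Dn) ↔ e' ∈ E ∧ ∃ i < s.hd, s.queue i = dst e') ∧
      (∀ e' ∈ l, e' ∉ insert e Dn) ∧
      (∀ r < NR, Function.update s.cnt (src e) (s.cnt (src e) - 1) r =
        ((E \ insert e Dn).filter fun e => src e = r).card) ∧
      (E \ insert e Dn).card < (E \ Dn).card := by
  have he : e ∈ E := ((h.mem e).1 (.inl (by simp))).1
  have heD : e ∉ Dn := h.disj e (by simp)
  have hnd := List.nodup_cons.1 h.nodup
  have hsd : E \ insert e Dn = (E \ Dn).erase e := by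
    ext x; simp only [Finset.mem_sdiff, Finset.mem_insert, Finset.mem_erase]; tauto
  have hmem : e ∈ E \ Dn := by simp [he, heD]
  refine ⟨he, heD, h.chain.1, h.chain.2, hnd.2, fun e' => ?_, fun e' he' => ?_, fun r hr => ?_, ?_⟩
  · rw [← h.mem e']
    simp only [List.mem_cons, Finset.mem_insert]
    tauto
  · have := h.disj e' (by simp [he'])
    have hne : e' ≠ e := fun h => hnd.1 (h ▸ he')
    simp [this, hne]
  · rw [hsd, Finset.filter_erase]
    by_cases hre : r = src e
    · subst hre
      rw [Function.update_self, h.cnt _ hr, Finset.card_erase_of_mem (by simp [he, heD])]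
    · rw [Function.update_of_ne hre, h.cnt r hr, Finset.erase_eq_of_notMem]
      simp [Ne.symm hre]
  · rw [hsd]; exact Finset.card_erase_lt_of_mem hmem

/-- The interesting case is that the last edge of a rule with an underived head is processed.
Because the queue is sorted, all premises of the rule have rank less than `nr`, and an earlier
derivation of the head would already have been noticed; so `nr` is its correct rank. -/
theorem Inv.step_edge {e : ℕ} (h : Inv E src dst head nxt base NV NR s Dn (e :: l))
    (hsrc : ∀ e ∈ E, src e < NR) (hdst : ∀ e ∈ E, dst e < NV) (hhead : ∀ r < NR, head r < NV) :
    Inv E src dst head nxt base NV NR (s.step nxt first src head) (insert e Dn) l := by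
  obtain ⟨he, heD, hcur, hch, hnd, hmem, hdisj, hcnt, -⟩ := h.process
  obtain ⟨hhd, -⟩ := h.curl e (by simp)
  obtain ⟨hnr, hle⟩ := h.cur1 hhd
  have hcur0 : s.cur ≠ 0 := by omega
  have hcur1 : s.cur - 1 = e := by omega
  have hre : src e < NR := hsrc e he
  have hlast : s.hd - 1 < s.tl := by have := h.hdtl; omega
  have hcnte : s.cnt (src e) - 1 = ((E \ insert e Dn).filter fun e' => src e' = src e).card := by
    have := hcnt _ hre; rwa [Function.update_self] at this
  have hzero : s.cnt (src e) - 1 = 0 ↔ ∀ e' ∈ E, src e' = src e → e' ∈ insert e Dn := by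
    rw [hcnte, Finset.card_eq_zero, Finset.filter_eq_empty_iff]
    simp only [Finset.mem_sdiff, and_imp]
    exact forall_congr' fun e' => forall_congr' fun _ => by tauto
  unfold State.step
  rw [if_pos hcur0, hcur1]
  split_ifs with hc
  · obtain ⟨hc0, hrk⟩ := hc
    set v := head (src e) with hv
    have hvN : v < NV := hhead _ hre
    have hvq : ∀ i < s.tl, s.queue i ≠ v := fun i hi hq =>
      (h.ranked v hvN).2 ⟨i, hi, hq⟩ hrk
    have hq : ∀ i < s.tl, Function.update s.queue s.tl v i = s.queue i := fun i hi =>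
      Function.update_of_ne (by omega) _ _
    have hr : ∀ i < s.tl, Function.update s.rank v s.nr (s.queue i) = s.rank (s.queue i) :=
      fun i hi => Function.update_of_ne (hvq i hi) _ _
    have hpos : ∀ i < s.tl, 0 < s.rank (s.queue i) := fun i hi =>
      Nat.pos_of_ne_zero ((h.ranked _ (h.qlt i hi)).2 ⟨i, hi, rfl⟩)
    have hnrpos : 2 ≤ s.nr := by have := hpos _ hlast; omega
    -- The new element has rank `nr`, so it is invisible at every threshold below `nr`; the
    -- thresholds in `loc` are all of this kind, since no rank exceeds `nr`.
    have hsame : ∀ k, k < s.nr → ∀ w, (0 < Function.update s.rank v s.nr w ∧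
        Function.update s.rank v s.nr w ≤ k) ↔ (0 < s.rank w ∧ s.rank w ≤ k) := by
      intro k hk w
      by_cases hw : w = v
      · subst hw; rw [Function.update_self]; omega
      · rw [Function.update_of_ne hw]
    have hfires : ∀ k, k < s.nr → ∀ r, Fires E src dst (fun w =>
        0 < Function.update s.rank v s.nr w ∧ Function.update s.rank v s.nr w ≤ k) r ↔
        Fires E src dst (fun w => 0 < s.rank w ∧ s.rank w ≤ k) r := by
      intro k hk r
      simp only [hsame k hk]
    refine ⟨hch, hnd, fun e' => ?_, hdisj, hcnt, ?_, ?_, ?_, ?_, ?_, ?_, ?_, ?_, ?_, ?_, ?_, ?_⟩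
    · rw [hmem e']
      refine and_congr_right fun _ => exists_congr fun i => and_congr_right fun hi => ?_
      dsimp only at hi ⊢
      rw [hq i (by have := h.hdtl; omega)]
    · have := h.hdtl; dsimp only; omega
    · intro i hi j hj hij
      dsimp only at hi hj hij
      rcases Nat.lt_succ_iff_lt_or_eq.1 hi with hi | rfl <;>
        rcases Nat.lt_succ_iff_lt_or_eq.1 hj with hj | rfl
      · rw [hq i hi, hq j hj] at hij; exact h.inj i hi j hj hij
      · rw [hq i hi, Function.update_self] at hij; exact absurd hij (hvq i hi)
      · rw [hq j hj, Function.update_self] at hij; exact absurd hij.symm (hvq j hj)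
      · rfl
    · intro i hi
      dsimp only at hi ⊢
      rcases Nat.lt_succ_iff_lt_or_eq.1 hi with hi | rfl
      · rw [hq i hi]; exact h.qlt i hi
      · rwa [Function.update_self]
    · intro w hw
      dsimp only
      by_cases hwv : w = v
      · subst hwv
        rw [Function.update_self]
        exact ⟨fun _ => ⟨s.tl, by omega, by rw [Function.update_self]⟩, fun _ => by omega⟩
      · rw [Function.update_of_ne hwv, h.ranked w hw]
        constructor
        · rintro ⟨i, hi, rfl⟩; exact ⟨i, by omega, hq i hi⟩
        · rintro ⟨i, hi, hi'⟩
          rcases Nat.lt_succ_iff_lt_or_eq.1 hi with hi | rfl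
          · exact ⟨i, hi, by rw [← hq i hi, hi']⟩
          · rw [Function.update_self] at hi'; exact absurd hi'.symm hwv
    · intro i j hij hj
      dsimp only at hj ⊢
      rcases Nat.lt_succ_iff_lt_or_eq.1 hj with hj | rfl
      · rw [hq i (by omega), hq j hj, hr i (by omega), hr j hj]; exact h.mono i j hij hj
      · rw [Function.update_self, Function.update_self]
        rcases Nat.lt_or_ge i s.tl with hi | hi
        · rw [hq i hi, hr i hi]; exact hle i hi
        · obtain rfl : i = s.tl := by omega
          rw [Function.update_self, Function.update_self]
    · intro h0; dsimp only at h0; omega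
    · intro _
      dsimp only
      rw [hq _ hlast, hr _ hlast]
      refine ⟨hnr, fun i hi => ?_⟩
      rcases Nat.lt_succ_iff_lt_or_eq.1 hi with hi | rfl
      · rw [hq i hi, hr i hi]; exact hle i hi
      · rw [Function.update_self, Function.update_self]
    · intro e' he'
      have := h.curl e' (by simp [he'])
      dsimp only
      rwa [hq _ hlast]
    · intro w hw hb
      have h1 := h.base1 w hw hb
      have : w ≠ v := by rintro rfl; omega
      dsimp only
      rwa [Function.update_of_ne this]
    · intro w hw h1
      dsimp only at h1
      by_cases hwv : w = v
      · subst hwv; rw [Function.update_self] at h1; omega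
      · rw [Function.update_of_ne hwv] at h1; exact h.loc1 w hw h1
    · intro w hw k hk
      dsimp only at hk ⊢
      by_cases hwv : w = v
      · subst hwv
        rw [Function.update_self] at hk
        simp only [hfires (k + 1) (by omega), hfires k (by omega)]
        constructor
        · refine ⟨src e, hre, rfl, ⟨e, he, rfl⟩, fun e' he' hs => ?_⟩
          obtain ⟨-, i, hi, hi'⟩ := (hmem e').1 (.inr (hzero.1 hc0 e' he' hs))
          rw [← hi']
          have hm := h.mono i (s.hd - 1) (by omega) hlast
          exact ⟨hpos i (by omega), by omega⟩
        -- If a rule for this head fired on ranks at most `k`, its premises would precede the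
        -- element taken last, whose rank is `k + 1`. Their edges would all be processed, and
        -- `fired` would have given the head a rank before.
        · rintro ⟨r, hr, hrv, hf⟩
          refine h.fired r hr hf.1 (fun e' he' hs => ?_) (hrv ▸ hrk)
          obtain ⟨h0, hk'⟩ := hf.2 e' he' hs
          obtain ⟨i, hi, hi'⟩ := (h.ranked _ (hdst e' he')).1 (by omega)
          rcases Nat.lt_or_ge i (s.hd - 1) with hi1 | hi1
          · rcases (h.mem e').2 ⟨he', i, by omega, hi'⟩ with h2 | h2
            · have h3 := (h.curl e' h2).2
              rw [← hi'] at h3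
              have := h.inj i hi _ hlast h3
              omega
            · exact h2
          · have := h.mono _ i hi1 hi
            rw [hi'] at this
            omega
      · rw [Function.update_of_ne hwv] at hk
        have hwr : s.rank w ≤ s.nr := by
          obtain ⟨i, hi, rfl⟩ := (h.ranked w hw).1 (by omega)
          exact hle i hi
        simp only [hfires (k + 1) (by omega), hfires k (by omega)]
        exact h.loc w hw k hk
    · intro r hr hne hall
      dsimp only
      by_cases hrv : head r = v
      · rw [hrv, Function.update_self]; omega
      · rw [Function.update_of_ne hrv]
        by_cases hre' : r = src e
        · subst hre'; exact absurd rfl hrv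
        · refine h.fired r hr hne fun e' he' hs => ?_
          rcases Finset.mem_insert.1 (hall e' he' hs) with rfl | h2
          · exact absurd hs.symm hre'
          · exact h2
  · refine ⟨hch, hnd, hmem, hdisj, hcnt, h.hdtl, h.inj, h.qlt, h.ranked, h.mono, h.cur0, h.cur1,
      fun e' he' => h.curl e' (by simp [he']), h.base1, h.loc1, h.loc, fun r hr hne hall => ?_⟩
    by_cases hre' : r = src e
    · subst hre'
      intro h0
      exact hc ⟨hzero.2 hall, h0⟩
    · refine h.fired r hr hne fun e' he' hs => ?_
      rcases Finset.mem_insert.1 (hall e' he' hs) with rfl | h2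
      · exact absurd hs.symm hre'
      · exact h2

theorem Inv.step_queue (h : Inv E src dst head nxt base NV NR s Dn [])
    (hfirst : ∀ v < NV, ∃ l, Chain nxt (first v) l ∧ l.Nodup ∧ ∀ e, e ∈ l ↔ e ∈ E ∧ dst e = v)
    (hlt : s.hd < s.tl) :
    ∃ l, Inv E src dst head nxt base NV NR (s.step nxt first src head) Dn l := by
  have hcur : s.cur = 0 := h.chain
  obtain ⟨l, hl, hnd, hmem⟩ := hfirst _ (h.qlt _ hlt)
  refine ⟨l, ?_⟩
  unfold State.step
  rw [if_neg (by simp [hcur]), if_pos hlt]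
  refine ⟨hl, hnd, fun e => ?_, fun e he => ?_, h.cnt, hlt, h.inj, h.qlt, h.ranked, h.mono,
    fun h0 => by simp at h0, fun _ => ⟨by simp, fun i hi => ?_⟩, fun e he => ?_, h.base1, h.loc1,
    h.loc, h.fired⟩
  · have := h.mem e
    simp only [List.not_mem_nil, false_or] at this
    rw [hmem, this]
    dsimp only
    constructor
    · rintro (⟨h1, h2⟩ | ⟨h1, i, hi, h2⟩)
      · exact ⟨h1, s.hd, by omega, h2.symm⟩
      · exact ⟨h1, i, by omega, h2⟩
    · rintro ⟨h1, i, hi, h2⟩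
      rcases Nat.lt_succ_iff_lt_or_eq.1 hi with hi | rfl
      · exact .inr ⟨h1, i, hi, h2⟩
      · exact .inl ⟨h1, h2.symm⟩
  -- A processed edge has its target among the elements taken before, and no element occurs twice in
  -- the queue.
  · intro hD
    obtain ⟨-, i, hi, h2⟩ := (h.mem e).1 (.inr hD)
    rw [((hmem e).1 he).2] at h2
    have := h.inj i (by omega) _ hlt h2
    omega
  · dsimp only at hi ⊢
    have h1 : 0 < s.rank (s.queue s.hd) :=
      Nat.pos_of_ne_zero ((h.ranked _ (h.qlt _ hlt)).2 ⟨_, hlt, rfl⟩)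
    rcases Nat.eq_zero_or_pos s.hd with h0 | h0
    · have := h.cur0 h0 i hi; omega
    · obtain ⟨h2, h3⟩ := h.cur1 h0
      have h4 := h3 i hi
      have h5 := h.mono (s.hd - 1) s.hd (by omega) hlt
      omega
  · exact ⟨by simp, by simpa using ((hmem e).1 he).2⟩

/-- After sufficiently many steps, the propagation is complete. -/
theorem Inv.iterate (hsrc : ∀ e ∈ E, src e < NR) (hdst : ∀ e ∈ E, dst e < NV)
    (hhead : ∀ r < NR, head r < NV)
    (hfirst : ∀ v < NV, ∃ l, Chain nxt (first v) l ∧ l.Nodup ∧ ∀ e, e ∈ l ↔ e ∈ E ∧ dst e = v)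
    (n : ℕ) : ∀ (s : State) (Dn : Finset ℕ) (l : List ℕ),
      Inv E src dst head nxt base NV NR s Dn l → (NV - s.hd) + (E \ Dn).card ≤ n →
      ∃ Dn' l', Inv E src dst head nxt base NV NR ((State.step nxt first src head)^[n] s) Dn' l' ∧
        ((State.step nxt first src head)^[n] s).cur = 0 ∧
        ((State.step nxt first src head)^[n] s).hd = ((State.step nxt first src head)^[n] s).tl := by
  -- The potential `(NV - s.hd) + (E \ Dn).card` drops whenever an edge is processed or an element
  -- is taken. When nothing is pending and the queue is exhausted, a step has no effect, so surplus
  -- steps are harmless.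
  induction n with
  | zero =>
    intro s Dn l h hn
    have h1 := h.tl_le
    have h2 := h.hdtl
    refine ⟨Dn, l, h, ?_, by simp only [Function.iterate_zero, id]; omega⟩
    cases l with
    | nil => exact h.chain
    | cons e l =>
      have := (h.process).2.2.2.2.2.2.2.2
      omega
  | succ n ih =>
    intro s Dn l h hn
    rw [Function.iterate_succ_apply]
    cases l with
    | cons e l =>
      refine ih _ _ _ (h.step_edge hsrc hdst hhead) ?_
      have h1 := (h.process).2.2.2.2.2.2.2.2
      have h2 : (s.step nxt first src head).hd = s.hd := by
        have : s.cur ≠ 0 := by have := h.chain.1; omega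
        unfold State.step
        rw [if_pos this]
        split_ifs <;> rfl
      rw [h2]
      omega
    | nil =>
      by_cases hlt : s.hd < s.tl
      · obtain ⟨l, hl⟩ := h.step_queue hfirst hlt
        refine ih _ _ _ hl ?_
        have h2 : (s.step nxt first src head).hd = s.hd + 1 := by
          have : s.cur = 0 := h.chain
          unfold State.step
          rw [if_neg (by simp [this]), if_pos hlt]
        rw [h2]
        have := h.tl_le
        omega
      · have hs : s.step nxt first src head = s := by
          have : s.cur = 0 := h.chain
          unfold State.step
          rw [if_neg (by simp [this]), if_neg hlt]
        have hit : (State.step nxt first src head)^[n] (s.step nxt first src head) = s := by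
          rw [hs]; exact Function.iterate_fixed hs n
        rw [hit]
        exact ⟨Dn, [], h, h.chain, by have := h.hdtl; omega⟩

/-- The sets of elements that are derived in at most `k` rounds. -/
def derived (E : Finset ℕ) (src dst head : ℕ → ℕ) (base : ℕ → Prop) (NR : ℕ) : ℕ → ℕ → Prop
  | 0, v => base v
  | k + 1, v => base v ∨
    ∃ r < NR, head r = v ∧ Fires E src dst (derived E src dst head base NR k) r

/-- When the propagation is complete, the ranks are one more than the numbers of rounds. -/
theorem Inv.rank_iff (h : Inv E src dst head nxt base NV NR s Dn l) (hcur : s.cur = 0)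
    (hq : s.hd = s.tl) (hdst : ∀ e ∈ E, dst e < NV) (k : ℕ) :
    ∀ v < NV, (0 < s.rank v ∧ s.rank v ≤ k + 1) ↔ derived E src dst head base NR k v := by
  have hl : l = [] := by
    cases l with
    | nil => rfl
    | cons e l => have := h.chain.1; omega
  subst hl
  -- All derived elements have been taken and no edge is pending, so a rule with derived premises
  -- has only processed edges.
  have hfired : ∀ r < NR, Fires E src dst (fun w => 0 < s.rank w) r → s.rank (head r) ≠ 0 := by
    intro r hr hf
    refine h.fired r hr hf.1 fun e he hs => ?_
    obtain ⟨i, hi, hi'⟩ := (h.ranked _ (hdst e he)).1 (by have := hf.2 e he hs; omega)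
    have := (h.mem e).2 ⟨he, i, by omega, hi'⟩
    simpa using this
  induction k with
  | zero =>
    intro v hv
    simp only [derived]
    constructor
    · exact fun h1 => h.loc1 v hv (by omega)
    · intro hb; have := h.base1 v hv hb; omega
  | succ k ih =>
    intro v hv
    simp only [derived]
    have hf : ∀ r, Fires E src dst (derived E src dst head base NR k) r ↔
        Fires E src dst (fun w => 0 < s.rank w ∧ s.rank w ≤ k + 1) r := fun r =>
      ⟨fun h' => h'.mono fun e he => (ih _ (hdst e he)).2,
        fun h' => h'.mono fun e he => (ih _ (hdst e he)).1⟩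
    simp only [hf]
    constructor
    · rintro ⟨h1, h2⟩
      rcases Nat.lt_or_ge (s.rank v) 2 with h3 | h3
      · exact .inl (h.loc1 v hv (by omega))
      · obtain ⟨j, hj⟩ : ∃ j, s.rank v = j + 2 := ⟨s.rank v - 2, by omega⟩
        obtain ⟨r, hr, hrv, hr'⟩ := (h.loc v hv j hj).1
        exact .inr ⟨r, hr, hrv, hr'.mono fun e _ he => ⟨he.1, by omega⟩⟩
    · rintro (hb | ⟨r, hr, rfl, hr'⟩)
      · have := h.base1 v hv hb; omega
      · have h0 := hfired r hr (hr'.mono fun e _ he => he.1)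
        refine ⟨by omega, ?_⟩
        -- Too large a rank contradicts the minimality in `loc`, as the given rule fires on smaller
        -- ranks.
        by_contra hlt
        obtain ⟨j, hj⟩ : ∃ j, s.rank (head r) = j + 2 := ⟨s.rank (head r) - 2, by omega⟩
        exact (h.loc _ hv j hj).2 ⟨r, hr, rfl, hr'.mono fun e _ he => ⟨he.1, by omega⟩⟩

end Propagation

end Shielding

namespace Shielding

namespace Propagation

theorem Chain.congr {nxt nxt' : ℕ → ℕ} : ∀ {l : List ℕ} {c : ℕ}, Chain nxt c l →
    (∀ e ∈ l, nxt e = nxt' e) → Chain nxt' c l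
  | [], _, h, _ => h
  | e :: _, _, h, h' =>
    ⟨h.1, Chain.congr (h' e (by simp) ▸ h.2) fun e' he' => h' e' (by simp [he'])⟩

end Propagation

namespace RAM

open Exp Propagation

/-! ### The propagation as a program

Array 10 holds the heads of the rules, array 11 the bodies (shifted by one, `0` for no entry), and
array 12 the indicator function of the facts; array 13 receives the ranks.  The arrays 14 to 19 are
used for the numbers of pending edges, the linked lists of edges, the queue, the sources of the
edges and the scalars of the state. -/

/-- Do nothing of interest. -/
def skip : Stmt := .put 19 (.lit 4) (.lit 0)

/-- Initialization of the counters and lists. -/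
def initLists (NV NR : ℕ) : Stmt :=
  .seq (.forv 20 NR (.put 14 (.var 20) (.lit 0)))
    (.forv 20 NV (.seq (.put 15 (.var 20) (.lit 0)) (.put 13 (.var 20) (.lit 0))))

/-- Insertion of an edge of the rule in variable 20 at position variable 21. -/
def addEdge (D : ℕ) : Stmt :=
  .letv 22 (.add (.mulv (.var 20) D) (.var 21)) (.letv 23 (.get 11 (.var 22))
    (.ite (.var 23)
      (.seq (.put 14 (.var 20) (.add (.get 14 (.var 20)) (.lit 1)))
        (.seq (.put 16 (.var 22) (.get 15 (.sub (.var 23) (.lit 1))))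
          (.seq (.put 15 (.sub (.var 23) (.lit 1)) (.add (.var 22) (.lit 1)))
            (.put 18 (.var 22) (.var 20)))))
      skip))

/-- Insertion of all edges. -/
def addEdges (NR D : ℕ) : Stmt := .forv 20 NR (.forv 21 D (addEdge D))

/-- Initialization of the queue. -/
def initQueue (NV : ℕ) : Stmt :=
  .seq (.put 19 (.lit 0) (.lit 0)) (.seq (.put 19 (.lit 1) (.lit 0))
    (.seq (.put 19 (.lit 2) (.lit 0))
      (.forv 20 NV (.ite (.get 12 (.var 20))
        (.seq (.put 17 (.get 19 (.lit 1)) (.var 20))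
          (.seq (.put 19 (.lit 1) (.add (.get 19 (.lit 1)) (.lit 1)))
            (.put 13 (.var 20) (.lit 1))))
        skip))))

/-- One step of the propagation. -/
def propagateStep : Stmt :=
  .ite (.get 19 (.lit 2))
    (.letv 21 (.sub (.get 19 (.lit 2)) (.lit 1)) (.letv 22 (.get 18 (.var 21))
      (.seq (.put 14 (.var 22) (.sub (.get 14 (.var 22)) (.lit 1)))
        (.seq (.put 19 (.lit 2) (.get 16 (.var 21)))
          (.letv 23 (.get 10 (.var 22))
            (.ite (Exp.and (Exp.not (.get 14 (.var 22))) (Exp.not (.get 13 (.var 23))))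
              (.seq (.put 17 (.get 19 (.lit 1)) (.var 23))
                (.seq (.put 19 (.lit 1) (.add (.get 19 (.lit 1)) (.lit 1)))
                  (.put 13 (.var 23) (.get 19 (.lit 3)))))
              skip))))))
    (.ite (Exp.lt (.get 19 (.lit 0)) (.get 19 (.lit 1)))
      (.letv 21 (.get 17 (.get 19 (.lit 0)))
        (.seq (.put 19 (.lit 0) (.add (.get 19 (.lit 0)) (.lit 1)))
          (.seq (.put 19 (.lit 2) (.get 15 (.var 21)))
            (.put 19 (.lit 3) (.add (.get 13 (.var 21)) (.lit 1))))))
      skip)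

/-- The propagation with `NV` elements, `NR` rules with `D` entries each, and `IT` steps (all
numbers of parameters). -/
def propagate (NV NR D IT : ℕ) : Stmt :=
  .seq (initLists NV NR) (.seq (addEdges NR D) (.seq (initQueue NV) (.forv 20 IT propagateStep)))

/-- The state of the propagation in the memory. -/
def stateOf (m : ℕ → ℕ → ℕ) : State where
  cnt := m 14
  rank := m 13
  queue := m 17
  hd := m 19 0
  tl := m 19 1
  cur := m 19 2
  nr := m 19 3

theorem stateOf_run_propagateStep (ρ : ℕ → ℕ) (m : ℕ → ℕ → ℕ) :
    stateOf (propagateStep.run ρ m) = (stateOf m).step (m 16) (m 15) (m 18) (m 10) := by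
  unfold State.step
  by_cases h1 : m 19 2 = 0
  · by_cases h2 : m 19 0 < m 19 1
    · have h2' : m 19 1 - m 19 0 ≠ 0 := by omega
      simp [propagateStep, Stmt.run, Exp.eval, h1, Exp.lt, h2, h2', stateOf]
    · have h2' : m 19 1 - m 19 0 = 0 := by omega
      simp [propagateStep, Stmt.run, Exp.eval, h1, Exp.lt, h2, h2', stateOf, skip]
  · by_cases h2 : m 14 (m 18 (m 19 2 - 1)) - 1 = 0
    · by_cases h3 : m 13 (m 10 (m 18 (m 19 2 - 1))) = 0
      · simp [propagateStep, Stmt.run, Exp.eval, h1, Exp.and, Exp.not, h2, h3, stateOf]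
      · simp [propagateStep, Stmt.run, Exp.eval, h1, Exp.and, Exp.not, h2, h3, stateOf, skip]
    · simp [propagateStep, Stmt.run, Exp.eval, h1, Exp.and, Exp.not, h2, stateOf, skip]

/-- The linked lists, sources and heads are read but not written in the loop, so one and the same
abstract step is iterated. -/
theorem stateOf_run_forv_propagateStep {P : ℕ} (ρ : ℕ → ℕ) (m : ℕ → ℕ → ℕ) :
    stateOf ((Stmt.forv 20 P propagateStep).run ρ m) =
      (State.step (m 16) (m 15) (m 18) (m 10))^[ρ P] (stateOf m) := by
  refine (Stmt.run_forv_induction (x := 20) (P := P) (p := propagateStep) (ρ := ρ) (m := m)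
    (fun i m' => (m' 16 = m 16 ∧ m' 15 = m 15 ∧ m' 18 = m 18 ∧ m' 10 = m 10) ∧
      stateOf m' = (State.step (m 16) (m 15) (m 18) (m 10))^[i] (stateOf m))
    ⟨⟨rfl, rfl, rfl, rfl⟩, rfl⟩ ?_).2
  rintro i m' - ⟨⟨h1, h2, h3, h4⟩, h5⟩
  refine ⟨⟨?_, ?_, ?_, ?_⟩, ?_⟩
  · rw [Stmt.run_of_not_writes rfl, h1]
  · rw [Stmt.run_of_not_writes rfl, h2]
  · rw [Stmt.run_of_not_writes rfl, h3]
  · rw [Stmt.run_of_not_writes rfl, h4]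
  · rw [stateOf_run_propagateStep, h1, h2, h3, h4, h5, Function.iterate_succ_apply']

/-- The edges below `k`. -/
def edges (body : ℕ → ℕ) (k : ℕ) : Finset ℕ := (Finset.range k).filter fun e => body e ≠ 0

theorem edges_succ (body : ℕ → ℕ) (k : ℕ) :
    edges body (k + 1) = if body k ≠ 0 then insert k (edges body k) else edges body k := by
  simp only [edges, Finset.range_add_one, Finset.filter_insert]

/-- The counters and lists in `m'` represent the edges below `k` of `m`. -/
def Represents (NV NR D : ℕ) (m : ℕ → ℕ → ℕ) (k : ℕ) (m' : ℕ → ℕ → ℕ) : Prop :=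
  (∀ B, B ≠ 14 → B ≠ 15 → B ≠ 16 → B ≠ 18 → B ≠ 19 → m' B = m B) ∧
  (∀ r < NR, m' 14 r = ((edges (m 11) k).filter fun e => e / D = r).card) ∧
  (∀ v < NV, ∃ l, Chain (m' 16) (m' 15 v) l ∧ l.Nodup ∧
    ∀ e, e ∈ l ↔ e ∈ edges (m 11) k ∧ m 11 e - 1 = v) ∧
  ∀ e ∈ edges (m 11) k, m' 18 e = e / D

/-- The new edge is put in front of the list of its target. It lies on none of the existing lists,
so changing its successor cell leaves them intact. -/
theorem Represents.run_addEdge {NV NR D : ℕ} (hD : D < 20) {ρ : ℕ → ℕ} {m m' : ℕ → ℕ → ℕ}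
    {r j : ℕ} (hj : j < ρ D) (hbody : m 11 (r * ρ D + j) ≤ NV)
    (h : Represents NV NR (ρ D) m (r * ρ D + j) m') :
    Represents NV NR (ρ D) m (r * ρ D + j + 1)
      ((addEdge D).run (Function.update (Function.update ρ 20 r) 21 j) m') := by
  obtain ⟨h1, h2, h3, h4⟩ := h
  have hD0 : 0 < ρ D := by omega
  have hdiv : (r * ρ D + j) / ρ D = r := by
    rw [mul_comm, Nat.mul_add_div hD0, Nat.div_eq_of_lt hj, add_zero]
  have hD20 : D ≠ 20 := by omega
  have hD21 : D ≠ 21 := by omega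
  have h11 : m' 11 = m 11 := h1 11 (by decide) (by decide) (by decide) (by decide) (by decide)
  set k := r * ρ D + j with hk
  by_cases hb : m 11 k = 0
  · have hrun : (addEdge D).run (Function.update (Function.update ρ 20 r) 21 j) m' =
        Function.update m' 19 (Function.update (m' 19) 4 0) := by
      simp [addEdge, Stmt.run, Exp.eval, hD20, hD21, h11, ← hk, hb, skip]
    rw [hrun]
    have hE : edges (m 11) (k + 1) = edges (m 11) k := by simp [edges_succ, hb]
    refine ⟨fun B b1 b2 b3 b4 b5 => ?_, ?_, ?_, ?_⟩
    · rw [Function.update_of_ne b5, h1 B b1 b2 b3 b4 b5]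
    · simpa [hE] using h2
    · simpa [hE] using h3
    · simpa [hE] using h4
  · have hE : edges (m 11) (k + 1) = insert k (edges (m 11) k) := by simp [edges_succ, hb]
    have hkE : k ∉ edges (m 11) k := by simp [edges]
    set v := m 11 k - 1 with hv
    have hrun : (addEdge D).run (Function.update (Function.update ρ 20 r) 21 j) m' =
        Function.update (Function.update (Function.update (Function.update m'
          14 (Function.update (m' 14) r (m' 14 r + 1)))
          16 (Function.update (m' 16) k (m' 15 v)))
          15 (Function.update (m' 15) v (k + 1)))
          18 (Function.update (m' 18) k r) := by
      simp [addEdge, Stmt.run, Exp.eval, hD20, hD21, h11, ← hk, hb, ← hv]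
    rw [hrun]
    refine ⟨fun B b1 b2 b3 b4 b5 => ?_, fun r' hr' => ?_, fun w hw => ?_, fun e he => ?_⟩
    · rw [Function.update_of_ne b4, Function.update_of_ne b2, Function.update_of_ne b3,
        Function.update_of_ne b1, h1 B b1 b2 b3 b4 b5]
    · rw [hE, Finset.filter_insert]
      by_cases hrr : r' = r
      · subst hrr
        rw [if_pos hdiv, Finset.card_insert_of_notMem (by simp [hkE]), ← h2 r' hr']
        simp
      · rw [if_neg (by omega), ← h2 r' hr']
        simp [hrr]
    · have hnk : ∀ l : List ℕ, (∀ e, e ∈ l ↔ e ∈ edges (m 11) k ∧ m 11 e - 1 = w) →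
          ∀ e ∈ l, m' 16 e = Function.update (m' 16) k (m' 15 v) e := by
        intro l hl e he
        rw [Function.update_of_ne]
        rintro rfl
        exact hkE ((hl k).1 he).1
      obtain ⟨l, hl, hnd, hmem⟩ := h3 w hw
      by_cases hwv : w = v
      · subst hwv
        refine ⟨k :: l, ⟨by simp, ?_⟩, ?_, fun e => ?_⟩
        · simpa using hl.congr (hnk l hmem)
        · refine List.nodup_cons.2 ⟨fun hc => hkE ((hmem k).1 hc).1, hnd⟩
        · rw [hE, List.mem_cons, hmem, Finset.mem_insert]
          constructor
          · rintro (rfl | h)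
            · exact ⟨.inl rfl, rfl⟩
            · exact ⟨.inr h.1, h.2⟩
          · rintro ⟨rfl | h, h'⟩
            · exact .inl rfl
            · exact .inr ⟨h, h'⟩
      · refine ⟨l, ?_, hnd, fun e => ?_⟩
        · simpa [hwv] using hl.congr (hnk l hmem)
        · rw [hE, hmem, Finset.mem_insert]
          constructor
          · exact fun h => ⟨.inr h.1, h.2⟩
          · rintro ⟨rfl | h, h'⟩
            · exact absurd h'.symm hwv
            · exact ⟨h, h'⟩
    · rw [hE, Finset.mem_insert] at he
      by_cases hek : e = k
      · subst hek; simp [hdiv]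
      · simpa [hek] using h4 e (he.resolve_left hek)

theorem Represents.run_addEdges {NV NR D : ℕ} (hD : D < 20) {ρ : ℕ → ℕ}
    {m m' : ℕ → ℕ → ℕ} (hbody : ∀ e < ρ NR * ρ D, m 11 e ≤ NV)
    (h : Represents NV (ρ NR) (ρ D) m 0 m') :
    Represents NV (ρ NR) (ρ D) m (ρ NR * ρ D) ((addEdges NR D).run ρ m') := by
  refine Stmt.run_forv_induction (I := fun i m' => Represents NV (ρ NR) (ρ D) m (i * ρ D) m')
    (by simpa using h) fun r m₁ hr hm₁ => ?_
  have hD20 : Function.update ρ 20 r D = ρ D := Function.update_of_ne (by omega) _ _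
  have := Stmt.run_forv_induction (x := 21) (P := D) (p := addEdge D)
    (ρ := Function.update ρ 20 r) (m := m₁)
    (I := fun j m' => Represents NV (ρ NR) (ρ D) m (r * ρ D + j) m') (by simpa using hm₁)
    (fun j m₂ hj hm₂ => by
      rw [hD20] at hj
      refine hm₂.run_addEdge hD hj (hbody _ ?_)
      calc r * ρ D + j < (r + 1) * ρ D := by rw [add_mul]; omega
        _ ≤ _ := Nat.mul_le_mul_right _ hr)
  rw [hD20] at this
  rwa [add_mul, one_mul]

/-- The sets of elements that are derived in at most `k` rounds by the rules in the arrays. -/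
def arrayDerived (NR D : ℕ) (head body base : ℕ → ℕ) : ℕ → ℕ → Prop
  | 0, v => base v ≠ 0
  | k + 1, v => base v ≠ 0 ∨ ∃ r < NR, head r = v ∧ (∃ j < D, body (r * D + j) ≠ 0) ∧
      ∀ j < D, body (r * D + j) ≠ 0 → arrayDerived NR D head body base k (body (r * D + j) - 1)

/-- Edge `r * D + j` is slot `j` of rule `r`; division by `D` recovers the rule. -/
theorem derived_iff_arrayDerived {NR D : ℕ} {head body base src : ℕ → ℕ}
    (hsrc : ∀ e ∈ edges body (NR * D), src e = e / D) (k : ℕ) :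
    ∀ v, derived (edges body (NR * D)) src (fun e => body e - 1) head (fun v => base v ≠ 0) NR k v ↔
      arrayDerived NR D head body base k v := by
  induction k with
  | zero => intro v; rfl
  | succ k ih =>
    intro v
    simp only [derived, arrayDerived]
    refine or_congr Iff.rfl (exists_congr fun r => and_congr_right fun hr => and_congr_right
      fun _ => ?_)
    have hlt : ∀ j < D, r * D + j < NR * D := fun j hj =>
      calc r * D + j < (r + 1) * D := by rw [add_mul]; omega
        _ ≤ _ := Nat.mul_le_mul_right _ hr
    have hdiv : ∀ j < D, (r * D + j) / D = r := fun j hj => by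
      rw [mul_comm, Nat.mul_add_div (by omega), Nat.div_eq_of_lt hj, add_zero]
    have hex : ∀ e ∈ edges body (NR * D), src e = r → ∃ j < D, e = r * D + j := by
      intro e he hs
      rw [hsrc e he] at hs
      have hD : 0 < D := by
        rcases Nat.eq_zero_or_pos D with rfl | h
        · simp [edges] at he
        · exact h
      refine ⟨e % D, Nat.mod_lt _ hD, ?_⟩
      rw [← hs, mul_comm, Nat.div_add_mod]
    have hmem : ∀ j < D, body (r * D + j) ≠ 0 →
        r * D + j ∈ edges body (NR * D) ∧ src (r * D + j) = r := by
      intro j hj hb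
      have : r * D + j ∈ edges body (NR * D) := by simp [edges, hlt j hj, hb]
      exact ⟨this, by rw [hsrc _ this, hdiv j hj]⟩
    unfold Fires
    refine and_congr ?_ ?_
    · constructor
      · rintro ⟨e, he, hs⟩
        obtain ⟨j, hj, rfl⟩ := hex e he hs
        exact ⟨j, hj, (Finset.mem_filter.1 he).2⟩
      · rintro ⟨j, hj, hb⟩
        exact ⟨_, hmem j hj hb⟩
    · constructor
      · intro h j hj hb
        exact (ih _).1 (h _ (hmem j hj hb).1 (hmem j hj hb).2)
      · intro h e he hs
        obtain ⟨j, hj, rfl⟩ := hex e he hs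
        exact (ih _).2 (h j hj (Finset.mem_filter.1 he).2)

/-- The queue after the insertion of the facts below `i`. -/
theorem run_initQueue {NV : ℕ} (ρ : ℕ → ℕ) (m : ℕ → ℕ → ℕ) (h0 : ∀ v < ρ NV, m 13 v = 0) :
    let m' := (initQueue NV).run ρ m
    (∀ B, B ≠ 13 → B ≠ 17 → B ≠ 19 → m' B = m B) ∧ m' 19 0 = 0 ∧ m' 19 2 = 0 ∧
      (∀ i < m' 19 1, m' 17 i < ρ NV) ∧
      (∀ i < m' 19 1, ∀ j < m' 19 1, m' 17 i = m' 17 j → i = j) ∧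
      (∀ v < ρ NV, m' 13 v = if m 12 v ≠ 0 then 1 else 0) ∧
      ∀ v < ρ NV, (m 12 v ≠ 0 ↔ ∃ i < m' 19 1, m' 17 i = v) := by
  set m₀ : ℕ → ℕ → ℕ := Function.update m 19 (Function.update (Function.update (Function.update
    (m 19) 0 0) 1 0) 2 0) with hm₀
  have hrun : (initQueue NV).run ρ m = (Stmt.forv 20 NV (.ite (.get 12 (.var 20))
        (.seq (.put 17 (.get 19 (.lit 1)) (.var 20))
          (.seq (.put 19 (.lit 1) (.add (.get 19 (.lit 1)) (.lit 1)))
            (.put 13 (.var 20) (.lit 1))))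
        skip)).run ρ m₀ := by
    simp [initQueue, Stmt.run, Exp.eval, hm₀]
  rw [hrun]
  have key := Stmt.run_forv_induction (x := 20) (P := NV) (ρ := ρ) (m := m₀)
    (p := .ite (.get 12 (.var 20))
        (.seq (.put 17 (.get 19 (.lit 1)) (.var 20))
          (.seq (.put 19 (.lit 1) (.add (.get 19 (.lit 1)) (.lit 1)))
            (.put 13 (.var 20) (.lit 1))))
        skip)
    (I := fun k m' => (∀ B, B ≠ 13 → B ≠ 17 → B ≠ 19 → m' B = m B) ∧ m' 19 0 = 0 ∧ m' 19 2 = 0 ∧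
      (∀ i < m' 19 1, m' 17 i < k) ∧
      (∀ i < m' 19 1, ∀ j < m' 19 1, m' 17 i = m' 17 j → i = j) ∧
      (∀ v < ρ NV, m' 13 v = if v < k ∧ m 12 v ≠ 0 then 1 else 0) ∧
      ∀ v < k, (m 12 v ≠ 0 ↔ ∃ i < m' 19 1, m' 17 i = v))
    (by
      refine ⟨fun B _ _ h => by simp [hm₀, h], by simp [hm₀], by simp [hm₀], by simp [hm₀],
        by simp [hm₀], fun v hv => by simp [hm₀, h0 v hv], by simp⟩)
    (by
      rintro k m' hk ⟨h1, h2, h3, h4, h5, h6, h7⟩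
      have h12 : m' 12 = m 12 := h1 12 (by decide) (by decide) (by decide)
      by_cases hb : m 12 k = 0
      · have hk20 : (Stmt.ite (.get 12 (.var 20))
            (.seq (.put 17 (.get 19 (.lit 1)) (.var 20))
              (.seq (.put 19 (.lit 1) (.add (.get 19 (.lit 1)) (.lit 1)))
                (.put 13 (.var 20) (.lit 1))))
            skip).run (Function.update ρ 20 k) m' =
            Function.update m' 19 (Function.update (m' 19) 4 0) := by
          simp [Stmt.run, Exp.eval, h12, hb, skip]
        rw [hk20]
        refine ⟨fun B b1 b2 b3 => by simp [b3, h1 B b1 b2 b3], by simpa using h2,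
          by simpa using h3, fun i hi => ?_, ?_, fun v hv => ?_, fun v hv => ?_⟩
        · have := h4 i (by simpa using hi); simp; omega
        · simpa using h5
        · have h8 : (v < k + 1 ∧ m 12 v ≠ 0) ↔ (v < k ∧ m 12 v ≠ 0) := by
            constructor
            · rintro ⟨h, h'⟩
              refine ⟨?_, h'⟩
              rcases Nat.lt_succ_iff_lt_or_eq.1 h with h | rfl
              · exact h
              · exact absurd hb h'
            · exact fun h => ⟨by omega, h.2⟩
          rw [Function.update_of_ne (by decide), h6 v hv]
          exact (if_congr h8 rfl rfl).symm
        · rcases Nat.lt_succ_iff_lt_or_eq.1 hv with h | rfl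
          · simpa using h7 v h
          · simp only [hb, ne_eq, not_true_eq_false, false_iff]
            rintro ⟨i, hi, hi'⟩
            have := h4 i (by simpa using hi)
            simp at hi'
            omega
      · have hk20 : (Stmt.ite (.get 12 (.var 20))
            (.seq (.put 17 (.get 19 (.lit 1)) (.var 20))
              (.seq (.put 19 (.lit 1) (.add (.get 19 (.lit 1)) (.lit 1)))
                (.put 13 (.var 20) (.lit 1))))
            skip).run (Function.update ρ 20 k) m' =
            Function.update (Function.update (Function.update m' 17
              (Function.update (m' 17) (m' 19 1) k)) 19
              (Function.update (m' 19) 1 (m' 19 1 + 1))) 13 (Function.update (m' 13) k 1) := by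
          simp [Stmt.run, Exp.eval, h12, hb]
        rw [hk20]
        refine ⟨fun B b1 b2 b3 => by simp [b1, b2, b3, h1 B b1 b2 b3], by simpa using h2,
          by simpa using h3, fun i hi => ?_, fun i hi j hj hij => ?_, fun v hv => ?_,
          fun v hv => ?_⟩
        · simp at hi ⊢
          by_cases hi' : i = m' 19 1
          · simp [hi']
          · have := h4 i (by omega); simp [hi']; omega
        · simp at hi hj hij
          by_cases hi' : i = m' 19 1 <;> by_cases hj' : j = m' 19 1
          · omega
          · have := h4 j (by omega); simp [hi', hj'] at hij; omega
          · have := h4 i (by omega); simp [hi', hj'] at hij; omega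
          · simp [hi', hj'] at hij; exact h5 i (by omega) j (by omega) hij
        · by_cases hvk : v = k
          · subst hvk; simp [hb]
          · have : v < k + 1 ↔ v < k := by omega
            simpa [hvk, this] using h6 v hv
        · simp
          by_cases hvk : v = k
          · subst hvk
            exact iff_of_true hb ⟨m' 19 1, by omega, by simp⟩
          · rw [← ne_eq, h7 v (by omega)]
            constructor
            · rintro ⟨i, hi, hi'⟩
              exact ⟨i, by omega, by rwa [Function.update_of_ne (by omega)]⟩
            · rintro ⟨i, hi, hi'⟩
              by_cases hi1 : i = m' 19 1
              · rw [hi1, Function.update_self] at hi'; omega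
              · exact ⟨i, by omega, by rwa [Function.update_of_ne hi1] at hi'⟩)
  obtain ⟨g1, g2, g3, g4, g5, g6, g7⟩ := key
  refine ⟨g1, g2, g3, g4, g5, fun v hv => ?_, g7⟩
  rw [g6 v hv]
  simp [hv]

theorem run_initLists {NV NR : ℕ} (ρ : ℕ → ℕ) (m : ℕ → ℕ → ℕ) (D : ℕ) :
    let m' := (initLists NV NR).run ρ m
    (∀ v < ρ NV, m' 13 v = 0) ∧ (∀ B, B ≠ 13 → B ≠ 14 → B ≠ 15 → m' B = m B) ∧
      Represents (ρ NV) (ρ NR) D m' 0 m' := by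
  set m₁ := (Stmt.forv 20 NR (.put 14 (.var 20) (.lit 0))).run ρ m with hm₁
  have h1 : (∀ B, B ≠ 14 → m₁ B = m B) ∧ ∀ r < ρ NR, m₁ 14 r = 0 := by
    refine Stmt.run_forv_induction (I := fun k m' => (∀ B, B ≠ 14 → m' B = m B) ∧
      ∀ r < k, m' 14 r = 0) ⟨fun _ _ => rfl, by simp⟩ ?_
    rintro i m' - ⟨h1, h2⟩
    simp only [Stmt.run, Exp.eval, Function.update_self]
    refine ⟨fun B hB => by simp [hB, h1 B hB], fun r hr => ?_⟩
    by_cases h : r = i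
    · simp [h]
    · simp [h, h2 r (by omega)]
  set m₂ := (initLists NV NR).run ρ m with hm₂
  have hm₂' : m₂ = (Stmt.forv 20 NV (.seq (.put 15 (.var 20) (.lit 0))
    (.put 13 (.var 20) (.lit 0)))).run ρ m₁ := by simp [hm₂, hm₁, initLists, Stmt.run]
  have h2 : (∀ B, B ≠ 13 → B ≠ 15 → m₂ B = m₁ B) ∧ ∀ v < ρ NV, m₂ 15 v = 0 ∧ m₂ 13 v = 0 := by
    rw [hm₂']
    refine Stmt.run_forv_induction (I := fun k m' => (∀ B, B ≠ 13 → B ≠ 15 → m' B = m₁ B) ∧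
      ∀ v < k, m' 15 v = 0 ∧ m' 13 v = 0) ⟨fun _ _ _ => rfl, by simp⟩ ?_
    rintro i m' - ⟨h1, h2⟩
    simp only [Stmt.run, Exp.eval, Function.update_self]
    refine ⟨fun B hB hB' => by simp [hB, hB', h1 B hB hB'], fun r hr => ?_⟩
    by_cases h : r = i
    · simp [h]
    · simp [h, h2 r (by omega)]
  refine ⟨fun v hv => (h2.2 v hv).2, fun B b1 b2 b3 => by rw [h2.1 B b1 b3, h1.1 B b2], ?_⟩
  refine ⟨fun _ _ _ _ _ _ => rfl, fun r hr => ?_, fun v hv => ⟨[], (h2.2 v hv).1, by simp,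
    by simp [edges]⟩, by simp [edges]⟩
  rw [h2.1 14 (by decide) (by decide), h1.2 r hr]
  simp [edges]

/-- The propagation computes the numbers of rounds after which the elements are derived, plus one,
and `0` for the elements that are not derived. -/
theorem run_propagate {NV NR D IT : ℕ} (hD : D < 20)
    (ρ : ℕ → ℕ) (m : ℕ → ℕ → ℕ) (hhead : ∀ r < ρ NR, m 10 r < ρ NV)
    (hbody : ∀ e < ρ NR * ρ D, m 11 e ≤ ρ NV) (hIT : ρ NV + ρ NR * ρ D ≤ ρ IT) (k : ℕ) :
    ∀ v < ρ NV, (0 < (propagate NV NR D IT).run ρ m 13 v ∧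
        (propagate NV NR D IT).run ρ m 13 v ≤ k + 1) ↔
      arrayDerived (ρ NR) (ρ D) (m 10) (m 11) (m 12) k v := by
  set m₁ := (initLists NV NR).run ρ m with hm₁
  set m₂ := (addEdges NR D).run ρ m₁ with hm₂
  set m₃ := (initQueue NV).run ρ m₂ with hm₃
  obtain ⟨a1, a2, a3⟩ := run_initLists (NV := NV) (NR := NR) ρ m (ρ D)
  rw [← hm₁] at a1 a2 a3
  have e10 : m₁ 10 = m 10 := a2 10 (by decide) (by decide) (by decide)
  have e11 : m₁ 11 = m 11 := a2 11 (by decide) (by decide) (by decide)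
  have e12 : m₁ 12 = m 12 := a2 12 (by decide) (by decide) (by decide)
  have hbody₁ : ∀ e < ρ NR * ρ D, m₁ 11 e ≤ ρ NV := by rwa [e11]
  obtain ⟨b1, b2, b3, b4⟩ := a3.run_addEdges hD hbody₁
  rw [← hm₂] at b1 b2 b3 b4
  have f10 : m₂ 10 = m 10 := by
    rw [b1 10 (by decide) (by decide) (by decide) (by decide) (by decide), e10]
  have f12 : m₂ 12 = m 12 := by
    rw [b1 12 (by decide) (by decide) (by decide) (by decide) (by decide), e12]
  have f13 : m₂ 13 = m₁ 13 := b1 13 (by decide) (by decide) (by decide) (by decide) (by decide)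
  obtain ⟨c1, c2, c3, c4, c5, c6, c7⟩ := run_initQueue (NV := NV) ρ m₂ (by rwa [f13])
  rw [← hm₃] at c1 c2 c3 c4 c5 c6 c7
  have g10 : m₃ 10 = m 10 := by rw [c1 10 (by decide) (by decide) (by decide), f10]
  have g14 : m₃ 14 = m₂ 14 := c1 14 (by decide) (by decide) (by decide)
  have g15 : m₃ 15 = m₂ 15 := c1 15 (by decide) (by decide) (by decide)
  have g16 : m₃ 16 = m₂ 16 := c1 16 (by decide) (by decide) (by decide)
  have g18 : m₃ 18 = m₂ 18 := c1 18 (by decide) (by decide) (by decide)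
  have hrun : stateOf ((propagate NV NR D IT).run ρ m) =
      (State.step (m₃ 16) (m₃ 15) (m₃ 18) (m₃ 10))^[ρ IT] (stateOf m₃) :=
    stateOf_run_forv_propagateStep ρ m₃
  set E := edges (m 11) (ρ NR * ρ D) with hE
  rw [e11, ← hE] at b2 b3 b4
  rw [f12] at c6 c7
  have hElt : ∀ e ∈ E, e < ρ NR * ρ D ∧ m 11 e ≠ 0 := fun e he => by
    simpa [hE, edges] using he
  have hsrc : ∀ e ∈ E, m₃ 18 e < ρ NR := fun e he => by
    rw [g18, b4 e he]
    exact Nat.div_lt_of_lt_mul (by rw [mul_comm]; exact (hElt e he).1)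
  have hdst : ∀ e ∈ E, m 11 e - 1 < ρ NV := fun e he => by
    have := hbody e (hElt e he).1
    have := (hElt e he).2
    omega
  -- At the start no edge is pending or processed, and the queue holds the facts, all of rank one;
  -- the conditions on higher ranks are void.
  have hinv : Inv E (m₃ 18) (fun e => m 11 e - 1) (m₃ 10) (m₃ 16) (fun v => m 12 v ≠ 0) (ρ NV)
      (ρ NR) (stateOf m₃) ∅ [] := by
    have hr : ∀ i < m₃ 19 1, m₃ 13 (m₃ 17 i) = 1 := fun i hi => by
      have := c4 i hi
      rw [c6 _ this, if_pos ((c7 _ this).2 ⟨i, hi, rfl⟩)]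
    refine ⟨c3, by simp, ?_, by simp, ?_, ?_, c5, c4, ?_, ?_, ?_, ?_, by simp, ?_, ?_, ?_, ?_⟩
    · intro e; simp [stateOf, c2]
    · intro r hr
      simp only [stateOf, g14, Finset.sdiff_empty]
      rw [b2 r hr]
      congr 1
      exact Finset.filter_congr fun e he => by rw [g18, b4 e he]
    · simp [stateOf, c2]
    · intro v hv
      simp only [stateOf]
      rw [c6 v hv, ← c7 v hv]
      by_cases hb : m 12 v = 0 <;> simp [hb]
    · intro i j hij hj
      simp only [stateOf] at hj ⊢
      rw [hr i (by omega), hr j hj]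
    · intro _ i hi
      exact (hr i hi).le
    · intro h0; simp [stateOf, c2] at h0
    · intro v hv hb
      simp only [stateOf]
      rw [c6 v hv, if_pos hb]
    · intro v hv h1
      simp only [stateOf] at h1
      rw [c6 v hv] at h1
      by_contra hb
      simp [hb] at h1
    · intro v hv k hk
      simp only [stateOf] at hk
      rw [c6 v hv] at hk
      split_ifs at hk <;> omega
    · rintro r - ⟨e, he, hs⟩ hall
      exact absurd (hall e he hs) (by simp)
  have hhead₃ : ∀ r < ρ NR, m₃ 10 r < ρ NV := by rwa [g10]
  have hfirst : ∀ v < ρ NV, ∃ l, Chain (m₃ 16) (m₃ 15 v) l ∧ l.Nodup ∧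
      ∀ e, e ∈ l ↔ e ∈ E ∧ m 11 e - 1 = v := by rwa [g15, g16]
  -- The initial potential is at most the number of elements plus the number of slots.
  obtain ⟨Dn, l, h1, h2, h3⟩ := hinv.iterate hsrc hdst hhead₃ hfirst (ρ IT) _ _ _
    (by
      change ρ NV - m₃ 19 0 + _ ≤ _
      have h1 : (E \ ∅).card ≤ ρ NR * ρ D := by
        rw [Finset.sdiff_empty]
        calc E.card ≤ (Finset.range (ρ NR * ρ D)).card := Finset.card_le_card (by
              simp only [hE, edges]; exact Finset.filter_subset _ _)
          _ = _ := Finset.card_range _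
      omega)
  rw [← hrun] at h1 h2 h3
  intro v hv
  rw [← derived_iff_arrayDerived (src := m₃ 18) (by
    intro e he; rw [g18]; exact b4 e he) k v]
  have := h1.rank_iff h2 h3 hdst k v hv
  rw [g10] at this
  exact this

end RAM

end Shielding

namespace Shielding

/-! ### Horn clauses -/

/-- A system of Horn clauses over `V` with rules `R`, each with a slot for every element of `J`. -/
structure Horn (V R J : Type) where
  base : V → Prop
  head : R → V
  used : R → J → Prop
  body : R → J → V

namespace Horn

variable {V R J : Type} (H : Horn V R J)

/-- The elements that are derived in at most `k` rounds. -/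
def derived : ℕ → V → Prop
  | 0, v => H.base v
  -- A rule without used slots never fires. Side conditions of a rule are expressed in this way: if
  -- they fail, none of its slots is used.
  | k + 1, v => H.base v ∨ ∃ r, H.head r = v ∧ (∃ j, H.used r j) ∧
      ∀ j, H.used r j → derived k (H.body r j)

/-- The elements that are derived. -/
def Derived (v : V) : Prop := ∃ k, H.derived k v

variable {H}

theorem derived_succ {k : ℕ} {v : V} (h : H.derived k v) : H.derived (k + 1) v := by
  induction k generalizing v with
  | zero => exact .inl h
  | succ k ih =>
    rcases h with h | ⟨r, hr, hj, h⟩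
    · exact .inl h
    · exact .inr ⟨r, hr, hj, fun j hj => ih (h j hj)⟩

theorem derived_mono {k l : ℕ} (hkl : k ≤ l) {v : V} (h : H.derived k v) : H.derived l v := by
  induction hkl with
  | refl => exact h
  | step _ ih => exact derived_succ ih

/-- Finitely many premises have a common bound for their rounds. -/
theorem Derived.rule [Finite J] {r : R} (hj : ∃ j, H.used r j)
    (h : ∀ j, H.used r j → H.Derived (H.body r j)) : H.Derived (H.head r) := by
  classical
  have : ∀ j, ∃ k, H.used r j → H.derived k (H.body r j) := fun j => by
    by_cases hu : H.used r j
    · obtain ⟨k, hk⟩ := h j hu; exact ⟨k, fun _ => hk⟩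
    · exact ⟨0, fun h => absurd h hu⟩
  choose k hk using this
  obtain ⟨N, hN⟩ := (Set.finite_range k).bddAbove
  exact ⟨N + 1, .inr ⟨r, rfl, hj, fun j hu => derived_mono (hN ⟨j, rfl⟩) (hk j hu)⟩⟩

/-- A set without facts that is met by all bodies of its elements contains nothing derived. -/
theorem not_derived {S : V → Prop} (hb : ∀ v, S v → ¬ H.base v)
    (hr : ∀ r, S (H.head r) → (∃ j, H.used r j) → ∃ j, H.used r j ∧ S (H.body r j)) {v : V}
    (hv : S v) : ¬ H.Derived v := by
  rintro ⟨k, hk⟩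
  induction k generalizing v with
  | zero => exact hb v hv hk
  | succ k ih =>
    rcases hk with hk | ⟨r, rfl, hj, h⟩
    · exact hb v hv hk
    · obtain ⟨j, hu, hs⟩ := hr r hv hj
      exact ih hs (h j hu)

theorem Derived.of_base {v : V} (h : H.base v) : H.Derived v := ⟨0, h⟩

/-- Transfer from arrays: the ranks of the derived elements, for a system that is encoded in
arrays. -/
theorem arrayDerived_iff {NR D : ℕ} {head body base : ℕ → ℕ} (eV : V → ℕ) (eR : R → ℕ)
    (eJ : J → ℕ) (hV : Function.Injective eV) (hR : ∀ r, eR r < NR)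
    (hR' : ∀ n < NR, ∃ r, eR r = n) (hJ : ∀ j, eJ j < D) (hJ' : ∀ n < D, ∃ j, eJ j = n)
    (hbase : ∀ v, base (eV v) ≠ 0 ↔ H.base v) (hhead : ∀ r, head (eR r) = eV (H.head r))
    (hused : ∀ r j, H.used r j → body (eR r * D + eJ j) = eV (H.body r j) + 1)
    (hused' : ∀ r j, ¬ H.used r j → body (eR r * D + eJ j) = 0) (k : ℕ) :
    ∀ v, RAM.arrayDerived NR D head body base k (eV v) ↔ H.derived k v := by
  have hiff : ∀ r j, body (eR r * D + eJ j) ≠ 0 ↔ H.used r j := by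
    intro r j
    by_cases h : H.used r j
    · simp [hused r j h, h]
    · simp [hused' r j h, h]
  induction k with
  | zero => exact hbase
  | succ k ih =>
    intro v
    simp only [RAM.arrayDerived, derived]
    refine or_congr (hbase v) ⟨?_, ?_⟩
    · rintro ⟨n, hn, hv, ⟨j, hj, hb⟩, h⟩
      obtain ⟨r, rfl⟩ := hR' n hn
      obtain ⟨j, rfl⟩ := hJ' j hj
      refine ⟨r, hV (by rw [← hhead, hv]), ⟨j, (hiff r j).1 hb⟩, fun j hu => ?_⟩
      have := h (eJ j) (hJ j) ((hiff r j).2 hu)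
      rwa [hused r j hu, Nat.add_sub_cancel, ih] at this
    · rintro ⟨r, rfl, ⟨j, hj⟩, h⟩
      refine ⟨eR r, hR r, hhead r, ⟨eJ j, hJ j, (hiff r j).2 hj⟩, fun n hn hb => ?_⟩
      obtain ⟨j, rfl⟩ := hJ' n hn
      have hu := (hiff r j).1 hb
      rw [hused r j hu, Nat.add_sub_cancel, ih]
      exact h j hu

end Horn

/-! ### Traces -/

namespace Mealy

variable {S T A B I O : Type}

theorem stateAfter_snoc (M : Mealy S A B) (w : List A) (x : A) :
    M.stateAfter (w ++ [x]) = M.next (M.stateAfter w) x := by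
  simp [stateAfter]

theorem traceFrom_append (M : Mealy S A B) (u v : List A) :
    ∀ s, M.traceFrom s (u ++ v) = M.traceFrom s u ++ M.traceFrom (u.foldl M.next s) v := by
  induction u with
  | nil => intro s; rfl
  | cons x u ih => intro s; simp [traceFrom, ih]

theorem trace_snoc (M : Mealy S A B) (w : List A) (x : A) :
    M.trace (w ++ [x]) = M.trace w ++ [(x, M.response w x)] := by
  simp [trace, traceFrom_append, traceFrom, response, stateAfter]

theorem stateAfter_comp (D : Mealy S I O) (M : Mealy T (I × O) O) (w : List I) :
    (D.comp M).stateAfter w = (D.stateAfter w, M.stateAfter (D.trace w)) := by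
  induction w using List.reverseRecOn with
  | nil => rfl
  | append_singleton w x ih =>
    rw [stateAfter_snoc, ih, trace_snoc, stateAfter_snoc, stateAfter_snoc]
    rfl

/-- Every word is the trace of a finite-state design. -/
theorem exists_trace_eq [Nonempty O] (w : List (I × O)) :
    ∃ D : Mealy (Fin (w.length + 1)) I O, D.trace (w.map Prod.fst) = w := by
  obtain ⟨o⟩ := ‹Nonempty O›
  let D : Mealy (Fin (w.length + 1)) I O :=
    { init := 0
      next := fun t _ => if h : t.val < w.length then ⟨t.val + 1, by omega⟩ else t
      out := fun t _ => if h : t.val < w.length then w[t.val].2 else o }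
  have key : ∀ u v : List (I × O), w = u ++ v → D.trace (u.map Prod.fst) = u ∧
      (D.stateAfter (u.map Prod.fst)).val = u.length := by
    intro u
    induction u using List.reverseRecOn with
    | nil => intro v _; exact ⟨rfl, rfl⟩
    | append_singleton u x ih =>
      intro v hw
      obtain ⟨h1, h2⟩ := ih ([x] ++ v) (by simp [hw])
      have hlt : u.length < w.length := by simp [hw]
      have hlt' : (D.stateAfter (u.map Prod.fst)).val < w.length := by omega
      have hx : w[u.length] = x := by simp [hw]
      rw [List.map_append, List.map_singleton, trace_snoc, stateAfter_snoc, h1]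
      constructor
      · have : D.response (u.map Prod.fst) x.1 = x.2 := by
          simp only [response, D, hlt', dite_true]
          rw [← hx]
          simp only [D] at h2
          simp only [h2]
        rw [this]
      · have : (D.next (D.stateAfter (u.map Prod.fst)) x.1).val =
            (D.stateAfter (u.map Prod.fst)).val + 1 := by
          simp only [D] at hlt' ⊢
          rw [dif_pos hlt']
        rw [this, h2, List.length_append, List.length_singleton]
  exact ⟨D, (key w [] (by simp)).1⟩

end Mealy

namespace SafetyAutomaton

variable {Q I O P T : Type} (φ : SafetyAutomaton Q I O)

/-- The union of all closed sets of safe states is closed, and it remains so if a safe state is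
added from which every input has an answer leading into it. -/
theorem mem_winning_iff {q : Q} :
    q ∈ φ.winning ↔ q ∈ φ.safe ∧ ∀ i, ∃ o, φ.next q (i, o) ∈ φ.winning := by
  constructor
  · rintro ⟨X, hq, hX⟩
    refine ⟨(hX q hq).1, fun i => ?_⟩
    obtain ⟨o, ho⟩ := (hX q hq).2 i
    exact ⟨o, X, ho, hX⟩
  · rintro ⟨h1, h2⟩
    refine ⟨insert q φ.winning, Set.mem_insert _ _, ?_⟩
    rintro p (rfl | hp)
    · exact ⟨h1, fun i => (h2 i).imp fun o ho => .inr ho⟩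
    · obtain ⟨X, hq, hX⟩ := hp
      refine ⟨(hX p hq).1, fun i => ?_⟩
      obtain ⟨o, ho⟩ := (hX p hq).2 i
      exact ⟨o, .inr ⟨X, ho, hX⟩⟩

/-- The losing states, by Horn clauses. -/
def losing : Horn Q (Q × I) O where
  base q := q ∉ φ.safe
  head r := r.1
  used _ _ := True
  body r o := φ.next r.1 (r.2, o)

/-- A greatest fixed point as the complement of a least one: the states that are not derived form a
closed set. Outputs have to exist, since a rule without slots would not fire. -/
theorem mem_winning_iff_not_derived [Finite O] [Nonempty O] {q : Q} :
    q ∈ φ.winning ↔ ¬ φ.losing.Derived q := by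
  constructor
  · refine Horn.not_derived (H := φ.losing) (S := (· ∈ φ.winning)) (fun v hv hb => hb (φ.mem_winning_iff.1 hv).1)
      fun r hr _ => ?_
    obtain ⟨o, ho⟩ := (φ.mem_winning_iff.1 hr).2 r.2
    exact ⟨o, trivial, ho⟩
  · intro h
    refine ⟨{q | ¬ φ.losing.Derived q}, h, fun p hp => ⟨?_, fun i => ?_⟩⟩
    · by_contra hs
      exact hp (.of_base hs)
    · by_contra! hi
      have hd : φ.losing.Derived (φ.losing.head (p, i)) :=
        Horn.Derived.rule ⟨Classical.arbitrary O, trivial⟩ fun o _ => by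
          have := hi o
          rwa [Set.mem_ofPred_eq, not_not] at this
      exact hp hd

theorem monitor_snoc (w : List (I × O)) (x : I × O) :
    φ.monitor (w ++ [x]) = φ.monitorStep (φ.monitor w) x := by
  simp [monitor]

theorem noViolation_nil (w : List (I × O)) : φ.NoViolation w [] := by
  intro v₁ x v₂ h; simp at h

theorem noViolation_cons {w v : List (I × O)} {x : I × O} :
    φ.NoViolation w (x :: v) ↔ ¬ φ.Violates (φ.monitor w) x ∧ φ.NoViolation (w ++ [x]) v := by
  constructor
  · intro h
    refine ⟨by simpa using h [] x v rfl, fun v₁ y v₂ hv => ?_⟩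
    have := h (x :: v₁) y v₂ (by simp [hv])
    simpa using this
  · rintro ⟨h1, h2⟩ v₁ y v₂ hv
    cases v₁ with
    | nil => simp only [List.nil_append, List.cons.injEq] at hv; simpa [hv.1] using h1
    | cons z v₁ =>
      simp only [List.cons_append, List.cons.injEq] at hv
      obtain ⟨rfl, hv⟩ := hv
      have := h2 v₁ y v₂ hv
      simpa using this

theorem noViolation_snoc {w v : List (I × O)} {x : I × O} :
    φ.NoViolation w (v ++ [x]) ↔ φ.NoViolation w v ∧ ¬ φ.Violates (φ.monitor (w ++ v)) x := by
  induction v generalizing w with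
  | nil => simp [noViolation_cons, noViolation_nil]
  | cons y v ih => simp [noViolation_cons, ih, and_assoc]

theorem deviates_snoc {M : Mealy T (I × O) O} {w : List (I × O)} {x : I × O} :
    Deviates M (w ++ [x]) ↔ M.response w x ≠ x.2 := by
  constructor
  · rintro ⟨v, y, h, h'⟩
    obtain ⟨rfl, h⟩ := List.append_inj' h rfl
    obtain rfl : x = y := by simpa using h
    exact h'
  · exact fun h => ⟨w, x, rfl, h⟩

theorem AdverselyStabilizes.snoc {M : Mealy T (I × O) O} {k : ℕ} {w : List (I × O)} {x : I × O}
    (h : φ.AdverselyStabilizes M (k + 1) w) (hx : ¬ φ.Violates (φ.monitor w) x) :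
    φ.AdverselyStabilizes M k (w ++ [x]) := by
  intro v hv hk
  have := h (x :: v) (φ.noViolation_cons.2 ⟨hx, hv⟩) (by simpa using hk)
  simpa using this

theorem AdverselyStabilizes.mono {M : Mealy T (I × O) O} {k l : ℕ} {w : List (I × O)}
    (h : φ.AdverselyStabilizes M k w) (hkl : k ≤ l) : φ.AdverselyStabilizes M l w :=
  fun v hv hl => h v hv (hkl.trans hl)

theorem CollaborativelyStabilizes.of_snoc {M : Mealy T (I × O) O} {k : ℕ} {w : List (I × O)}
    {x : I × O} (h : φ.CollaborativelyStabilizes M k (w ++ [x]))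
    (hx : ¬ φ.Violates (φ.monitor w) x) : φ.CollaborativelyStabilizes M (k + 1) w := by
  obtain ⟨v, h1, h2, h3⟩ := h
  exact ⟨x :: v, φ.noViolation_cons.2 ⟨hx, h1⟩, by simp [h2], by simpa using h3⟩

end SafetyAutomaton

/-! ### The arena -/

/-- A set of positions that determine the state of the specification under the corrected outputs
and the monitored set; `move p x o` is the position after the letter `x` is corrected to `o`. -/
structure Arena {Q I O : Type} (φ : SafetyAutomaton Q I O) (P : Type) where
  pos : P → Q × Set Q
  move : P → I × O → O → P
  init : P
  pos_move : ∀ p x o,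
    pos (move p x o) = (φ.next (pos p).1 (x.1, o), φ.monitorStep (pos p).2 x)
  pos_init : pos init = (φ.init, {φ.init})

namespace Arena

variable {Q I O P T S : Type} {φ : SafetyAutomaton Q I O} (G : Arena φ P)

/-- The state is winning. -/
def Win (p : P) : Prop := (G.pos p).1 ∈ φ.winning

/-- The letter is no violation. -/
def Calm (p : P) (x : I × O) : Prop := ¬ φ.Violates (G.pos p).2 x

/-- The monitored set is a nonempty set of winning states. -/
def Good (p : P) : Prop := (G.pos p).2.Nonempty ∧ (G.pos p).2 ⊆ φ.winning

/-- The positions where the design has to be corrected before the next violation, by Horn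
clauses. -/
def escape : Horn P (P × I × O) Unit where
  base p := ¬ G.Win p
  head r := r.1
  used r _ := G.Calm r.1 r.2
  body r _ := G.move r.1 r.2 r.2.2

/-- No correction is needed before the next violation. -/
def Free (p : P) : Prop := ¬ G.escape.Derived p

/-- No correction is needed from the letter `x` on until the next violation. -/
def Copy (p : P) (x : I × O) : Prop := G.Free (G.move p x x.2)

/-- The pairs of a position and a letter such that the corrections can be ended in a number of
steps, whatever the design does, by Horn clauses. -/
def adverse : Horn (P × I × O) ((P × I × O) × O) (I × O) where
  base v := G.Copy v.1 v.2
  head r := r.1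
  -- If the output leaves the winning region, no slot is used and the rule for this output is void.
  used r y := G.Win (G.move r.1.1 r.1.2 r.2) ∧ G.Calm (G.move r.1.1 r.1.2 r.2) y
  body r y := (G.move r.1.1 r.1.2 r.2, y)

/-- The pairs of a position and a letter such that the corrections can be ended in a number of
steps with the help of the design, by Horn clauses. -/
def collab : Horn (P × I × O) ((P × I × O) × O × I × O) Unit where
  base v := G.Copy v.1 v.2
  head r := r.1
  used r _ := G.Win (G.move r.1.1 r.1.2 r.2.1) ∧ G.Calm (G.move r.1.1 r.1.2 r.2.1) r.2.2
  body r _ := (G.move r.1.1 r.1.2 r.2.1, r.2.2)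

/-- The corrections can be ended after `k` steps, whatever the design does. -/
def Adv (k : ℕ) (p : P) (x : I × O) : Prop := G.adverse.derived k (p, x)

/-- The corrections can be ended after `k` steps with the help of the design. -/
def Col (k : ℕ) (p : P) (x : I × O) : Prop := G.collab.derived k (p, x)

/-- The output `o` is optimal against an adverse design. -/
def Allowed (p : P) (x : I × O) (o : O) : Prop :=
  G.Win (G.move p x o) ∧ (G.Copy p x → o = x.2) ∧
    -- Stage zero of `Adv` and of `Col` is `Copy`. Off `Copy` ranks are therefore positive, and an
    -- optimal output has to lower them by one.
    (¬ G.Copy p x → ∀ k, G.Adv (k + 1) p x → ∀ y, G.Calm (G.move p x o) y →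
      G.Adv k (G.move p x o) y)

/-- The corrections can only be ended with the help of the design. -/
def NeedsHelp (p : P) (x : I × O) : Prop := (¬ ∃ k, G.Adv k p x) ∧ ∃ k, G.Col k p x

/-- The output `o` and the next letter `y` belong to a shortest way of ending the corrections. -/
def Shortens (p : P) (x : I × O) (o : O) (y : I × O) : Prop :=
  -- The output has to be allowed on the whole path: condition (i) is in force also at later
  -- entries, where the design may have become irrelevant for ending the corrections.
  ¬ G.Copy p x ∧ G.Allowed p x o ∧ G.Calm (G.move p x o) y ∧ (∃ k, G.Col k p x) ∧
    ∀ k, G.Col (k + 1) p x → G.Col k (G.move p x o) y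

/-- The failure of admissibility, by Horn clauses: `inr p` means that no admissible continuation
exists from `p`, and `inl (p, x)` means that none follows a shortest way of ending the
corrections. -/
noncomputable def blocked : Horn ((P × I × O) ⊕ P) ((P × I × O) × Fin 3) (O × I × O) where
  -- That there is no shortening combination must be a fact, since the rule with this empty body
  -- would never fire.
  base v := v.elim (fun v => ¬ G.Copy v.1 v.2 ∧ ∀ o y, ¬ G.Shortens v.1 v.2 o y) fun p => ¬ G.Win p
  -- Rules of kind 0 block a position because of one letter: if help is needed, the entry itself is
  -- blocked; otherwise all allowed outputs lead to blocked positions. Kind 1 blocks an entry if all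
  -- shortening combinations lead to blocked entries. Kind 2 blocks an entry at a blocked position,
  -- because a commitment for one letter does not dispense from answering the others.
  head r := if r.2 = 0 then .inr r.1.1 else .inl r.1
  used r j := if r.2 = 0 then G.NeedsHelp r.1.1 r.1.2 ∨ G.Allowed r.1.1 r.1.2 j.1
    else if r.2 = 1 then G.Shortens r.1.1 r.1.2 j.1 j.2 else True
  body r j := open Classical in
    if r.2 = 0 then
      (if G.NeedsHelp r.1.1 r.1.2 then .inl r.1 else .inr (G.move r.1.1 r.1.2 j.1))
    else if r.2 = 1 then .inl (G.move r.1.1 r.1.2 j.1, j.2) else .inr r.1.1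

/-- An admissible continuation exists. -/
def Viable (p : P) : Prop := ¬ G.blocked.Derived (.inr p)

/-- An admissible continuation exists that follows a shortest way of ending the corrections. -/
def Tight (p : P) (x : I × O) : Prop := ¬ G.blocked.Derived (.inl (p, x))

/-! ### Unfolding the fixed points of the arena -/

variable {G}

theorem free_iff {p : P} :
    G.Free p ↔ G.Win p ∧ ∀ x, G.Calm p x → G.Free (G.move p x x.2) := by
  constructor
  · intro h
    refine ⟨?_, fun x hx hd => ?_⟩
    · by_contra hw
      exact h (.of_base hw)
    · exact h (Horn.Derived.rule (r := (p, x)) ⟨(), hx⟩ fun _ _ => hd)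
  · rintro ⟨h1, h2⟩
    refine Horn.not_derived (H := G.escape) (S := fun p => G.Win p ∧ ∀ x, G.Calm p x → G.Free (G.move p x x.2))
      (fun v hv hb => hb hv.1) (fun r hr hj => ?_) ⟨h1, h2⟩
    obtain ⟨_, hu⟩ := hj
    refine ⟨(), hu, ?_⟩
    have h3 := hr.2 _ hu
    change G.Win _ ∧ _
    refine ⟨?_, fun x hx hd => ?_⟩
    · by_contra hw
      exact h3 (.of_base hw)
    · exact h3 (Horn.Derived.rule (r := (G.move r.1 r.2 r.2.2, x)) ⟨(), hx⟩ fun _ _ => hd)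

/-- Coinduction, as `Free` is the complement of a least fixed point. -/
theorem free_of_closed {F : P → Prop} (h : ∀ p, F p → G.Win p)
    (h' : ∀ p x, F p → G.Calm p x → F (G.move p x x.2)) {p : P} (hp : F p) : G.Free p :=
  Horn.not_derived (H := G.escape) (S := F) (fun v hv hb => hb (h v hv))
    (fun _ hr ⟨_, hu⟩ => ⟨(), hu, h' _ _ hr hu⟩) hp

theorem Copy.step {p : P} {x y : I × O} (h : G.Copy p x) (hy : G.Calm (G.move p x x.2) y) :
    G.Copy (G.move p x x.2) y := (free_iff.1 h).2 y hy

theorem col_zero {p : P} {x : I × O} : G.Col 0 p x ↔ G.Copy p x := Iff.rfl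

theorem adv_succ {k : ℕ} {p : P} {x : I × O} : G.Adv (k + 1) p x ↔ G.Copy p x ∨
    ∃ o, G.Win (G.move p x o) ∧ (∃ y, G.Calm (G.move p x o) y) ∧
      ∀ y, G.Calm (G.move p x o) y → G.Adv k (G.move p x o) y := by
  refine or_congr Iff.rfl ⟨?_, ?_⟩
  · rintro ⟨⟨v, o⟩, rfl, ⟨y, hw, hc⟩, h⟩
    exact ⟨o, hw, ⟨y, hc⟩, fun y hy => h y ⟨hw, hy⟩⟩
  · rintro ⟨o, hw, ⟨y, hc⟩, h⟩
    exact ⟨((p, x), o), rfl, ⟨y, hw, hc⟩, fun y hy => h y hy.2⟩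

theorem col_succ {k : ℕ} {p : P} {x : I × O} : G.Col (k + 1) p x ↔ G.Copy p x ∨
    ∃ o y, G.Win (G.move p x o) ∧ G.Calm (G.move p x o) y ∧ G.Col k (G.move p x o) y := by
  refine or_congr Iff.rfl ⟨?_, ?_⟩
  · rintro ⟨⟨v, o, y⟩, rfl, ⟨_, hw, hc⟩, h⟩
    exact ⟨o, y, hw, hc, h () ⟨hw, hc⟩⟩
  · rintro ⟨o, y, hw, hc, h⟩
    exact ⟨((p, x), o, y), rfl, ⟨(), hw, hc⟩, fun _ _ => h⟩

theorem Adv.mono {k l : ℕ} {p : P} {x : I × O} (h : G.Adv k p x) (hkl : k ≤ l) : G.Adv l p x :=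
  Horn.derived_mono hkl h

theorem Col.mono {k l : ℕ} {p : P} {x : I × O} (h : G.Col k p x) (hkl : k ≤ l) : G.Col l p x :=
  Horn.derived_mono hkl h

theorem Win.exists_win {p : P} (h : G.Win p) (x : I × O) : ∃ o, G.Win (G.move p x o) := by
  obtain ⟨o, ho⟩ := (φ.mem_winning_iff.1 h).2 x.1
  exact ⟨o, by simpa [Win, G.pos_move] using ho⟩

/-- Without a violation, the state that witnesses this has a winning successor. After a violation,
any monitored state is winning and so has a winning successor under the same input and some output.
Thus the monitored set never becomes empty. -/
theorem Good.move {p : P} (h : G.Good p) (x : I × O) (o : O) : G.Good (G.move p x o) := by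
  simp only [Good, G.pos_move]
  refine ⟨?_, fun q hq => hq.1⟩
  by_cases hv : φ.Violates (G.pos p).2 x
  · obtain ⟨q, hq⟩ := h.1
    obtain ⟨o', ho'⟩ := (φ.mem_winning_iff.1 (h.2 hq)).2 x.1
    exact ⟨_, ho', .inr ⟨hv, q, hq, o', rfl⟩⟩
  · have hv' := hv
    simp only [SafetyAutomaton.Violates, not_forall, not_not] at hv'
    obtain ⟨q, hq, hw⟩ := hv'
    exact ⟨_, hw, .inl ⟨hv, q, hq, rfl⟩⟩

theorem Good.exists_calm [Nonempty I] {p : P} (h : G.Good p) : ∃ x, G.Calm p x := by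
  obtain ⟨q, hq⟩ := h.1
  obtain ⟨i⟩ := ‹Nonempty I›
  obtain ⟨o, ho⟩ := (φ.mem_winning_iff.1 (h.2 hq)).2 i
  exact ⟨(i, o), fun hv => hv q hq ho⟩

/-- The output that realizes the least adverse rank works for all larger bounds by monotonicity. In
the absence of a rank any output that stays winning will do. -/
theorem exists_allowed {p : P} (hw : G.Win p) (x : I × O) : ∃ o, G.Allowed p x o := by
  classical
  by_cases hc : G.Copy p x
  · exact ⟨x.2, (free_iff.1 hc).1, fun _ => rfl, fun h => absurd hc h⟩
  by_cases hk : ∃ k, G.Adv (k + 1) p x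
  · obtain ⟨o, ho, -, h⟩ := (adv_succ.1 (Nat.find_spec hk)).resolve_left hc
    exact ⟨o, ho, fun h => absurd h hc, fun _ k hk' y hy =>
      (h y hy).mono (Nat.find_min' hk hk')⟩
  · obtain ⟨o, ho⟩ := hw.exists_win x
    exact ⟨o, ho, fun h => absurd h hc, fun _ k hk' => absurd ⟨k, hk'⟩ hk⟩

/-- This serves the competing shields, which need not be admissible: only the collaborative rank is
lowered, without regard to `Allowed`. -/
theorem exists_collab {p : P} (hw : G.Win p) (x : I × O) :
    ∃ o, G.Win (G.move p x o) ∧ (G.Copy p x → o = x.2) ∧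
      (¬ G.Copy p x → (∃ k, G.Col k p x) → ∃ y, G.Calm (G.move p x o) y ∧
        (∃ k, G.Col k (G.move p x o) y) ∧ ∀ k, G.Col (k + 1) p x → G.Col k (G.move p x o) y) := by
  classical
  by_cases hc : G.Copy p x
  · exact ⟨x.2, (free_iff.1 hc).1, fun _ => rfl, fun h => absurd hc h⟩
  by_cases hk : ∃ k, G.Col (k + 1) p x
  · obtain ⟨o, y, ho, hy, h⟩ := (col_succ.1 (Nat.find_spec hk)).resolve_left hc
    exact ⟨o, ho, fun h => absurd h hc, fun _ _ => ⟨y, hy, ⟨_, h⟩, fun k hk' =>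
      h.mono (Nat.find_min' hk hk')⟩⟩
  · obtain ⟨o, ho⟩ := hw.exists_win x
    refine ⟨o, ho, fun h => absurd h hc, fun _ ⟨k, hk'⟩ => absurd ⟨k, hk'.mono k.le_succ⟩ hk⟩

theorem Viable.win {p : P} (h : G.Viable p) : G.Win p := by
  by_contra hw
  exact h (.of_base hw)

/-- The contrapositive of a rule of kind 0. The next three lemmas do the same for the other branch
of kind 0 and for the kinds 2 and 1. -/
theorem Viable.tight [Finite O] [Finite I] [Nonempty O] [Nonempty I] {p : P} (h : G.Viable p)
    {x : I × O} (hx : G.NeedsHelp p x) : G.Tight p x := by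
  intro hd
  have := Horn.Derived.rule (H := G.blocked) (r := ((p, x), 0))
    ⟨(Classical.arbitrary O, Classical.arbitrary (I × O)), by simp [blocked, hx]⟩
    (fun j _ => by simpa [blocked, hx] using hd)
  exact h (by simpa [blocked] using this)

theorem Viable.exists_allowed [Finite O] [Finite I] [Nonempty O] [Nonempty I] {p : P}
    (h : G.Viable p) {x : I × O} (hx : ¬ G.NeedsHelp p x) :
    ∃ o, G.Allowed p x o ∧ G.Viable (G.move p x o) := by
  by_contra! hcon
  obtain ⟨o, ho⟩ := Arena.exists_allowed h.win x
  have := Horn.Derived.rule (H := G.blocked) (r := ((p, x), 0))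
    ⟨(o, Classical.arbitrary (I × O)), by simp [blocked, ho]⟩
    (fun j hj => by
      have := hcon j.1 (by simpa [blocked, hx] using hj)
      simpa [blocked, hx, Viable] using this)
  exact h (by simpa [blocked] using this)

theorem Tight.viable [Finite O] [Finite I] [Nonempty O] [Nonempty I] {p : P} {x : I × O}
    (h : G.Tight p x) : G.Viable p := by
  intro hd
  have := Horn.Derived.rule (H := G.blocked) (r := ((p, x), 2))
    ⟨(Classical.arbitrary O, Classical.arbitrary (I × O)), by simp [blocked]⟩
    (fun j _ => by simpa [blocked] using hd)
  exact h (by simpa [blocked] using this)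

theorem Tight.exists_shortens [Finite O] [Finite I] {p : P} {x : I × O}
    (h : G.Tight p x) (hc : ¬ G.Copy p x) :
    ∃ o y, G.Shortens p x o y ∧ G.Tight (G.move p x o) y := by
  by_contra! hcon
  by_cases hs : ∃ o y, G.Shortens p x o y
  · obtain ⟨o, y, hoy⟩ := hs
    have := Horn.Derived.rule (H := G.blocked) (r := ((p, x), 1))
      ⟨(o, y), by simpa [blocked] using hoy⟩
      (fun j hj => by
        have := hcon j.1 j.2 (by simpa [blocked] using hj)
        simpa [blocked, Tight] using this)
    exact h (by simpa [blocked] using this)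
  · push Not at hs
    exact h (.of_base ⟨hc, hs⟩)

/-! ### Positions along traces -/

variable (G)

/-- The position after a trace with the corrections of `M`. -/
def after (M : Mealy T (I × O) O) (w : List (I × O)) : P :=
  (w.foldl (fun s x => (M.next s.1 x, G.move s.2 x (M.out s.1 x))) (M.init, G.init)).2

variable {G}

theorem after_snoc (M : Mealy T (I × O) O) (w : List (I × O)) (x : I × O) :
    G.after M (w ++ [x]) = G.move (G.after M w) x (M.response w x) := by
  have : ∀ w : List (I × O), (w.foldl (fun s x => (M.next s.1 x, G.move s.2 x (M.out s.1 x)))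
      (M.init, G.init)).1 = M.stateAfter w := by
    intro w
    induction w using List.reverseRecOn with
    | nil => rfl
    | append_singleton w x ih => rw [List.foldl_append, M.stateAfter_snoc, ← ih]; rfl
  simp only [after, List.foldl_append, List.foldl_cons, List.foldl_nil, this, Mealy.response]

/-- The monitor observes the design and not the corrections, so this component is the same for all
machines. -/
theorem pos_after_snd (M : Mealy T (I × O) O) (w : List (I × O)) :
    (G.pos (G.after M w)).2 = φ.monitor w := by
  induction w using List.reverseRecOn with
  | nil => simp [after, G.pos_init, SafetyAutomaton.monitor]
  | append_singleton w x ih => rw [after_snoc, G.pos_move, φ.monitor_snoc, ih]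

theorem calm_after {M : Mealy T (I × O) O} {w : List (I × O)} {x : I × O} :
    G.Calm (G.after M w) x ↔ ¬ φ.Violates (φ.monitor w) x := by
  rw [Calm, pos_after_snd]

theorem stateAfter_trace_comp (D : Mealy S I O) (M : Mealy T (I × O) O) (w : List I) :
    φ.stateAfter ((D.comp M).trace w) = (G.pos (G.after M (D.trace w))).1 := by
  induction w using List.reverseRecOn with
  | nil =>
    simp [Mealy.trace, Mealy.traceFrom, after, G.pos_init, SafetyAutomaton.stateAfter]
  | append_singleton w x ih =>
    have h1 : (D.comp M).response w x =
        M.response (D.trace w) (x, D.response w x) := by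
      simp only [Mealy.response, Mealy.stateAfter_comp]; rfl
    rw [Mealy.trace_snoc, Mealy.trace_snoc, after_snoc, G.pos_move, ← ih, h1]
    simp [SafetyAutomaton.stateAfter]

/-- The states reached under the corrections of a shield are safe, since every word is the trace of
a design, and they are closed under answering arbitrary inputs. Hence they lie in the winning
region. -/
theorem isShield_iff [Nonempty O] {M : Mealy T (I × O) O} :
    φ.IsShield M ↔ ∀ w, G.Win (G.after M w) := by
  constructor
  · intro h w
    refine ⟨{q | ∃ w, (G.pos (G.after M w)).1 = q}, ⟨w, rfl⟩, ?_⟩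
    rintro _ ⟨w, rfl⟩
    constructor
    · obtain ⟨D, hD⟩ := Mealy.exists_trace_eq w
      have := h _ D (w.map Prod.fst)
      rwa [stateAfter_trace_comp (G := G), hD] at this
    · intro i
      obtain ⟨o⟩ := ‹Nonempty O›
      exact ⟨M.response w (i, o), w ++ [(i, o)], by rw [after_snoc, G.pos_move]⟩
  · intro h S _ D w
    rw [stateAfter_trace_comp (G := G)]
    exact (φ.mem_winning_iff.1 (h _)).1

theorem good_after (h : G.Win G.init) (M : Mealy T (I × O) O) (w : List (I × O)) :
    G.Good (G.after M w) := by
  induction w using List.reverseRecOn with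
  | nil =>
    simp only [after, List.foldl_nil, Good, G.pos_init]
    simp only [Win, G.pos_init] at h
    exact ⟨⟨_, rfl⟩, by simpa using h⟩
  | append_singleton w x ih => rw [after_snoc]; exact ih.move _ _

/-! ### What stabilization implies for the position -/

/-- The positions after traces that are 0-stabilized are winning and closed under copying a letter
without a violation, so coinduction applies. -/
theorem copy_of_adverselyStabilizes {M : Mealy T (I × O) O} (hM : ∀ w, G.Win (G.after M w))
    {w : List (I × O)} {x : I × O} (h : φ.AdverselyStabilizes M 0 (w ++ [x])) :
    M.response w x = x.2 ∧ G.Copy (G.after M w) x := by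
  have hr : ∀ w x, φ.AdverselyStabilizes M 0 (w ++ [x]) → M.response w x = x.2 := by
    intro w x h
    have := h [] (φ.noViolation_nil _) le_rfl
    rw [List.append_nil, SafetyAutomaton.deviates_snoc, not_not] at this
    exact this
  refine ⟨hr w x h, ?_⟩
  refine free_of_closed (F := fun p => ∃ w, φ.AdverselyStabilizes M 0 w ∧ G.after M w = p) ?_ ?_
    ⟨_, h, by rw [after_snoc, hr w x h]⟩
  · rintro _ ⟨w, -, rfl⟩; exact hM w
  · rintro _ y ⟨w, hw, rfl⟩ hy
    have h2 := (hw.mono φ (Nat.zero_le 1)).snoc φ (calm_after.1 hy)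
    exact ⟨w ++ [y], h2, by rw [after_snoc, hr w y h2]⟩

/-- The response of the shield is the output required by the rule. The rule also needs a next letter
without a violation, which exists because the monitored set is good. -/
theorem adv_of_adverselyStabilizes [Nonempty I] {M : Mealy T (I × O) O}
    (hM : ∀ w, G.Win (G.after M w)) {k : ℕ} :
    ∀ {w : List (I × O)} {x : I × O}, φ.AdverselyStabilizes M k (w ++ [x]) →
      G.Adv k (G.after M w) x := by
  induction k with
  | zero => intro w x h; exact (copy_of_adverselyStabilizes hM h).2
  | succ k ih =>
    intro w x h
    refine adv_succ.2 (.inr ⟨M.response w x, ?_⟩)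
    rw [← after_snoc]
    exact ⟨hM _, (good_after (hM []) M _).exists_calm, fun y hy => ih (h.snoc φ (calm_after.1 hy))⟩

theorem col_of_collaborativelyStabilizes {M : Mealy T (I × O) O}
    (hM : ∀ w, G.Win (G.after M w)) {k : ℕ} :
    ∀ {w : List (I × O)} {x : I × O}, φ.CollaborativelyStabilizes M k (w ++ [x]) →
      G.Col k (G.after M w) x := by
  induction k with
  | zero =>
    rintro w x ⟨v, -, hv, h⟩
    obtain rfl := List.length_eq_zero_iff.1 hv
    rw [List.append_nil] at h
    exact (copy_of_adverselyStabilizes hM h).2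
  | succ k ih =>
    rintro w x ⟨v, hn, hv, h⟩
    cases v with
    | nil => simp at hv
    | cons y v =>
      obtain ⟨h1, h2⟩ := φ.noViolation_cons.1 hn
      refine col_succ.2 (.inr ⟨M.response w x, y, ?_⟩)
      rw [← after_snoc]
      exact ⟨hM _, calm_after.2 h1, ih ⟨v, h2, by simpa using hv, by simpa using h⟩⟩

/-! ### Strategies -/

/-- The number `t` is the length of the past that is prescribed by another machine; nothing is
assumed about the responses before. -/
theorem adverselyStabilizes_zero {N : Mealy T (I × O) O} {t : ℕ}
    (hN : ∀ w x, t ≤ w.length → G.Copy (G.after N w) x → N.response w x = x.2)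
    {w : List (I × O)} {x : I × O} (ht : t ≤ w.length) (h : G.Copy (G.after N w) x) :
    φ.AdverselyStabilizes N 0 (w ++ [x]) := by
  intro v hv _
  induction v generalizing w x with
  | nil => rw [List.append_nil, SafetyAutomaton.deviates_snoc, not_not]; exact hN w x ht h
  | cons y v ih =>
    obtain ⟨h1, h2⟩ := φ.noViolation_cons.1 hv
    have hy := (calm_after (G := G) (M := N)).2 h1
    have hmove := after_snoc (G := G) N w x
    rw [hN w x ht h] at hmove
    have := ih (w := w ++ [x]) (x := y) (by simp; omega)
      (by rw [hmove] at hy ⊢; exact h.step hy) h2 (Nat.zero_le _)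
    simpa using this

theorem adverselyStabilizes_of_adv {N : Mealy T (I × O) O} {t : ℕ}
    (hN : ∀ w x, t ≤ w.length → G.Allowed (G.after N w) x (N.response w x)) {k : ℕ}
    {w : List (I × O)} {x : I × O} (ht : t ≤ w.length) (h : G.Adv k (G.after N w) x) :
    φ.AdverselyStabilizes N k (w ++ [x]) := by
  have hcopy : ∀ w x, t ≤ w.length → G.Copy (G.after N w) x → N.response w x = x.2 :=
    fun w x ht hc => (hN w x ht).2.1 hc
  induction k generalizing w x with
  | zero => exact adverselyStabilizes_zero hcopy ht h
  | succ k ih =>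
    by_cases hc : G.Copy (G.after N w) x
    · exact (adverselyStabilizes_zero hcopy ht hc).mono φ (Nat.zero_le _)
    · intro v hv hk
      cases v with
      | nil => simp at hk
      | cons y v =>
        obtain ⟨h1, h2⟩ := φ.noViolation_cons.1 hv
        have hy := (calm_after (G := G) (M := N)).2 h1
        have := (hN w x ht).2.2 hc k h y (by rwa [← after_snoc])
        rw [← after_snoc] at this
        have := ih (w := w ++ [x]) (by simp; omega) this v h2 (by simpa using hk)
        simpa using this

/-- The predicate `Z` marks the entries at which the machine is committed to lowering the
collaborative rank. It is taken to be the existence of a rank for competing shields, and `Tight` for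
the admissible one. -/
theorem collaborativelyStabilizes_of_col [Nonempty I] (hinit : G.Win G.init)
    {N : Mealy T (I × O) O} {t : ℕ} {Z : P → I × O → Prop}
    (hN : ∀ w x, t ≤ w.length → G.Copy (G.after N w) x → N.response w x = x.2)
    (hZ : ∀ w x, t ≤ w.length → Z (G.after N w) x → ¬ G.Copy (G.after N w) x →
      ∃ y, G.Calm (G.after N (w ++ [x])) y ∧ Z (G.after N (w ++ [x])) y ∧
        ∀ k, G.Col (k + 1) (G.after N w) x → G.Col k (G.after N (w ++ [x])) y) {k : ℕ}
    {w : List (I × O)} {x : I × O} (ht : t ≤ w.length)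
    (hz : G.Copy (G.after N w) x ∨ Z (G.after N w) x) (h : G.Col k (G.after N w) x) :
    φ.CollaborativelyStabilizes N k (w ++ [x]) := by
  induction k generalizing w x with
  | zero =>
    exact ⟨[], φ.noViolation_nil _, rfl, by
      rw [List.append_nil]; exact adverselyStabilizes_zero hN ht h⟩
  | succ k ih =>
    have ht' : t ≤ (w ++ [x]).length := by simp; omega
    by_cases hc : G.Copy (G.after N w) x
    -- The continuation must have exactly `k` letters. If the corrections end earlier, it is padded
    -- with letters that are no violations.
    · obtain ⟨y, hy⟩ := (good_after hinit N (w ++ [x])).exists_calm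
      have hcy : G.Copy (G.after N (w ++ [x])) y := by
        rw [after_snoc, hN w x ht hc] at hy ⊢
        exact hc.step hy
      exact (ih ht' (.inl hcy) ((col_zero.2 hcy).mono (Nat.zero_le _))).of_snoc φ
        (calm_after.1 hy)
    · obtain ⟨y, hy, hzy, hk⟩ := hZ w x ht (hz.resolve_left hc) hc
      exact (ih ht' (.inr hzy) (hk k h)).of_snoc φ (calm_after.1 hy)

variable (G)

/-- The machine that follows a positional strategy. -/
def machine (f : P → I × O → O) : Mealy P (I × O) O where
  init := G.init
  next p x := G.move p x (f p x)
  out := f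

/-- The machine that acts like `M` for `t` steps and then follows a positional strategy. -/
def switch (M : Mealy T (I × O) O) (f : P → I × O → O) (t : ℕ) :
    Mealy (T × P × Fin (t + 1)) (I × O) O where
  init := (M.init, G.init, 0)
  next s x := (M.next s.1 x,
    G.move s.2.1 x (if s.2.2.val < t then M.out s.1 x else f s.2.1 x),
    -- The clock stops at `t`, which keeps the machine finite.
    ⟨min (s.2.2.val + 1) t, by omega⟩)
  out s x := if s.2.2.val < t then M.out s.1 x else f s.2.1 x

variable {G}

theorem stateAfter_machine (f : P → I × O → O) (w : List (I × O)) :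
    (G.machine f).stateAfter w = G.after (G.machine f) w := by
  induction w using List.reverseRecOn with
  | nil => rfl
  | append_singleton w x ih =>
    rw [Mealy.stateAfter_snoc, after_snoc, Mealy.response, ih]; rfl

theorem response_machine (f : P → I × O → O) (w : List (I × O)) (x : I × O) :
    (G.machine f).response w x = f (G.after (G.machine f) w) x := by
  rw [Mealy.response, stateAfter_machine]; rfl

theorem stateAfter_switch (M : Mealy T (I × O) O) (f : P → I × O → O) (t : ℕ)
    (w : List (I × O)) :
    ((G.switch M f t).stateAfter w).1 = M.stateAfter w ∧
      ((G.switch M f t).stateAfter w).2.1 = G.after (G.switch M f t) w ∧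
      ((G.switch M f t).stateAfter w).2.2.val = min w.length t := by
  induction w using List.reverseRecOn with
  | nil => simp [Mealy.stateAfter, after, switch]
  | append_singleton w x ih =>
    obtain ⟨h1, h2, h3⟩ := ih
    rw [Mealy.stateAfter_snoc, after_snoc, Mealy.response, Mealy.stateAfter_snoc, ← h1, ← h2]
    refine ⟨rfl, rfl, ?_⟩
    change min (((G.switch M f t).stateAfter w).2.2.val + 1) t = _
    rw [h3, List.length_append, List.length_singleton]
    omega

theorem response_switch (M : Mealy T (I × O) O) (f : P → I × O → O) (t : ℕ)
    (w : List (I × O)) (x : I × O) :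
    (G.switch M f t).response w x =
      if w.length < t then M.response w x else f (G.after (G.switch M f t) w) x := by
  obtain ⟨h1, h2, h3⟩ := stateAfter_switch (G := G) M f t w
  have : (min w.length t < t) = (w.length < t) := by
    refine propext ⟨fun h => by omega, fun h => by omega⟩
  rw [Mealy.response, Mealy.response, ← h1, ← h2]
  change (if ((G.switch M f t).stateAfter w).2.2.val < t then _ else _) = _
  simp only [h3, this]

theorem after_switch (M : Mealy T (I × O) O) (f : P → I × O → O) (t : ℕ) {w : List (I × O)}
    (hw : w.length ≤ t) : G.after (G.switch M f t) w = G.after M w := by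
  induction w using List.reverseRecOn with
  | nil => rfl
  | append_singleton w x ih =>
    rw [List.length_append, List.length_singleton] at hw
    rw [after_snoc, after_snoc, ih (by omega), response_switch, if_pos (by omega)]

theorem win_after_switch {M : Mealy T (I × O) O} (hM : ∀ w, G.Win (G.after M w))
    {f : P → I × O → O} (hf : ∀ p x, G.Win p → G.Win (G.move p x (f p x))) (t : ℕ)
    (w : List (I × O)) : G.Win (G.after (G.switch M f t) w) := by
  induction w using List.reverseRecOn with
  | nil => exact hM []
  | append_singleton w x ih =>
    rcases Nat.lt_or_ge w.length t with h | h
    · rw [after_switch M f t (by simp; omega)]; exact hM _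
    · rw [after_snoc, response_switch, if_neg (by omega)]; exact hf _ _ ih

theorem agreeBefore_switch (M : Mealy T (I × O) O) (f : P → I × O → O) (w : List (I × O))
    (x : I × O) :
    SafetyAutomaton.AgreeBefore M (G.switch M f w.length) (w ++ [x]) := by
  intro v₁ y v₂ h hv
  rw [response_switch, if_pos]
  have := congrArg List.length h
  have := List.length_pos_of_ne_nil hv
  simp at *
  omega

theorem after_eq_of_agreeBefore {M : Mealy T (I × O) O} {N : Mealy S (I × O) O}
    {w : List (I × O)} {x : I × O} (h : SafetyAutomaton.AgreeBefore M N (w ++ [x])) :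
    G.after M w = G.after N w := by
  have key : ∀ u v, w = u ++ v → G.after M u = G.after N u := by
    intro u
    induction u using List.reverseRecOn with
    | nil => intro v _; rfl
    | append_singleton u y ih =>
      intro v hv
      rw [after_snoc, after_snoc, ih (y :: v) (by simp [hv]), h u y (v ++ [x]) (by simp [hv])
        (by simp)]
  exact key w [] (by simp)

/-! ### Competing shields with the same past -/

/-- The competitor acts like `M` before the last step of the trace and then plays an allowed output
at each position, all of which are winning. -/
theorem canAdverselyStabilize_of_adv [Finite P] [Finite T] [Nonempty O] [Nonempty I]
    {M : Mealy T (I × O) O} (hM : ∀ w, G.Win (G.after M w)) {k : ℕ} {w : List (I × O)}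
    {x : I × O} (h : G.Adv k (G.after M w) x) : φ.CanAdverselyStabilize M k (w ++ [x]) := by
  classical
  have hex : ∀ p x, ∃ o, G.Win p → G.Allowed p x o := fun p x => by
    by_cases hp : G.Win p
    · exact (Arena.exists_allowed hp x).imp fun o ho _ => ho
    · exact ⟨Classical.arbitrary O, fun h => absurd h hp⟩
  choose f hf using hex
  have hw := win_after_switch hM (fun p x hp => (hf p x hp).1) w.length
  refine ⟨_, inferInstance, G.switch M f w.length, (isShield_iff (G := G)).2 hw,
    agreeBefore_switch M f w x, ?_⟩
  refine adverselyStabilizes_of_adv (G := G) (t := w.length) (fun v y hv => ?_) le_rfl ?_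
  · rw [response_switch, if_neg (by omega)]; exact hf _ _ (hw _)
  · rwa [after_switch _ _ _ le_rfl]

theorem canCollaborativelyStabilize_of_col [Finite P] [Finite T] [Nonempty O] [Nonempty I]
    {M : Mealy T (I × O) O} (hM : ∀ w, G.Win (G.after M w)) {k : ℕ} {w : List (I × O)}
    {x : I × O} (h : G.Col k (G.after M w) x) :
    φ.CanCollaborativelyStabilize M k (w ++ [x]) := by
  classical
  have hex : ∀ p x, ∃ o, G.Win p → G.Win (G.move p x o) ∧ (G.Copy p x → o = x.2) ∧
      (¬ G.Copy p x → (∃ k, G.Col k p x) → ∃ y, G.Calm (G.move p x o) y ∧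
        (∃ k, G.Col k (G.move p x o) y) ∧
          ∀ k, G.Col (k + 1) p x → G.Col k (G.move p x o) y) := fun p x => by
    by_cases hp : G.Win p
    · exact (Arena.exists_collab hp x).imp fun o ho _ => ho
    · exact ⟨Classical.arbitrary O, fun h => absurd h hp⟩
  choose f hf using hex
  have hw := win_after_switch hM (fun p x hp => (hf p x hp).1) w.length
  have hresp : ∀ v y, w.length ≤ v.length → (G.switch M f w.length).response v y =
      f (G.after (G.switch M f w.length) v) y := fun v y hv => by
    rw [response_switch, if_neg (by omega)]
  refine ⟨_, inferInstance, G.switch M f w.length, (isShield_iff (G := G)).2 hw,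
    agreeBefore_switch M f w x, ?_⟩
  have h' : G.Col k (G.after (G.switch M f w.length) w) x := by rwa [after_switch _ _ _ le_rfl]
  refine collaborativelyStabilizes_of_col (G := G) (hM []) (t := w.length)
    (Z := fun p x => ∃ k, G.Col k p x) (fun v y hv hc => ?_) (fun v y hv hz hc => ?_) le_rfl
    (.inr ⟨k, h'⟩) h'
  · rw [hresp v y hv]; exact (hf _ _ (hw _)).2.1 hc
  · rw [after_snoc, hresp v y hv]
    exact (hf _ _ (hw _)).2.2 hc hz

/-! ### Admissible shields -/

/-- The strategy continues admissibly wherever this is possible. -/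
def IsAdmissibleStrategy (G : Arena φ P) (f : P → I × O → O) : Prop :=
  ∀ p x, G.Viable p → G.Allowed p x (f p x) ∧ G.Viable (G.move p x (f p x)) ∧
    (G.Tight p x → ¬ G.Copy p x → ∃ y, G.Shortens p x (f p x) y ∧
      G.Tight (G.move p x (f p x)) y)

/-- As long as there is no violation, the monitored set consists of the actual state only, and a
letter that is no violation keeps this state winning. Such positions are closed under copying, so
every letter met on the way satisfies `Copy`. -/
theorem noUnnecessaryDeviation {M : Mealy T (I × O) O} (hinit : G.Win G.init)
    (hM : ∀ w x, G.Copy (G.after M w) x → M.response w x = x.2) :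
    φ.NoUnnecessaryDeviation M := by
  let F : P → Prop := fun p => G.Win p ∧ (G.pos p).2 = {(G.pos p).1}
  have hstep : ∀ p x, F p → G.Calm p x → F (G.move p x x.2) := by
    rintro p x ⟨h1, h2⟩ hx
    have hw : φ.next (G.pos p).1 x ∈ φ.winning := by
      by_contra hw
      refine hx fun q hq => ?_
      rw [h2, Set.mem_singleton_iff] at hq
      rwa [hq]
    refine ⟨by simpa only [Win, G.pos_move] using hw, ?_⟩
    rw [G.pos_move]
    ext q
    constructor
    · rintro ⟨-, ⟨-, r, hr, rfl⟩ | ⟨hv, -⟩⟩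
      · rw [h2, Set.mem_singleton_iff] at hr
        simp [hr]
      · exact absurd hv hx
    · intro hq
      rw [Set.mem_singleton_iff] at hq
      subst hq
      exact ⟨hw, .inl ⟨hx, (G.pos p).1, by rw [h2]; rfl, rfl⟩⟩
  have hcopy : ∀ p x, F p → G.Calm p x → G.Copy p x := fun p x hp hx =>
    free_of_closed (F := F) (fun _ h => h.1) hstep (hstep p x hp hx)
  have key : ∀ w, φ.NoViolation [] w → F (G.after M w) ∧ ¬ SafetyAutomaton.Deviates M w := by
    intro w
    induction w using List.reverseRecOn with
    | nil =>
      intro _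
      refine ⟨⟨hinit, ?_⟩, ?_⟩
      · simp [after, G.pos_init]
      · rintro ⟨v, x, h, -⟩; simp at h
    | append_singleton w x ih =>
      intro hw
      obtain ⟨h1, h2⟩ := φ.noViolation_snoc.1 hw
      obtain ⟨h3, -⟩ := ih h1
      have hx : G.Calm (G.after M w) x := calm_after.2 (by simpa using h2)
      have hr := hM w x (hcopy _ _ h3 hx)
      rw [after_snoc, SafetyAutomaton.deviates_snoc, hr]
      exact ⟨hstep _ _ h3 hx, fun h => h rfl⟩
  exact fun w hw => (key w hw).2

theorem adverselyStabilizes_nil {M : Mealy T (I × O) O} (h : φ.NoUnnecessaryDeviation M) (k : ℕ) :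
    φ.AdverselyStabilizes M k [] := fun v hv _ => h v hv

/-- The machine visits viable positions only, so its outputs are always allowed, which yields (i).
Under the hypothesis of (ii) the entry is tight, and tightness is handed on along a path on which
the collaborative rank drops. -/
theorem isAdmissible_machine [Finite P] [Finite I] [Finite O] [Nonempty I] [Nonempty O]
    {f : P → I × O → O} (hf : G.IsAdmissibleStrategy f) (hinit : G.Viable G.init) :
    φ.IsAdmissible (G.machine f) := by
  have hv : ∀ w, G.Viable (G.after (G.machine f) w) := by
    intro w
    induction w using List.reverseRecOn with
    | nil => exact hinit
    | append_singleton w x ih =>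
      rw [after_snoc, response_machine]; exact (hf _ x ih).2.1
  have hwin : ∀ w, G.Win (G.after (G.machine f) w) := fun w => (hv w).win
  have hall : ∀ w x, G.Allowed (G.after (G.machine f) w) x ((G.machine f).response w x) :=
    fun w x => by rw [response_machine]; exact (hf _ x (hv w)).1
  have hcopy : ∀ w x, G.Copy (G.after (G.machine f) w) x → (G.machine f).response w x = x.2 :=
    fun w x => (hall w x).2.1
  have hshield : φ.IsShield (G.machine f) := (isShield_iff (G := G)).2 hwin
  have hnd := noUnnecessaryDeviation hinit.win hcopy
  refine ⟨hshield, hnd, fun w => ?_⟩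
  rcases List.eq_nil_or_concat' w with rfl | ⟨w, x, rfl⟩
  -- On the empty trace nothing is to be corrected: the machine itself adversely 0-stabilizes it, so
  -- the hypothesis of (ii) fails.
  · refine ⟨fun k _ => adverselyStabilizes_nil hnd k, fun h => absurd ⟨0, P, ‹_›, G.machine f,
      hshield, fun _ _ _ _ _ => rfl, adverselyStabilizes_nil hnd 0⟩ h⟩
  · constructor
    · rintro k ⟨S, _, N, hN, ha, hk⟩
      have h1 := adv_of_adverselyStabilizes ((isShield_iff (G := G)).1 hN) hk
      rw [← after_eq_of_agreeBefore ha] at h1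
      exact adverselyStabilizes_of_adv (G := G) (t := 0) (fun w x _ => hall w x) (Nat.zero_le _) h1
    · rintro hno k ⟨S, _, N, hN, ha, hk⟩
      have h1 := col_of_collaborativelyStabilizes ((isShield_iff (G := G)).1 hN) hk
      rw [← after_eq_of_agreeBefore ha] at h1
      have hneed : G.NeedsHelp (G.after (G.machine f) w) x :=
        ⟨fun ⟨k, hk⟩ => hno ⟨k, canAdverselyStabilize_of_adv hwin hk⟩, k, h1⟩
      refine collaborativelyStabilizes_of_col (G := G) hinit.win (t := 0) (Z := G.Tight)
        (fun w x _ => hcopy w x) (fun w x _ hz hc => ?_) (Nat.zero_le _)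
        (.inr ((hv w).tight hneed)) h1
      obtain ⟨y, hs, ht⟩ := (hf _ x (hv w)).2.2 hz hc
      rw [after_snoc, response_machine]
      exact ⟨y, hs.2.2.1, ht, hs.2.2.2.2⟩

/-- No rule of `blocked` can derive a position that an admissible shield reaches, nor an entry at
which it realizes the least collaborative number of steps: its own behaviour always supplies a
premise that is again of this form. -/
theorem viable_of_isAdmissible [Finite P] [Finite T] [Nonempty I] [Nonempty O]
    {M : Mealy T (I × O) O} (hM : φ.IsAdmissible M) : G.Viable G.init := by
  classical
  obtain ⟨hshield, -, hadm⟩ := hM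
  have hwin := (isShield_iff (G := G)).1 hshield
  have hadv : ∀ k w x, G.Adv k (G.after M w) x → φ.AdverselyStabilizes M k (w ++ [x]) :=
    fun k w x h => (hadm _).1 k (canAdverselyStabilize_of_adv hwin h)
  have hall : ∀ w x, G.Allowed (G.after M w) x (M.response w x) := by
    intro w x
    refine ⟨by rw [← after_snoc]; exact hwin _, fun hc =>
      (copy_of_adverselyStabilizes hwin (hadv 0 w x hc)).1, fun hc k hk y hy => ?_⟩
    rw [← after_snoc] at hy ⊢
    exact adv_of_adverselyStabilizes hwin ((hadv _ w x hk).snoc φ (calm_after.1 hy))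
  -- The commitment of the shield: it collaboratively stabilizes this trace within the least number
  -- of steps that any way through the arena permits.
  let A : List (I × O) → I × O → Prop := fun w x => ∃ k,
    φ.CollaborativelyStabilizes M k (w ++ [x]) ∧ ∀ j, G.Col j (G.after M w) x → k ≤ j
  have hA : ∀ w x, G.NeedsHelp (G.after M w) x → A w x := by
    rintro w x ⟨h1, h2⟩
    refine ⟨Nat.find h2, (hadm _).2 ?_ _ (canCollaborativelyStabilize_of_col hwin
      (Nat.find_spec h2)), fun j hj => Nat.find_min' h2 hj⟩
    rintro ⟨k, S, _, N, hN, ha, hk⟩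
    have h3 := adv_of_adverselyStabilizes ((isShield_iff (G := G)).1 hN) hk
    rw [← after_eq_of_agreeBefore ha] at h3
    exact h1 ⟨k, h3⟩
  have hstep : ∀ w x, A w x → ¬ G.Copy (G.after M w) x →
      ∃ y, G.Shortens (G.after M w) x (M.response w x) y ∧ A (w ++ [x]) y := by
    rintro w x ⟨k, hk, hmin⟩ hc
    have hcol := col_of_collaborativelyStabilizes hwin hk
    cases k with
    | zero => exact absurd (col_zero.1 hcol) hc
    | succ k =>
      obtain ⟨v, hn, hv, h⟩ := hk
      cases v with
      | nil => simp at hv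
      | cons y v =>
        obtain ⟨h1, h2⟩ := φ.noViolation_cons.1 hn
        have hy := (calm_after (G := G) (M := M)).2 h1
        have hk' : φ.CollaborativelyStabilizes M k (w ++ [x] ++ [y]) :=
          ⟨v, h2, by simpa using hv, by simpa using h⟩
        have hcol' := col_of_collaborativelyStabilizes hwin hk'
        refine ⟨y, ⟨hc, hall w x, by rwa [← after_snoc], ⟨_, hcol⟩, fun j hj => ?_⟩, k, hk',
          fun j hj => ?_⟩
        · rw [← after_snoc]
          exact hcol'.mono (by have := hmin _ hj; omega)
        -- Minimality is inherited along the path, as a shorter way from the next entry would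
        -- shorten the way from this one.
        · have := hmin (j + 1) (col_succ.2 (.inr ⟨M.response w x, y, ?_⟩))
          · omega
          · rw [← after_snoc]; exact ⟨hwin _, hy, hj⟩
  -- The set to be avoided by derivations has both kinds of elements: committed entries and reached
  -- positions.
  have key := Horn.not_derived (H := G.blocked)
    (S := fun v => v.elim (fun v => ∃ w, G.after M w = v.1 ∧ A w v.2) fun p =>
      ∃ w, G.after M w = p) (v := .inr G.init) ?_ ?_ ⟨[], rfl⟩
  · exact key
  · rintro (v | p)
    · rintro ⟨w, hw, ha⟩ ⟨hc, hs⟩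
      change G.after M w = v.1 at hw
      rw [← hw] at hc hs
      obtain ⟨y, hy, -⟩ := hstep w v.2 ha hc
      exact hs _ _ hy
    · rintro ⟨w, rfl⟩ hb
      exact hb (hwin w)
  · rintro ⟨⟨p, x⟩, i⟩ hS hj
    simp only [blocked] at hS hj ⊢
    split_ifs at hS hj ⊢ with h0 h1 h2
    · obtain ⟨w, rfl⟩ := hS
      exact ⟨(Classical.arbitrary O, x), .inl h1, w, rfl, hA w x h1⟩
    · obtain ⟨w, rfl⟩ := hS
      exact ⟨(M.response w x, x), .inr (hall w x), w ++ [x], by rw [after_snoc]⟩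
    · obtain ⟨w, hw, ha⟩ := hS
      dsimp only at hw ha
      subst hw
      obtain ⟨⟨o, y⟩, hs⟩ := hj
      obtain ⟨y, hy, ha'⟩ := hstep w x ha hs.1
      exact ⟨(M.response w x, y), hy, w ++ [x], by rw [after_snoc], ha'⟩
    · obtain ⟨w, hw, -⟩ := hS
      exact ⟨(Classical.arbitrary O, x), trivial, w, hw⟩

end Arena

end Shielding

namespace Shielding

/-! ### Encodings by numbers -/

/-- The function `e` numbers the elements of its domain by the numbers below `N`. -/
structure Encodes {A : Type} (e : A → ℕ) (N : ℕ) : Prop where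
  inj : Function.Injective e
  lt : ∀ x, e x < N
  surj : ∀ k < N, ∃ x, e x = k

namespace Encodes

variable {A B : Type} {e : A → ℕ} {e' : B → ℕ} {N N' : ℕ}

theorem fin (n : ℕ) : Encodes (Fin.val : Fin n → ℕ) n :=
  ⟨Fin.val_injective, Fin.is_lt, fun k hk => ⟨⟨k, hk⟩, rfl⟩⟩

theorem unit : Encodes (fun _ : Unit => 0) 1 :=
  ⟨fun _ _ _ => rfl, fun _ => one_pos, fun k hk => ⟨(), by omega⟩⟩

theorem prod (h : Encodes e N) (h' : Encodes e' N') :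
    Encodes (fun x : A × B => e x.1 * N' + e' x.2) (N * N') where
  inj := by
    rintro ⟨x, y⟩ ⟨x', y'⟩ hxy
    have h1 := h'.lt y
    have h2 := h'.lt y'
    have hpos : 0 < N' := by omega
    simp only at hxy
    have h3 : e' y = e' y' := by
      have := congrArg (· % N') hxy
      simpa [Nat.mul_add_mod', Nat.mod_eq_of_lt h1, Nat.mod_eq_of_lt h2] using this
    have h4 : e x = e x' := by
      rw [h3] at hxy
      exact Nat.eq_of_mul_eq_mul_right hpos (Nat.add_right_cancel hxy)
    rw [h.inj h4, h'.inj h3]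
  lt := fun ⟨x, y⟩ => by
    have h1 := h'.lt y
    calc e x * N' + e' y < (e x + 1) * N' := by rw [add_mul]; omega
      _ ≤ N * N' := Nat.mul_le_mul_right _ (h.lt x)
  surj := fun k hk => by
    have hpos : 0 < N' := Nat.pos_of_mul_pos_left (by omega : 0 < N * N')
    obtain ⟨x, hx⟩ := h.surj (k / N') (Nat.div_lt_of_lt_mul (by rwa [mul_comm] at hk))
    obtain ⟨y, hy⟩ := h'.surj (k % N') (Nat.mod_lt _ hpos)
    exact ⟨(x, y), by simp only [hx, hy]; rw [mul_comm]; exact Nat.div_add_mod _ _⟩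

theorem sum (h : Encodes e N) (h' : Encodes e' N') :
    Encodes (Sum.elim e fun y => N + e' y) (N + N') where
  inj := by
    rintro (x | x) (y | y) hxy <;> simp only [Sum.elim_inl, Sum.elim_inr] at hxy
    · rw [h.inj hxy]
    · have := h.lt x; omega
    · have := h.lt y; omega
    · rw [h'.inj (Nat.add_left_cancel hxy)]
  lt := by
    rintro (x | x)
    · exact (h.lt x).trans_le (Nat.le_add_right _ _)
    · exact Nat.add_lt_add_left (h'.lt x) _
  surj := fun k hk => by
    rcases Nat.lt_or_ge k N with hlt | hge
    · obtain ⟨x, hx⟩ := h.surj k hlt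
      exact ⟨.inl x, hx⟩
    · obtain ⟨x, hx⟩ := h'.surj (k - N) (by omega)
      exact ⟨.inr x, by simp only [Sum.elim_inr, hx]; omega⟩

end Encodes

/-- The number of a letter. -/
def letterIndex {a b : ℕ} (x : Fin a × Fin b) : ℕ := x.1 * b + x.2

/-- The number of a pair of a state and a letter. -/
def entryIndex {K a b : ℕ} (v : Fin K × Fin a × Fin b) : ℕ := tableIndex a b v.1 v.2.1 v.2.2

theorem entryIndex_eq {K a b : ℕ} (v : Fin K × Fin a × Fin b) :
    entryIndex v = v.1 * (a * b) + letterIndex v.2 := by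
  simp only [entryIndex, tableIndex, letterIndex]; ring

theorem encodes_letterIndex (a b : ℕ) : Encodes (letterIndex (a := a) (b := b)) (a * b) :=
  (Encodes.fin a).prod (Encodes.fin b)

theorem encodes_entryIndex (K a b : ℕ) :
    Encodes (entryIndex (K := K) (a := a) (b := b)) (K * (a * b)) := by
  have := (Encodes.fin K).prod (encodes_letterIndex a b)
  convert this using 2 with v
  exact entryIndex_eq v

/-! ### Propagation for encoded Horn clauses -/

/-- The number `r` is one more than the round in which `v` is derived, or `0` if there is none. -/
def Horn.IsRank {V R J : Type} (H : Horn V R J) (v : V) (r : ℕ) : Prop :=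
  ∀ k, (0 < r ∧ r ≤ k + 1) ↔ H.derived k v

namespace Horn.IsRank

variable {V R J : Type} {H : Horn V R J} {v : V} {r : ℕ}

theorem derived_iff (h : H.IsRank v r) : H.Derived v ↔ r ≠ 0 := by
  constructor
  · rintro ⟨k, hk⟩
    have := ((h k).2 hk).1
    omega
  · exact fun hr => ⟨r, (h r).1 ⟨by omega, by omega⟩⟩

/-- Thus a statement on all stages is decided by comparing two stored ranks. The hypothesis on stage
zero excludes `r = 1`; a rank of zero means that the premise never holds. -/
theorem forall_imp_iff (h : H.IsRank v r) (h0 : ¬ H.derived 0 v) {V' R' J' : Type}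
    {H' : Horn V' R' J'} {v' : V'} {r' : ℕ} (h' : H'.IsRank v' r') :
    (∀ k, H.derived (k + 1) v → H'.derived k v') ↔ (r = 0 ∨ (0 < r' ∧ r' < r)) := by
  have h1 := mt (h 0).1 h0
  constructor
  · intro hk
    rcases Nat.eq_zero_or_pos r with hr | hr
    · exact .inl hr
    · have := (h' (r - 2)).2 (hk _ ((h _).1 ⟨hr, by omega⟩))
      exact .inr ⟨this.1, by omega⟩
  · rintro hr k hk
    have := (h (k + 1)).2 hk
    exact (h' k).1 (by omega)

end Horn.IsRank

/-- The bridge from abstract systems to arrays: it suffices to number the elements, rules and slots,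
and to fill in heads, bodies and facts. A body entry is shifted by one, since zero marks an unused
slot. -/
theorem RAM.run_propagate_horn {V R J : Type} (H : Horn V R J) {NV NR D IT : ℕ} (hD : D < 20)
    (ρ : ℕ → ℕ) (m : ℕ → ℕ → ℕ) {eV : V → ℕ} {eR : R → ℕ} {eJ : J → ℕ}
    (hV : Encodes eV (ρ NV)) (hR : Encodes eR (ρ NR)) (hJ : Encodes eJ (ρ D))
    (hIT : ρ NV + ρ NR * ρ D ≤ ρ IT) (hhead : ∀ r, m 10 (eR r) = eV (H.head r))
    (hused : ∀ r j, H.used r j → m 11 (eR r * ρ D + eJ j) = eV (H.body r j) + 1)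
    (hused' : ∀ r j, ¬ H.used r j → m 11 (eR r * ρ D + eJ j) = 0)
    (hbase : ∀ v, m 12 (eV v) ≠ 0 ↔ H.base v) (v : V) :
    H.IsRank v ((propagate NV NR D IT).run ρ m 13 (eV v)) := by
  intro k
  rw [← Horn.arrayDerived_iff (H := H) eV eR eJ hV.inj hR.lt hR.surj hJ.lt hJ.surj hbase hhead
    hused hused' k v]
  refine run_propagate hD ρ m (fun r hr => ?_) (fun e he => ?_) hIT k _ (hV.lt v)
  · obtain ⟨r, rfl⟩ := hR.surj r hr
    rw [hhead]; exact hV.lt _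
  · obtain ⟨⟨r, j⟩, rfl⟩ := (hR.prod hJ).surj e he
    by_cases hu : H.used r j
    · rw [hused r j hu]; exact hV.lt _
    · rw [hused' r j hu]; exact Nat.zero_le _

/-! ### Bit masks -/

/-- The bit mask of a set. -/
noncomputable def setCode {n : ℕ} (U : Set (Fin n)) : ℕ :=
  open Classical in ∑ s : Fin n, if s ∈ U then 2 ^ (s : ℕ) else 0

theorem sum_two_pow_lt (p : ℕ → Prop) [DecidablePred p] (n : ℕ) :
    (∑ s ∈ Finset.range n, if p s then 2 ^ s else 0) < 2 ^ n := by
  induction n with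
  | zero => simp
  | succ n ih => rw [Finset.sum_range_succ, pow_succ]; split_ifs <;> omega

theorem testBit_sum_two_pow (p : ℕ → Prop) [DecidablePred p] {n s : ℕ} (hs : s < n) :
    (∑ s ∈ Finset.range n, if p s then 2 ^ s else 0).testBit s = decide (p s) := by
  induction n with
  | zero => omega
  | succ n ih =>
    rw [Finset.sum_range_succ]
    have hlt := sum_two_pow_lt p n
    rcases Nat.lt_succ_iff_lt_or_eq.1 hs with h | rfl
    · split_ifs
      · rw [add_comm, Nat.testBit_two_pow_add_gt h, ih h]
      · rw [add_zero, ih h]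
    · split_ifs with h
      · rw [add_comm, Nat.testBit_two_pow_add_eq, Nat.testBit_lt_two_pow hlt]; simp [h]
      · rw [add_zero, Nat.testBit_lt_two_pow hlt]; simp [h]

theorem setCode_eq_sum_range {n : ℕ} (U : Set (Fin n)) (p : ℕ → Prop) [DecidablePred p]
    (hp : ∀ s : Fin n, p s ↔ s ∈ U) :
    setCode U = ∑ s ∈ Finset.range n, if p s then 2 ^ s else 0 := by
  classical
  rw [setCode, Finset.sum_range]
  exact Finset.sum_congr rfl fun s _ => if_congr (hp s).symm rfl rfl

theorem setCode_lt {n : ℕ} (U : Set (Fin n)) : setCode U < 2 ^ n := by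
  classical
  rw [setCode_eq_sum_range U (fun s => ∃ h : s < n, (⟨s, h⟩ : Fin n) ∈ U) (by simp)]
  exact sum_two_pow_lt _ n

theorem testBit_setCode {n : ℕ} (U : Set (Fin n)) (s : Fin n) :
    (setCode U).testBit s = true ↔ s ∈ U := by
  classical
  rw [setCode_eq_sum_range U (fun s => ∃ h : s < n, (⟨s, h⟩ : Fin n) ∈ U) (by simp),
    testBit_sum_two_pow _ s.2]
  simp

theorem encodes_setCode (n : ℕ) : Encodes (setCode (n := n)) (2 ^ n) where
  inj U U' h := by
    ext s
    rw [← testBit_setCode, ← testBit_setCode, h]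
  lt := setCode_lt
  surj k hk := by
    refine ⟨{s | k.testBit s = true}, Nat.eq_of_testBit_eq fun s => ?_⟩
    rcases Nat.lt_or_ge s n with h | h
    · rw [Bool.eq_iff_iff]
      exact testBit_setCode _ ⟨s, h⟩
    · have h2 : 2 ^ n ≤ 2 ^ s := Nat.pow_le_pow_right (by omega) h
      rw [Nat.testBit_lt_two_pow (hk.trans_le h2),
        Nat.testBit_lt_two_pow ((setCode_lt _).trans_le h2)]

/-- The numbering of the pairs of a state and a set of states. -/
noncomputable def positionEquiv (n : ℕ) : Fin n × Set (Fin n) ≃ Fin (2 ^ n * n) :=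
  Equiv.ofBijective
    -- The mask is the leading digit. Tables over the positions then need one loop over `2 ^ n`,
    -- outermost, and products with the small number `n` only.
    (fun p => ⟨setCode p.2 * n + p.1, ((encodes_setCode n).prod (Encodes.fin n)).lt (p.2, p.1)⟩)
    ⟨fun p p' h => by
      have := ((encodes_setCode n).prod (Encodes.fin n)).inj
        (a₁ := (p.2, p.1)) (a₂ := (p'.2, p'.1)) (by simpa using h)
      rw [Prod.mk.injEq] at this
      exact Prod.ext this.2 this.1,
    fun k => by
      obtain ⟨⟨U, q⟩, h⟩ := ((encodes_setCode n).prod (Encodes.fin n)).surj k k.2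
      exact ⟨(q, U), Fin.ext h⟩⟩

theorem positionEquiv_val {n : ℕ} (p : Fin n × Set (Fin n)) :
    (positionEquiv n p : ℕ) = setCode p.2 * n + p.1 := rfl

/-- The arena of all pairs of a state and a set of states. -/
noncomputable def SafetyAutomaton.arena {n : ℕ} {I O : Type} (φ : SafetyAutomaton (Fin n) I O) :
    Arena φ (Fin (2 ^ n * n)) where
  pos := (positionEquiv n).symm
  move p x o := positionEquiv n (φ.next ((positionEquiv n).symm p).1 (x.1, o),
    φ.monitorStep ((positionEquiv n).symm p).2 x)
  init := positionEquiv n (φ.init, {φ.init})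
  pos_move _ _ _ := Equiv.symm_apply_apply _ _
  pos_init := Equiv.symm_apply_apply _ _

theorem SafetyAutomaton.arena_val {n : ℕ} {I O : Type} (φ : SafetyAutomaton (Fin n) I O)
    (p : Fin (2 ^ n * n)) : (p : ℕ) = setCode (φ.arena.pos p).2 * n + (φ.arena.pos p).1 := by
  conv_lhs => rw [← (positionEquiv n).apply_symm_apply p]
  exact positionEquiv_val _

end Shielding

namespace Shielding

open RAM

/-! ### The program: parameters -/

/-- The parameters of the synthesis program, for `n` states, `a` inputs, `b` outputs, and `K`
positions. -/
structure Params (n a b K : ℕ) (ρ : ℕ → ℕ) : Prop where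
  p0 : ρ 0 = n
  p1 : ρ 1 = a
  p2 : ρ 2 = b
  p4 : ρ 4 = 1
  p5 : ρ 5 = a * b
  p6 : ρ 6 = b * (a * b)
  p7 : ρ 7 = n * a
  p8 : ρ 8 = 3
  p10 : ρ 10 = 2 ^ n
  p11 : ρ 11 = K
  -- Parameter 12 counts the entries, 13 the rules of `adverse`, 14 those of `collab`, 15 the rules
  -- and 16 the elements of `blocked`.
  p12 : ρ 12 = K * (a * b)
  p13 : ρ 13 = K * (a * b) * b
  p14 : ρ 14 = K * (a * b) * b * (a * b)
  p15 : ρ 15 = K * (a * b) * 3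
  p16 : ρ 16 = K * (a * b) + K
  -- Elements plus slots of `blocked`, the largest system; this number of steps is enough for every
  -- propagation.
  p17 : ρ 17 = K * (a * b) + K + K * (a * b) * 3 * (b * (a * b))

/-! ### The program: bit masks -/

/-- Enter the powers of two into array 2. -/
def powStmt : Stmt :=
  .seq (.put 2 (.lit 0) (.lit 1))
    (.forv 21 0 (.put 2 (.add (.var 21) (.lit 1)) (.add (.get 2 (.var 21)) (.get 2 (.var 21)))))

theorem run_powStmt (ρ : ℕ → ℕ) (m : ℕ → ℕ → ℕ) : ∀ s ≤ ρ 0, powStmt.run ρ m 2 s = 2 ^ s := by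
  have := Stmt.run_forv_induction (x := 21) (P := 0) (ρ := ρ)
    (p := .put 2 (.add (.var 21) (.lit 1)) (.add (.get 2 (.var 21)) (.get 2 (.var 21))))
    (m := (Stmt.put 2 (.lit 0) (.lit 1)).run ρ m) (fun i m' => ∀ s ≤ i, m' 2 s = 2 ^ s)
    (by intro s hs; obtain rfl : s = 0 := by omega
        simp [Stmt.run, Exp.eval])
    (by
      intro i m' _ h s hs
      simp only [Stmt.run, Exp.eval, Function.update_self]
      rcases Nat.lt_or_ge i s with h1 | h1
      · obtain rfl : s = i + 1 := by omega
        rw [Function.update_self, h i le_rfl, pow_succ]; omega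
      · rw [Function.update_of_ne (by omega), h s h1])
  exact this

/-- Enter the bits of the masks into array 3. -/
def bitStmt : Stmt :=
  .forv 21 10 (.forv 22 0 (.put 3 (.add (.mulv (.var 21) 0) (.var 22))
    (.ite (.lt (.var 21) (.get 2 (.var 22))) (.lit 0)
      (.not (.get 3 (.add (.mulv (.sub (.var 21) (.get 2 (.var 22))) 0) (.var 22)))))))

/-- Bits are found without division. If `u` is less than `2 ^ s`, bit `s` is zero. Otherwise it is
the negation of bit `s` of `u - 2 ^ s`, as adding `2 ^ s` flips it, and the smaller number is
already in the table. -/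
theorem run_bitStmt {n : ℕ} {ρ : ℕ → ℕ} {m : ℕ → ℕ → ℕ} (h0 : ρ 0 = n) (h10 : ρ 10 = 2 ^ n)
    (hpow : ∀ s < n, m 2 s = 2 ^ s) :
    ∀ u < 2 ^ n, ∀ s < n, bitStmt.run ρ m 3 (u * n + s) ≠ 0 ↔ u.testBit s = true := by
  have hidx : ∀ {u s u' s' : ℕ}, s < n → s' < n → u * n + s = u' * n + s' → u = u' ∧ s = s' := by
    intro u s u' s' hs hs' h
    have h1 := congrArg (· % n) h
    simp only [Nat.mul_add_mod', Nat.mod_eq_of_lt hs, Nat.mod_eq_of_lt hs'] at h1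
    subst h1
    exact ⟨Nat.eq_of_mul_eq_mul_right (by omega) (Nat.add_right_cancel h), rfl⟩
  have := Stmt.run_forv_induction (x := 21) (P := 10) (ρ := ρ) (m := m)
    (p := .forv 22 0 (.put 3 (.add (.mulv (.var 21) 0) (.var 22))
    (.ite (.lt (.var 21) (.get 2 (.var 22))) (.lit 0)
      (.not (.get 3 (.add (.mulv (.sub (.var 21) (.get 2 (.var 22))) 0) (.var 22)))))))
    (fun k m' => m' 2 = m 2 ∧
      ∀ u < k, ∀ s < n, m' 3 (u * n + s) ≠ 0 ↔ u.testBit s = true)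
    ⟨rfl, fun u hu => absurd hu (by omega)⟩
    (by
      rintro k m' - ⟨h2, h3⟩
      have := Stmt.run_forv_induction (x := 22) (P := 0) (ρ := Function.update ρ 21 k) (m := m')
        (p := .put 3 (.add (.mulv (.var 21) 0) (.var 22))
          (.ite (.lt (.var 21) (.get 2 (.var 22))) (.lit 0)
          (.not (.get 3 (.add (.mulv (.sub (.var 21) (.get 2 (.var 22))) 0) (.var 22))))))
        (fun j m'' => m'' 2 = m 2 ∧
          (∀ u < k, ∀ s < n, m'' 3 (u * n + s) ≠ 0 ↔ u.testBit s = true) ∧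
          ∀ s < j, s < n → (m'' 3 (k * n + s) ≠ 0 ↔ k.testBit s = true))
        ⟨h2, h3, fun u hu => absurd hu (by omega)⟩
        (by
          rintro j m'' hj ⟨g2, g3, g4⟩
          have hj' : j < n := by simpa [Function.update_apply, h0] using hj
          have hval : (Exp.eval (.ite (.lt (.var 21) (.get 2 (.var 22))) (.lit 0)
              (.not (.get 3 (.add (.mulv (.sub (.var 21) (.get 2 (.var 22))) 0) (.var 22)))))
              (Function.update (Function.update ρ 21 k) 22 j) m'' ≠ 0) ↔
              k.testBit j = true := by
            have hle : (Exp.lt (.var 21) (.get 2 (.var 22))).eval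
              (Function.update (Function.update ρ 21 k) 22 j) m'' = 2 ^ j - k := by
              simp [Exp.lt, Exp.eval, g2, hpow j hj']
            have hpos : 0 < 2 ^ j := by positivity
            rcases Nat.lt_or_ge k (2 ^ j) with hk | hk
            · rw [Exp.eval, hle, if_pos (by omega), Nat.testBit_lt_two_pow hk]
              simp [Exp.eval]
            · rw [Exp.eval, hle, if_neg (by omega)]
              change Exp.Holds _ _ _ ↔ _
              rw [Exp.holds_not, Exp.holds_get]
              simp [Exp.eval, g2, hpow j hj', h0]
              obtain ⟨l, rfl⟩ := Nat.exists_eq_add_of_le hk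
              have := g3 l (by omega) j hj'
              rw [Nat.testBit_two_pow_add_eq, Nat.add_sub_cancel_left]
              rw [← not_iff_not, not_not] at this
              rw [this]
              simp
          have hpos : (Exp.add (.mulv (.var 21) 0) (.var 22)).eval
              (Function.update (Function.update ρ 21 k) 22 j) m'' = k * n + j := by
            simp [Exp.eval, h0]
          rw [Stmt.run, hpos]
          refine ⟨by rw [Function.update_of_ne (by decide), g2], fun u hu s hs => ?_,
            fun s hs hs' => ?_⟩
          · rw [Function.update_self, Function.update_of_ne, g3 u hu s hs]
            intro he
            have := (hidx hs hj' he).1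
            omega
          · rcases Nat.lt_succ_iff_lt_or_eq.1 hs with h | rfl
            · rw [Function.update_self, Function.update_of_ne, g4 s h hs']
              intro he
              have := (hidx hs' hj' he).2
              omega
            · rw [Function.update_self, Function.update_self, hval])
      obtain ⟨g2, g3, g4⟩ := this
      have hn : Function.update ρ 21 k 0 = n := by simp [h0]
      rw [hn] at g4
      refine ⟨g2, fun u hu s hs => ?_⟩
      rcases Nat.lt_succ_iff_lt_or_eq.1 hu with h | rfl
      · exact g3 u h s hs
      · exact g4 s hs hs)
  exact fun u hu s hs => this.2 u (by rwa [h10]) s hs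

/-! ### The program: winning states -/

variable {n a b K : ℕ} {φ : SafetyAutomaton (Fin n) (Fin a) (Fin b)} {ρ : ℕ → ℕ}
  {m : ℕ → ℕ → ℕ}

/-- Enter the indicator function of the winning states into array 4. -/
def winningStmt : Stmt :=
  .seq (.tab 10 [0, 1] (.var 21))
    (.seq (.tab 11 [0, 1, 2] (.add (.get 1 (.var 26)) (.lit 1)))
      (.seq (.tab 12 [0] (.not (.get 0 (.var 21))))
        (.seq (propagate 0 7 2 17) (.tab 4 [0] (.not (.get 13 (.var 21)))))))

/-- The specification is stored in the arrays 0 and 1. -/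
def StoresSpec (φ : SafetyAutomaton (Fin n) (Fin a) (Fin b)) (m : ℕ → ℕ → ℕ) : Prop :=
  (∀ q : Fin n, m 0 q ≠ 0 ↔ q ∈ φ.safe) ∧
    ∀ (q : Fin n) (i : Fin a) (o : Fin b), m 1 (tableIndex a b q i o) = φ.next q (i, o)

theorem run_winningStmt (hρ : Params n a b (2 ^ n * n) ρ) (hb : 0 < b) (hm : StoresSpec φ m)
    (q : Fin n) : winningStmt.run ρ m 4 q ≠ 0 ↔ q ∈ φ.winning := by
  obtain ⟨hm0, hm1⟩ := hm
  have : Nonempty (Fin b) := ⟨⟨0, hb⟩⟩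
  simp only [winningStmt, Stmt.run]
  set m1 := (Stmt.tab 10 [0, 1] (.var 21)).run ρ m with hm1'
  set m2 := (Stmt.tab 11 [0, 1, 2] (.add (.get 1 (.var 26)) (.lit 1))).run ρ m1 with hm2'
  set m3 := (Stmt.tab 12 [0] (.not (.get 0 (.var 21)))).run ρ m2 with hm3'
  have e0 : m2 0 = m 0 := by
    rw [hm2', Stmt.run_of_not_writes rfl, hm1', Stmt.run_of_not_writes rfl]
  have e1 : m1 1 = m 1 := by rw [hm1', Stmt.run_of_not_writes rfl]
  have e10 : m3 10 = m1 10 := by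
    rw [hm3', Stmt.run_of_not_writes rfl, hm2', Stmt.run_of_not_writes rfl]
  have e11 : m3 11 = m2 11 := by rw [hm3', Stmt.run_of_not_writes rfl]
  have h10 : ∀ r : Fin n × Fin a, m3 10 (r.1 * a + r.2) = r.1 := by
    intro r
    have := Stmt.run_tab (A := 10) (e := .var 21) rfl (L := [0, 1]) (by decide) ρ m
      (vs := [r.1, r.2]) (by simp [hρ.p0, hρ.p1])
    simpa [tabPos, tabEnv, Exp.eval, Function.update_apply, hρ.p0, hρ.p1, ← hm1', ← e10] using this
  have h11 : ∀ (r : Fin n × Fin a) (o : Fin b),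
      m3 11 ((r.1 * a + r.2) * b + o) = φ.next r.1 (r.2, o) + 1 := by
    intro r o
    have := Stmt.run_tab (A := 11) (e := .add (.get 1 (.var 26)) (.lit 1)) rfl (L := [0, 1, 2])
      (by decide) ρ m1 (vs := [r.1, r.2, o]) (by simp [hρ.p0, hρ.p1, hρ.p2])
    simp only [tabPos, tabEnv, Exp.eval, Function.update_apply, hρ.p0, hρ.p1, hρ.p2, ← hm2', ← e11,
      e1] at this
    norm_num at this
    rw [this, ← hm1]; rfl
  have h12 : ∀ q : Fin n, m3 12 q ≠ 0 ↔ q ∉ φ.safe := by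
    intro q
    have := Stmt.run_tab (A := 12) (e := .not (.get 0 (.var 21))) rfl (L := [0])
      (by decide) ρ m2 (vs := [q]) (by simp [hρ.p0])
    simp only [tabPos, zero_mul, zero_add, ← hm3'] at this
    rw [this]
    change Exp.Holds _ _ _ ↔ _
    simp [tabEnv, Exp.eval, e0, ← hm0]
  have key := run_propagate_horn φ.losing (NV := 0) (NR := 7) (D := 2) (IT := 17) (by decide) ρ m3
    (eV := Fin.val) (eR := fun r => r.1 * a + r.2) (eJ := Fin.val)
    (by rw [hρ.p0]; exact .fin n) (by rw [hρ.p7]; exact (Encodes.fin n).prod (.fin a))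
    (by rw [hρ.p2]; exact .fin b)
    (by
      rw [hρ.p0, hρ.p7, hρ.p2, hρ.p17]
      have h1 : n ≤ 2 ^ n * n := Nat.le_mul_of_pos_left _ (by positivity)
      have h2 : n * a * b ≤ 2 ^ n * n * (a * b) := by
        rw [mul_assoc n]; exact Nat.mul_le_mul_right _ h1
      omega)
    h10 (fun r o _ => by rw [hρ.p2]; exact h11 r o) (fun _ _ h => absurd trivial h) h12 q
  have := Stmt.run_tab (A := 4) (e := .not (.get 13 (.var 21))) rfl (L := [0])
    (by decide) ρ ((propagate 0 7 2 17).run ρ m3) (vs := [q]) (by simp [hρ.p0])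
  simp only [tabPos, zero_mul, zero_add] at this
  rw [this, φ.mem_winning_iff_not_derived, key.derived_iff, not_not]
  change Exp.Holds _ _ _ ↔ _
  simp [tabEnv, Exp.eval]

/-! ### The program: tables of the arena -/

/-- The position of an entry of the transition table of the specification. -/
def deltaIndex (s i o : ℕ) : Exp := .add (.mulv (.add (.mulv (.var s) 1) (.var i)) 2) (.var o)

/-- The variable `s` is in the set coded by the variable 21. -/
def memExp (s : ℕ) : Exp := .get 3 (.add (.mulv (.var 21) 0) (.var s))

/-- Enter the letters without a violation into array 6. -/
def calmStmt : Stmt :=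
  -- In tables over masks and states, variable 21 is the mask, 23 the state, 25 the input, 27 the
  -- output of the design, 28 the number of the entry, and 29 the corrected output.
  .tab 6 [10, 0, 1, 2] (.any 40 0 (.and (memExp 40) (.get 4 (.get 1 (deltaIndex 40 25 27)))))

/-- The variable 40 is in the next monitored set. -/
def monitorExp : Exp :=
  .and (.get 4 (.var 40)) (.or
    (.and (.get 6 (.var 28))
      (.any 41 0 (.and (memExp 41) (.eq (.get 1 (deltaIndex 41 25 27)) (.var 40)))))
    (.and (.not (.get 6 (.var 28)))
      (.any 41 0 (.and (memExp 41)
        (.any 42 2 (.eq (.get 1 (deltaIndex 41 25 42)) (.var 40)))))))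

/-- Enter the successor positions into array 5. -/
def moveStmt : Stmt :=
  .tab 5 [10, 0, 1, 2, 2]
    (.add (.mulv (.sum 40 0 (.ite monitorExp (.get 2 (.var 40)) (.lit 0))) 0)
      (.get 1 (deltaIndex 23 25 29)))

/-- Enter the winning positions into array 7. -/
def winStmt : Stmt := .tab 7 [10, 0] (.get 4 (.var 23))

/-- The arena is stored in the arrays 5, 6 and 7. -/
structure StoresArena (G : Arena φ (Fin K)) (m : ℕ → ℕ → ℕ) : Prop where
  move : ∀ p x (o : Fin b), m 5 (entryIndex (p, x) * b + o) = G.move p x o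
  calm : ∀ p x, m 6 (entryIndex (p, x)) ≠ 0 ↔ G.Calm p x
  win : ∀ p : Fin K, m 7 p ≠ 0 ↔ G.Win p

/-- The monitor tables are stored in the arrays 1 to 4. -/
structure StoresSets (φ : SafetyAutomaton (Fin n) (Fin a) (Fin b)) (m : ℕ → ℕ → ℕ) : Prop where
  next : ∀ (q : Fin n) (i : Fin a) (o : Fin b), m 1 (tableIndex a b q i o) = φ.next q (i, o)
  pow : ∀ s < n, m 2 s = 2 ^ s
  bit : ∀ (U : Set (Fin n)) (s : Fin n), m 3 (setCode U * n + s) ≠ 0 ↔ s ∈ U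
  winning : ∀ q : Fin n, m 4 q ≠ 0 ↔ q ∈ φ.winning

theorem exists_lt_iff_fin {n : ℕ} {p : ℕ → Prop} : (∃ i < n, p i) ↔ ∃ i : Fin n, p i :=
  ⟨fun ⟨i, h, hp⟩ => ⟨⟨i, h⟩, hp⟩, fun ⟨i, hp⟩ => ⟨i, i.2, hp⟩⟩

namespace StoresSets

theorem next' (hm : StoresSets φ m) (q : Fin n) (i : Fin a) (o : Fin b) :
    m 1 ((q * a + i) * b + o) = φ.next q (i, o) := hm.next q i o

theorem bit' (hm : StoresSets φ m) (U : Set (Fin n)) (s : Fin n) :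
    ¬ m 3 (setCode U * n + s) = 0 ↔ s ∈ U := hm.bit U s

theorem winning' (hm : StoresSets φ m) (q : Fin n) : ¬ m 4 q = 0 ↔ q ∈ φ.winning := hm.winning q

end StoresSets

theorem run_calmStmt (hρ : Params n a b (2 ^ n * n) ρ) (hm : StoresSets φ m)
    (p : Fin (2 ^ n * n)) (x : Fin a × Fin b) :
    calmStmt.run ρ m 6 (entryIndex (p, x)) ≠ 0 ↔ φ.arena.Calm p x := by
  have := Stmt.run_tab (A := 6)
    (e := .any 40 0 (.and (memExp 40) (.get 4 (.get 1 (deltaIndex 40 25 27))))) rfl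
    (L := [10, 0, 1, 2]) (by decide) ρ m
    (vs := [setCode (φ.arena.pos p).2, (φ.arena.pos p).1, x.1, x.2])
    (by simp [hρ.p0, hρ.p1, hρ.p2, hρ.p10, setCode_lt])
  simp only [tabPos, zero_mul, zero_add, hρ.p0, hρ.p1, hρ.p2, ← φ.arena_val] at this
  rw [calmStmt, entryIndex, tableIndex, this]
  change Exp.Holds _ _ _ ↔ _
  simp only [Exp.holds_any, Exp.holds_and, memExp, deltaIndex, Exp.holds_get]
  simp only [tabEnv, Exp.eval, Function.update_self, ne_eq, Nat.reduceEqDiff, not_false_eq_true,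
    Function.update_of_ne, hρ.p0, hρ.p1, hρ.p2, exists_lt_iff_fin]
  simp [hm.next', hm.bit', hm.winning', Arena.Calm, SafetyAutomaton.Violates]

theorem run_moveStmt (hρ : Params n a b (2 ^ n * n) ρ) (hm : StoresSets φ m)
    (h6 : ∀ p x, m 6 (entryIndex (p, x)) ≠ 0 ↔ φ.arena.Calm p x)
    (p : Fin (2 ^ n * n)) (x : Fin a × Fin b) (o : Fin b) :
    moveStmt.run ρ m 5 (entryIndex (p, x) * b + o) = φ.arena.move p x o := by
  have h6' : ¬ m 6 (((p : ℕ) * a + x.1) * b + x.2) = 0 ↔ φ.arena.Calm p x := h6 p x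
  have := Stmt.run_tab (A := 5)
    (e := .add (.mulv (.sum 40 0 (.ite monitorExp (.get 2 (.var 40)) (.lit 0))) 0)
      (.get 1 (deltaIndex 23 25 29))) rfl
    (L := [10, 0, 1, 2, 2]) (by decide) ρ m
    (vs := [setCode (φ.arena.pos p).2, (φ.arena.pos p).1, x.1, x.2, o])
    (by simp [hρ.p0, hρ.p1, hρ.p2, hρ.p10, setCode_lt])
  simp only [tabPos, zero_mul, zero_add, hρ.p0, hρ.p1, hρ.p2, ← φ.arena_val] at this
  rw [moveStmt, entryIndex, tableIndex, this, φ.arena_val (φ.arena.move p x o)]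
  simp only [φ.arena.pos_move]
  set ρ' := tabEnv 20 [10, 0, 1, 2, 2] (Function.update ρ 20 0)
    [setCode (φ.arena.pos p).2, (φ.arena.pos p).1, x.1, x.2, o] with hρ'
  have hmon : ∀ s : Fin n, monitorExp.Holds (Function.update ρ' 40 s) m ↔
      s ∈ φ.monitorStep (φ.arena.pos p).2 x := by
    intro s
    simp only [monitorExp, Exp.holds_any, Exp.holds_and, Exp.holds_or, Exp.holds_not, memExp,
      deltaIndex, Exp.holds_get, Exp.holds_eq]
    simp only [hρ', tabEnv, Exp.eval, Function.update_self, ne_eq, Nat.reduceEqDiff,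
      not_false_eq_true, Function.update_of_ne, hρ.p0, hρ.p1, hρ.p2, exists_lt_iff_fin, zero_mul,
      zero_add]
    simp only [← φ.arena_val, hm.next', hm.bit', hm.winning', h6', Arena.Calm, not_not,
      SafetyAutomaton.monitorStep, Set.mem_ofPred_eq, Fin.val_inj]
  classical
  rw [setCode_eq_sum_range (φ.monitorStep (φ.arena.pos p).2 x)
    (fun s => monitorExp.Holds (Function.update ρ' 40 s) m) hmon]
  have hnext : (Exp.get 1 (deltaIndex 23 25 29)).eval ρ' m =
      φ.next (φ.arena.pos p).1 (x.1, o) := by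
    simp [hρ', deltaIndex, tabEnv, Exp.eval, hρ.p1, hρ.p2, hm.next']
  have h0 : ρ' 0 = n := by simp [hρ', tabEnv, hρ.p0]
  rw [Exp.eval, hnext, Exp.eval, Exp.eval, h0]
  congr 2
  refine Finset.sum_congr rfl fun s hs => ?_
  rw [Exp.eval_ite_of]
  simp only [Exp.eval, Function.update_self, hm.pow s (Finset.mem_range.1 hs)]

theorem run_winStmt (hρ : Params n a b (2 ^ n * n) ρ) (hm : StoresSets φ m)
    (p : Fin (2 ^ n * n)) : winStmt.run ρ m 7 p ≠ 0 ↔ φ.arena.Win p := by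
  have := Stmt.run_tab (A := 7) (e := .get 4 (.var 23)) rfl
    (L := [10, 0]) (by decide) ρ m (vs := [setCode (φ.arena.pos p).2, (φ.arena.pos p).1])
    (by simp [hρ.p0, hρ.p10, setCode_lt])
  simp only [tabPos, zero_mul, zero_add, hρ.p0, ← φ.arena_val] at this
  rw [winStmt, this]
  simp [tabEnv, Exp.eval, hm.winning', Arena.Win]

/-- Enter the tables of the arena. -/
def arenaStmt : Stmt :=
  .seq bitStmt (.seq winningStmt (.seq calmStmt (.seq moveStmt winStmt)))

theorem run_arenaStmt (hρ : Params n a b (2 ^ n * n) ρ) (hb : 0 < b) (hm : StoresSpec φ m)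
    (hpow : ∀ s ≤ n, m 2 s = 2 ^ s) : StoresArena φ.arena (arenaStmt.run ρ m) := by
  simp only [arenaStmt, Stmt.run]
  set m1 := bitStmt.run ρ m with hm1
  set m2 := winningStmt.run ρ m1 with hm2
  set m3 := calmStmt.run ρ m2 with hm3
  set m4 := moveStmt.run ρ m3 with hm4
  have h2 : StoresSets φ m2 := by
    refine ⟨?_, ?_, ?_, ?_⟩
    · rw [hm2, Stmt.run_of_not_writes rfl, hm1, Stmt.run_of_not_writes rfl]
      exact hm.2
    · rw [hm2, Stmt.run_of_not_writes rfl, hm1, Stmt.run_of_not_writes rfl]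
      exact fun s hs => hpow s hs.le
    · rw [hm2, Stmt.run_of_not_writes rfl, hm1]
      intro U s
      rw [run_bitStmt hρ.p0 hρ.p10 (fun s hs => hpow s hs.le) _ (setCode_lt U) _ s.2,
        testBit_setCode]
    · refine run_winningStmt hρ hb ⟨?_, ?_⟩
      · rw [hm1, Stmt.run_of_not_writes rfl]; exact hm.1
      · rw [hm1, Stmt.run_of_not_writes rfl]; exact hm.2
  have h3 : StoresSets φ m3 := by
    refine ⟨?_, ?_, ?_, ?_⟩ <;> rw [hm3, Stmt.run_of_not_writes rfl]
    exacts [h2.next, h2.pow, h2.bit, h2.winning]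
  have h4 : StoresSets φ m4 := by
    refine ⟨?_, ?_, ?_, ?_⟩ <;> rw [hm4, Stmt.run_of_not_writes rfl]
    exacts [h3.next, h3.pow, h3.bit, h3.winning]
  have h6 := run_calmStmt hρ h2
  rw [← hm3] at h6
  refine ⟨?_, ?_, run_winStmt hρ h4⟩
  · rw [Stmt.run_of_not_writes rfl]
    exact run_moveStmt hρ h3 h6
  · rw [Stmt.run_of_not_writes rfl, hm4, Stmt.run_of_not_writes rfl]
    exact h6

end Shielding

namespace Shielding

open RAM

variable {n a b K : ℕ} {φ : SafetyAutomaton (Fin n) (Fin a) (Fin b)} {G : Arena φ (Fin K)}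
  {ρ : ℕ → ℕ} {m : ℕ → ℕ → ℕ}

/-! ### The program: expressions for positions and letters -/

theorem Encodes.exists_lt_iff {A : Type} {e : A → ℕ} {N : ℕ} (h : Encodes e N) {p : ℕ → Prop} :
    (∃ i < N, p i) ↔ ∃ x, p (e x) :=
  ⟨fun ⟨i, hi, hp⟩ => by obtain ⟨x, rfl⟩ := h.surj i hi; exact ⟨x, hp⟩,
    fun ⟨x, hx⟩ => ⟨e x, h.lt x, hx⟩⟩

theorem Encodes.forall_lt_iff {A : Type} {e : A → ℕ} {N : ℕ} (h : Encodes e N) {p : ℕ → Prop} :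
    (∀ i < N, p i) ↔ ∀ x, p (e x) :=
  ⟨fun hp x => hp _ (h.lt x), fun hp i hi => by obtain ⟨x, rfl⟩ := h.surj i hi; exact hp x⟩

/-- The number of an entry and an output. -/
def edgeIndex (v : Fin K × Fin a × Fin b) (o : Fin b) : ℕ := entryIndex v * b + o

/-- The number of an entry, an output, and the next letter. -/
def lookIndex (v : Fin K × Fin a × Fin b) (o : Fin b) (y : Fin a × Fin b) : ℕ :=
  edgeIndex v o * (a * b) + letterIndex y

theorem encodes_edgeIndex (K a b : ℕ) :
    Encodes (fun r : (Fin K × Fin a × Fin b) × Fin b => edgeIndex r.1 r.2) (K * (a * b) * b) :=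
  (encodes_entryIndex K a b).prod (.fin b)

theorem encodes_lookIndex (K a b : ℕ) :
    Encodes (fun r : (Fin K × Fin a × Fin b) × Fin b × Fin a × Fin b => lookIndex r.1 r.2.1 r.2.2)
      (K * (a * b) * b * (a * b)) := by
  have := (encodes_edgeIndex K a b).prod (encodes_letterIndex a b)
  refine ⟨fun r r' h => ?_, fun r => this.lt ((r.1, r.2.1), r.2.2), fun k hk => ?_⟩
  · have := this.inj (a₁ := ((r.1, r.2.1), r.2.2)) (a₂ := ((r'.1, r'.2.1), r'.2.2)) h
    simp only [Prod.mk.injEq] at this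
    exact Prod.ext this.1.1 (Prod.ext this.1.2 this.2)
  · obtain ⟨⟨⟨v, o⟩, y⟩, h⟩ := this.surj k hk
    exact ⟨(v, o, y), h⟩

/-- One more than `e` if `c` holds, else zero. -/
def RAM.Exp.guard (c e : Exp) : Exp := .ite c (.add e (.lit 1)) (.lit 0)

theorem eval_guard_pos {c e : Exp} (h : c.Holds ρ m) : (Exp.guard c e).eval ρ m = e.eval ρ m + 1 :=
  if_pos h

theorem eval_guard_neg {c e : Exp} (h : ¬ c.Holds ρ m) : (Exp.guard c e).eval ρ m = 0 :=
  if_neg h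

/-- The number of the entry `v` and the output `w`, both given by variables. -/
def edgeExp (v w : ℕ) : Exp := .add (.mulv (.var v) 2) (.var w)

/-- The number of the entry `v`, the output `w` and the letter `z`. -/
def lookExp (v w z : ℕ) : Exp := .add (.mulv (edgeExp v w) 5) (.var z)

/-- The position after the entry `v` with the output `w`. -/
def moveExp (v w : ℕ) : Exp := .get 5 (edgeExp v w)

/-- The entry after the entry `v` with the output `w` and the next letter `z`. -/
def nextExp (v w z : ℕ) : Exp := .add (.mulv (moveExp v w) 5) (.var z)

section eval

variable {v : Fin K × Fin a × Fin b} {o : Fin b} {y : Fin a × Fin b} {i j k : ℕ}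

theorem eval_edgeExp (hρ : Params n a b K ρ) (hi : ρ i = entryIndex v) (hj : ρ j = o) :
    (edgeExp i j).eval ρ m = edgeIndex v o := by
  simp [edgeExp, Exp.eval, hi, hj, hρ.p2, edgeIndex]

theorem eval_lookExp (hρ : Params n a b K ρ) (hi : ρ i = entryIndex v) (hj : ρ j = o)
    (hk : ρ k = letterIndex y) : (lookExp i j k).eval ρ m = lookIndex v o y := by
  simp only [lookExp, Exp.eval, eval_edgeExp hρ hi hj, hρ.p5, hk, lookIndex]

theorem eval_moveExp (hρ : Params n a b K ρ) (hm : StoresArena G m) (hi : ρ i = entryIndex v)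
    (hj : ρ j = o) : (moveExp i j).eval ρ m = G.move v.1 v.2 o := by
  rw [moveExp, Exp.eval, eval_edgeExp hρ hi hj]
  exact hm.move v.1 v.2 o

theorem eval_nextExp (hρ : Params n a b K ρ) (hm : StoresArena G m) (hi : ρ i = entryIndex v)
    (hj : ρ j = o) (hk : ρ k = letterIndex y) :
    (nextExp i j k).eval ρ m = entryIndex (G.move v.1 v.2 o, y) := by
  simp only [nextExp, Exp.eval, eval_moveExp hρ hm hi hj, hρ.p5, hk, entryIndex_eq]

end eval

theorem Params.congr (hρ : Params n a b K ρ) {ρ' : ℕ → ℕ} (h : ∀ P < 20, ρ' P = ρ P) :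
    Params n a b K ρ' := by
  cases hρ
  constructor <;> rw [h _ (by decide)] <;> assumption

theorem Params.update (hρ : Params n a b K ρ) {x k : ℕ} (hx : 20 ≤ x) :
    Params n a b K (Function.update ρ x k) :=
  hρ.congr fun P hP => Function.update_of_ne (by omega) _ _

/-- The variables of a loop over the entries. -/
structure EntryEnv (n : ℕ) (v : Fin K × Fin a × Fin b) (ρ : ℕ → ℕ) : Prop where
  params : Params n a b K ρ
  var_p : ρ 21 = v.1
  var_o : ρ 25 = v.2.2
  var_v : ρ 26 = entryIndex v

/-- The concrete environment of the loops is hidden, except for the variables that occur in table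
expressions: 21 is the position, 25 the output of the design, and 26 the number of the entry. -/
theorem run_tab_entry (hρ : Params n a b K ρ) {A : ℕ} {e : Exp} (he : e.reads A = false)
    (v : Fin K × Fin a × Fin b) : ∃ ρ', EntryEnv n v ρ' ∧
      (Stmt.tab A [11, 1, 2] e).run ρ m A (entryIndex v) = e.eval ρ' m := by
  have := Stmt.run_tab he (L := [11, 1, 2]) (by decide) ρ m
    (vs := [v.1, v.2.1, v.2.2]) (by simp [hρ.p11, hρ.p1, hρ.p2])
  rw [show tabPos ρ 0 _ _ = entryIndex v by simp [tabPos, hρ.p1, hρ.p2, entryIndex, tableIndex]] at this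
  refine ⟨_, ⟨hρ.congr fun P hP => ?_, ?_, ?_, ?_⟩, this⟩
  · simp only [tabEnv]
    repeat rw [Function.update_of_ne (by omega)]
  all_goals simp [tabEnv, hρ.p1, hρ.p2, entryIndex, tableIndex]

/-- The variables of a loop over the entries and outputs. -/
structure EdgeEnv (n : ℕ) (v : Fin K × Fin a × Fin b) (o : Fin b) (ρ : ℕ → ℕ) : Prop
    extends EntryEnv n v ρ where
  var_o' : ρ 27 = o

theorem run_tab_edge (hρ : Params n a b K ρ) {A : ℕ} {e : Exp} (he : e.reads A = false)
    (v : Fin K × Fin a × Fin b) (o : Fin b) : ∃ ρ', EdgeEnv n v o ρ' ∧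
      (Stmt.tab A [11, 1, 2, 2] e).run ρ m A (edgeIndex v o) = e.eval ρ' m := by
  have := Stmt.run_tab he (L := [11, 1, 2, 2]) (by decide) ρ m
    (vs := [v.1, v.2.1, v.2.2, o]) (by simp [hρ.p11, hρ.p1, hρ.p2])
  rw [show tabPos ρ 0 _ _ = edgeIndex v o by simp [tabPos, hρ.p1, hρ.p2, edgeIndex, entryIndex, tableIndex]] at this
  refine ⟨_, ⟨⟨hρ.congr fun P hP => ?_, ?_, ?_, ?_⟩, ?_⟩, this⟩
  · simp only [tabEnv]
    repeat rw [Function.update_of_ne (by omega)]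
  all_goals simp [tabEnv, hρ.p1, hρ.p2, entryIndex, tableIndex]

/-- The variables of a loop over the entries, outputs, and next letters. -/
structure LookEnv (n : ℕ) (v : Fin K × Fin a × Fin b) (o : Fin b) (y : Fin a × Fin b)
    (ρ : ℕ → ℕ) : Prop extends EdgeEnv n v o ρ where
  var_y : ρ 29 = letterIndex y

theorem run_tab_look (hρ : Params n a b K ρ) {A : ℕ} {e : Exp} (he : e.reads A = false)
    (v : Fin K × Fin a × Fin b) (o : Fin b) (y : Fin a × Fin b) : ∃ ρ', LookEnv n v o y ρ' ∧
      (Stmt.tab A [11, 1, 2, 2, 5] e).run ρ m A (lookIndex v o y) = e.eval ρ' m := by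
  have := Stmt.run_tab he (L := [11, 1, 2, 2, 5]) (by decide) ρ m
    (vs := [v.1, v.2.1, v.2.2, o, letterIndex y])
    (by simp [hρ.p11, hρ.p1, hρ.p2, hρ.p5, (encodes_letterIndex a b).lt])
  rw [show tabPos ρ 0 _ _ = lookIndex v o y by simp [tabPos, hρ.p1, hρ.p2, hρ.p5, lookIndex, edgeIndex, entryIndex, tableIndex]] at this
  refine ⟨_, ⟨⟨⟨hρ.congr fun P hP => ?_, ?_, ?_, ?_⟩, ?_⟩, ?_⟩, this⟩
  · simp only [tabEnv]
    repeat rw [Function.update_of_ne (by omega)]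
  all_goals simp [tabEnv, hρ.p1, hρ.p2, entryIndex, tableIndex]

theorem run_tab_single {A : ℕ} {e : Exp} (he : e.reads A = false) {P : ℕ} (hP : P < 20)
    (hρ : Params n a b K ρ) {w : ℕ} (hw : w < ρ P) : ∃ ρ', Params n a b K ρ' ∧ ρ' 21 = w ∧
      (Stmt.tab A [P] e).run ρ m A w = e.eval ρ' m := by
  have := Stmt.run_tab he (L := [P]) (by simpa using hP) ρ m (vs := [w]) (by simpa using hw)
  rw [show tabPos ρ 0 _ _ = w by simp [tabPos]] at this
  refine ⟨_, hρ.congr fun P hP => ?_, ?_, this⟩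
  · simp only [tabEnv]
    repeat rw [Function.update_of_ne (by omega)]
  · simp [tabEnv]

theorem StoresArena.congr (hm : StoresArena G m) {m' : ℕ → ℕ → ℕ} (h5 : m' 5 = m 5)
    (h6 : m' 6 = m 6) (h7 : m' 7 = m 7) : StoresArena G m' :=
  ⟨by rw [h5]; exact hm.move, by rw [h6]; exact hm.calm, by rw [h7]; exact hm.win⟩

theorem StoresArena.run (hm : StoresArena G m) {p : Stmt} (h5 : p.writes 5 = false)
    (h6 : p.writes 6 = false) (h7 : p.writes 7 = false) : StoresArena G (p.run ρ m) :=
  hm.congr (Stmt.run_of_not_writes h5) (Stmt.run_of_not_writes h6) (Stmt.run_of_not_writes h7)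

/-! ### The program: free positions -/

/-- Enter the entries from which no corrections are needed into array 21. -/
def copyStmt : Stmt :=
  .seq (.tab 10 [11, 1, 2] (.var 21))
    (.seq (.tab 11 [11, 1, 2] (.guard (.get 6 (.var 26)) (moveExp 26 25)))
      (.seq (.tab 12 [11] (.not (.get 7 (.var 21))))
        (.seq (propagate 11 12 4 17) (.tab 21 [11, 1, 2] (.not (.get 13 (moveExp 26 25)))))))

theorem run_copyStmt (hρ : Params n a b K ρ) (hm : StoresArena G m) (v) :
    copyStmt.run ρ m 21 (entryIndex v) ≠ 0 ↔ G.Copy v.1 v.2 := by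
  simp only [copyStmt, Stmt.run]
  set s1 := Stmt.tab 10 [11, 1, 2] (.var 21) with hs1
  set s2 := Stmt.tab 11 [11, 1, 2] (.guard (.get 6 (.var 26)) (moveExp 26 25)) with hs2
  set s3 := Stmt.tab 12 [11] (.not (.get 7 (.var 21))) with hs3
  set m1 := s1.run ρ m with hm1
  set m2 := s2.run ρ m1 with hm2
  set m3 := s3.run ρ m2 with hm3
  have g1 : StoresArena G m1 := hm.run rfl rfl rfl
  have g2 : StoresArena G m2 := g1.run rfl rfl rfl
  have g3 : StoresArena G m3 := g2.run rfl rfl rfl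
  have h10 : ∀ v : Fin K × Fin a × Fin b, m3 10 (entryIndex v) = v.1 := by
    intro v
    rw [hm3, Stmt.run_of_not_writes rfl, hm2, Stmt.run_of_not_writes rfl]
    obtain ⟨ρ', h, he⟩ := run_tab_entry (m := m) hρ (A := 10) (e := .var 21) rfl v
    rw [hm1, he, Exp.eval, h.var_p]
  have h11 : ∀ v : Fin K × Fin a × Fin b,
      (G.Calm v.1 v.2 → m3 11 (entryIndex v) = G.move v.1 v.2 v.2.2 + 1) ∧
        (¬ G.Calm v.1 v.2 → m3 11 (entryIndex v) = 0) := by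
    intro v
    rw [hm3, Stmt.run_of_not_writes rfl]
    obtain ⟨ρ', h, he⟩ := run_tab_entry (m := m1) hρ (A := 11) (e := .guard (.get 6 (.var 26)) (moveExp 26 25)) rfl v
    have hc : (Exp.get 6 (.var 26)).Holds ρ' m1 ↔ G.Calm v.1 v.2 := by
      rw [Exp.holds_get, Exp.eval, h.var_v]; exact g1.calm v.1 v.2
    rw [hm2, he, ← eval_moveExp h.params g1 h.var_v h.var_o, ← hc]
    exact ⟨eval_guard_pos, eval_guard_neg⟩
  have h12 : ∀ p : Fin K, m3 12 p ≠ 0 ↔ ¬ G.Win p := by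
    intro p
    obtain ⟨ρ', h, h21, he⟩ := run_tab_single (m := m2) (A := 12) (e := .not (.get 7 (.var 21))) rfl
      (P := 11) (by decide) hρ (w := p) (by simp [hρ.p11])
    rw [hm3, he]
    change Exp.Holds _ _ _ ↔ _
    rw [Exp.holds_not, Exp.holds_get, Exp.eval, h21, g2.win]
  -- The rules are the entries, with a single slot each; parameter 4 is one.
  have key := run_propagate_horn G.escape (NV := 11) (NR := 12) (D := 4) (IT := 17) (by decide) ρ m3
    (eV := Fin.val) (eR := entryIndex) (eJ := fun _ => 0)
    (by rw [hρ.p11]; exact .fin K) (by rw [hρ.p12]; exact encodes_entryIndex K a b)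
    (by rw [hρ.p4]; exact .unit)
    (by
      rw [hρ.p11, hρ.p12, hρ.p4, hρ.p17]
      omega)
    h10 (fun r _ h => by rw [hρ.p4, mul_one, add_zero]; exact (h11 r).1 h)
    (fun r _ h => by rw [hρ.p4, mul_one, add_zero]; exact (h11 r).2 h) h12
  have g4 : StoresArena G ((propagate 11 12 4 17).run ρ m3) := g3.run rfl rfl rfl
  obtain ⟨ρ', h, he⟩ := run_tab_entry (m := (propagate 11 12 4 17).run ρ m3) hρ (A := 21)
    (e := .not (.get 13 (moveExp 26 25))) rfl v
  rw [he]
  change Exp.Holds _ _ _ ↔ _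
  rw [Exp.holds_not, Exp.holds_get, eval_moveExp h.params g4 h.var_v h.var_o, Arena.Copy, Arena.Free,
    (key _).derived_iff]

/-! ### The program: ending the corrections -/

/-- Enter the ranks for an adverse design into array 23 and the ranks for a collaborative design
into array 24. -/
def rankStmt : Stmt :=
  .seq (.tab 11 [11, 1, 2, 2, 5] (.guard (.and (.get 7 (moveExp 26 27)) (.get 6 (nextExp 26 27 29)))
      (nextExp 26 27 29)))
    (.seq (.tab 12 [12] (.get 21 (.var 21)))
      (.seq (.tab 10 [11, 1, 2, 2] (.var 26))
        (.seq (propagate 12 13 5 17)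
          (.seq (.tab 23 [12] (.get 13 (.var 21)))
            (.seq (.tab 10 [11, 1, 2, 2, 5] (.var 26))
              (.seq (propagate 12 14 4 17) (.tab 24 [12] (.get 13 (.var 21)))))))))

theorem run_copy_array (hρ : Params n a b K ρ) {A : ℕ} (hA : 13 ≠ A) (v : Fin K × Fin a × Fin b) :
    (Stmt.tab A [12] (.get 13 (.var 21))).run ρ m A (entryIndex v) = m 13 (entryIndex v) := by
  obtain ⟨ρ', -, h21, he⟩ := run_tab_single (m := m) (A := A) (e := .get 13 (.var 21))
    (by simp [Exp.reads, hA]) (P := 12) (by decide) hρ (w := entryIndex v)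
    (by rw [hρ.p12]; exact (encodes_entryIndex K a b).lt v)
  rw [he, Exp.eval, Exp.eval, h21]

theorem run_rankStmt (hρ : Params n a b K ρ) (hm : StoresArena G m)
    (h21 : ∀ v, m 21 (entryIndex v) ≠ 0 ↔ G.Copy v.1 v.2) (v : Fin K × Fin a × Fin b) :
    G.adverse.IsRank v (rankStmt.run ρ m 23 (entryIndex v)) ∧
      G.collab.IsRank v (rankStmt.run ρ m 24 (entryIndex v)) := by
  simp only [rankStmt, Stmt.run]
  set s1 := Stmt.tab 11 [11, 1, 2, 2, 5] (.guard (.and (.get 7 (moveExp 26 27))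
    (.get 6 (nextExp 26 27 29))) (nextExp 26 27 29)) with hs1
  set s2 := Stmt.tab 12 [12] (.get 21 (.var 21)) with hs2
  set s3 := Stmt.tab 10 [11, 1, 2, 2] (.var 26) with hs3
  set s4 := propagate 12 13 5 17 with hs4
  set s5 := Stmt.tab 23 [12] (.get 13 (.var 21)) with hs5
  set s6 := Stmt.tab 10 [11, 1, 2, 2, 5] (.var 26) with hs6
  set m1 := s1.run ρ m with hm1
  set m2 := s2.run ρ m1 with hm2
  set m3 := s3.run ρ m2 with hm3
  set m4 := s4.run ρ m3 with hm4
  set m5 := s5.run ρ m4 with hm5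
  set m6 := s6.run ρ m5 with hm6
  -- One table of bodies serves both systems, because slot `y` of the adverse rule for an entry and
  -- an output has the same number as the collaborative rule for the entry, the output and `y`. Only
  -- the heads are tabulated anew.
  have h11 : ∀ (v : Fin K × Fin a × Fin b) (o : Fin b) (y : Fin a × Fin b),
      (G.Win (G.move v.1 v.2 o) ∧ G.Calm (G.move v.1 v.2 o) y →
        m1 11 (lookIndex v o y) = entryIndex (G.move v.1 v.2 o, y) + 1) ∧
      (¬ (G.Win (G.move v.1 v.2 o) ∧ G.Calm (G.move v.1 v.2 o) y) →
        m1 11 (lookIndex v o y) = 0) := by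
    intro v o y
    obtain ⟨ρ', h, he⟩ := run_tab_look (m := m) hρ (A := 11) (e := .guard (.and
      (.get 7 (moveExp 26 27)) (.get 6 (nextExp 26 27 29))) (nextExp 26 27 29)) rfl v o y
    have hc : (Exp.and (.get 7 (moveExp 26 27)) (.get 6 (nextExp 26 27 29))).Holds ρ' m ↔
        G.Win (G.move v.1 v.2 o) ∧ G.Calm (G.move v.1 v.2 o) y := by
      rw [Exp.holds_and, Exp.holds_get, Exp.holds_get,
        eval_moveExp h.params hm h.var_v h.var_o',
        eval_nextExp h.params hm h.var_v h.var_o' h.var_y, hm.win, hm.calm]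
    rw [hm1, he, ← eval_nextExp h.params hm h.var_v h.var_o' h.var_y, ← hc]
    exact ⟨eval_guard_pos, eval_guard_neg⟩
  have h12 : ∀ v : Fin K × Fin a × Fin b, m2 12 (entryIndex v) ≠ 0 ↔ G.Copy v.1 v.2 := by
    intro v
    obtain ⟨ρ', -, h, he⟩ := run_tab_single (m := m1) (A := 12) (e := .get 21 (.var 21)) rfl
      (P := 12) (by decide) hρ (w := entryIndex v)
      (by rw [hρ.p12]; exact (encodes_entryIndex K a b).lt v)
    rw [hm2, he, Exp.eval, Exp.eval, h, hm1, Stmt.run_of_not_writes rfl]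
    exact h21 v
  have h10 : ∀ r : (Fin K × Fin a × Fin b) × Fin b,
      m3 10 (edgeIndex r.1 r.2) = entryIndex r.1 := by
    intro r
    obtain ⟨ρ', h, he⟩ := run_tab_edge (m := m2) hρ (A := 10) (e := .var 26) rfl r.1 r.2
    rw [hm3, he, Exp.eval, h.var_v]
  have h10' : ∀ r : (Fin K × Fin a × Fin b) × Fin b × Fin a × Fin b,
      m6 10 (lookIndex r.1 r.2.1 r.2.2) = entryIndex r.1 := by
    intro r
    obtain ⟨ρ', h, he⟩ := run_tab_look (m := m5) hρ (A := 10) (e := .var 26) rfl r.1 r.2.1 r.2.2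
    rw [hm6, he, Exp.eval, h.var_v]
  have e3 : m3 11 = m1 11 ∧ m3 12 = m2 12 := by
    rw [hm3, Stmt.run_of_not_writes rfl, hm2, Stmt.run_of_not_writes rfl,
      Stmt.run_of_not_writes rfl]
    exact ⟨rfl, rfl⟩
  have e6 : m6 11 = m1 11 ∧ m6 12 = m2 12 := by
    rw [hm6, Stmt.run_of_not_writes rfl, hm5, Stmt.run_of_not_writes rfl, hm4,
      Stmt.run_of_not_writes rfl, e3.1, Stmt.run_of_not_writes rfl, Stmt.run_of_not_writes rfl,
      Stmt.run_of_not_writes rfl, e3.2]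
    exact ⟨rfl, rfl⟩
  have key := run_propagate_horn G.adverse (NV := 12) (NR := 13) (D := 5) (IT := 17) (by decide)
    ρ m3 (eV := entryIndex) (eR := fun r => edgeIndex r.1 r.2) (eJ := letterIndex)
    (by rw [hρ.p12]; exact encodes_entryIndex K a b)
    (by rw [hρ.p13]; exact encodes_edgeIndex K a b)
    (by rw [hρ.p5]; exact encodes_letterIndex a b)
    (by
      rw [hρ.p12, hρ.p13, hρ.p5, hρ.p17]
      have : K * (a * b) * b * (a * b) ≤ K * (a * b) * 3 * (b * (a * b)) := by
        rw [mul_assoc (K * (a * b)) b, mul_assoc (K * (a * b)) 3]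
        exact Nat.mul_le_mul_left _ (by omega)
      omega)
    h10 (fun r y h => by rw [hρ.p5, e3.1]; exact (h11 _ _ _).1 h)
    (fun r y h => by rw [hρ.p5, e3.1]; exact (h11 _ _ _).2 h)
    (by rw [e3.2]; exact h12) v
  have key' := run_propagate_horn G.collab (NV := 12) (NR := 14) (D := 4) (IT := 17) (by decide)
    ρ m6 (eV := entryIndex) (eR := fun r => lookIndex r.1 r.2.1 r.2.2) (eJ := fun _ => 0)
    (by rw [hρ.p12]; exact encodes_entryIndex K a b)
    (by rw [hρ.p14]; exact encodes_lookIndex K a b)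
    (by rw [hρ.p4]; exact .unit)
    (by
      rw [hρ.p12, hρ.p14, hρ.p4, hρ.p17]
      have : K * (a * b) * b * (a * b) ≤ K * (a * b) * 3 * (b * (a * b)) := by
        rw [mul_assoc (K * (a * b)) b, mul_assoc (K * (a * b)) 3]
        exact Nat.mul_le_mul_left _ (by omega)
      omega)
    h10' (fun r y h => by rw [hρ.p4, e6.1, mul_one, add_zero]; exact (h11 _ _ _).1 h)
    (fun r y h => by rw [hρ.p4, e6.1, mul_one, add_zero]; exact (h11 _ _ _).2 h)
    (by rw [e6.2]; exact h12) v
  constructor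
  · rw [Stmt.run_of_not_writes rfl, Stmt.run_of_not_writes rfl, hm6, Stmt.run_of_not_writes rfl,
      hm5, run_copy_array hρ (by decide)]
    exact key
  · rw [run_copy_array hρ (by decide)]
    exact key'

end Shielding

namespace Shielding

open RAM

variable {n a b K : ℕ} {φ : SafetyAutomaton (Fin n) (Fin a) (Fin b)} {G : Arena φ (Fin K)}
  {ρ : ℕ → ℕ} {m : ℕ → ℕ → ℕ} {v : Fin K × Fin a × Fin b} {o : Fin b} {y : Fin a × Fin b}

theorem eval_ite_pos {c e f : Exp} (h : c.Holds ρ m) : (Exp.ite c e f).eval ρ m = e.eval ρ m :=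
  if_pos h

theorem eval_ite_neg {c e f : Exp} (h : ¬ c.Holds ρ m) :
    (Exp.ite c e f).eval ρ m = f.eval ρ m :=
  if_neg h

theorem EntryEnv.update (h : EntryEnv n v ρ) {x k : ℕ} (hx : 27 ≤ x) :
    EntryEnv n v (Function.update ρ x k) := by
  refine ⟨h.params.update (by omega), ?_, ?_, ?_⟩ <;> rw [Function.update_of_ne (by omega)]
  exacts [h.var_p, h.var_o, h.var_v]

theorem EntryEnv.edge (h : EntryEnv n v ρ) (o : Fin b) :
    EdgeEnv n v o (Function.update ρ 27 o) :=
  ⟨h.update le_rfl, Function.update_self _ _ _⟩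

theorem EdgeEnv.look (h : EdgeEnv n v o ρ) (y : Fin a × Fin b) :
    LookEnv n v o y (Function.update ρ 29 (letterIndex y)) :=
  ⟨⟨h.toEntryEnv.update (by decide), by rw [Function.update_of_ne (by decide), h.var_o']⟩,
    Function.update_self _ _ _⟩

theorem EdgeEnv.holds_all (h : EdgeEnv n v o ρ) {e : Exp} :
    (Exp.all 29 5 e).Holds ρ m ↔ ∀ y : Fin a × Fin b, e.Holds (Function.update ρ 29 (letterIndex y)) m := by
  rw [Exp.holds_all, h.params.p5, (encodes_letterIndex a b).forall_lt_iff]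

theorem EdgeEnv.holds_any (h : EdgeEnv n v o ρ) {e : Exp} :
    (Exp.any 29 5 e).Holds ρ m ↔
      ∃ y : Fin a × Fin b, e.Holds (Function.update ρ 29 (letterIndex y)) m := by
  rw [Exp.holds_any, h.params.p5, (encodes_letterIndex a b).exists_lt_iff]

theorem EntryEnv.holds_any (h : EntryEnv n v ρ) {e : Exp} :
    (Exp.any 27 2 e).Holds ρ m ↔ ∃ o : Fin b, e.Holds (Function.update ρ 27 o) m := by
  rw [Exp.holds_any, h.params.p2, (Encodes.fin b).exists_lt_iff]

/-! ### The program: optimal outputs -/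

/-- The output is optimal against an adverse design. -/
def allowedExp : Exp :=
  .and (.get 7 (moveExp 26 27)) (.and
    (.or (.not (.get 21 (.var 26))) (.eq (.var 27) (.var 25)))
    (.or (.get 21 (.var 26)) (.or (.not (.get 23 (.var 26)))
      (.all 29 5 (.or (.not (.get 6 (nextExp 26 27 29)))
        (.and (.get 23 (nextExp 26 27 29))
          (.lt (.get 23 (nextExp 26 27 29)) (.get 23 (.var 26)))))))))

/-- The output and the next letter belong to a shortest way of ending the corrections. -/
def shortensExp : Exp :=
  .and (.not (.get 21 (.var 26))) (.and (.get 25 (edgeExp 26 27))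
    (.and (.get 6 (nextExp 26 27 29)) (.and (.get 24 (.var 26))
      (.and (.get 24 (nextExp 26 27 29))
        (.lt (.get 24 (nextExp 26 27 29)) (.get 24 (.var 26)))))))

/-- The results of the analysis of the arena. -/
structure StoresRanks (G : Arena φ (Fin K)) (m : ℕ → ℕ → ℕ) : Prop extends StoresArena G m where
  copy : ∀ v, m 21 (entryIndex v) ≠ 0 ↔ G.Copy v.1 v.2
  adverse : ∀ v, G.adverse.IsRank v (m 23 (entryIndex v))
  collab : ∀ v, G.collab.IsRank v (m 24 (entryIndex v))

/-- The condition on all stages becomes a comparison of adverse ranks. An entry of rank zero has no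
adverse stage at all and imposes nothing; otherwise the next entry must have a positive smaller
rank. -/
theorem holds_allowedExp (hm : StoresRanks G m) (h : EdgeEnv n v o ρ) :
    allowedExp.Holds ρ m ↔ G.Allowed v.1 v.2 o := by
  have hy : ∀ y, Exp.Holds (.or (.not (.get 6 (nextExp 26 27 29)))
        (.and (.get 23 (nextExp 26 27 29))
          (.lt (.get 23 (nextExp 26 27 29)) (.get 23 (.var 26)))))
        (Function.update ρ 29 (letterIndex y)) m ↔
      (G.Calm (G.move v.1 v.2 o) y → 0 < m 23 (entryIndex (G.move v.1 v.2 o, y)) ∧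
        m 23 (entryIndex (G.move v.1 v.2 o, y)) < m 23 (entryIndex v)) := by
    intro y
    have h' := h.look y
    rw [Exp.holds_or, Exp.holds_not, Exp.holds_and, Exp.holds_lt, Exp.holds_get, Exp.holds_get,
      Exp.eval, Exp.eval, eval_nextExp h'.params hm.toStoresArena h'.var_v h'.var_o' h'.var_y,
      Exp.eval, h'.var_v, hm.calm, imp_iff_not_or, Nat.pos_iff_ne_zero]
  rw [allowedExp, Exp.holds_and, Exp.holds_and, Exp.holds_or, Exp.holds_or, Exp.holds_or,
    Exp.holds_not, Exp.holds_not, Exp.holds_get, Exp.holds_get, Exp.holds_get, h.holds_all,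
    Exp.holds_eq, Exp.eval, Exp.eval, Exp.eval, h.var_v, h.var_o, h.var_o', hm.copy,
    eval_moveExp h.params hm.toStoresArena h.var_v h.var_o', hm.win, Arena.Allowed, Fin.val_inj,
    imp_iff_not_or, ← or_iff_not_imp_left]
  refine and_congr Iff.rfl (and_congr Iff.rfl ?_)
  by_cases hc : G.Copy v.1 v.2
  · simp [hc]
  have hiff : ∀ y, (∀ k, G.Adv (k + 1) v.1 v.2 → G.Adv k (G.move v.1 v.2 o) y) ↔ _ := fun y =>
    (hm.adverse v).forall_imp_iff (h0 := hc) (hm.adverse (G.move v.1 v.2 o, y))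
  simp only [hc, false_or, hy, ne_eq, not_not]
  constructor
  · rintro (h0 | h1) k hk y hy
    · exact (hiff y).2 (.inl h0) k hk
    · exact (hiff y).2 (.inr (h1 y hy)) k hk
  · intro h1
    by_cases h0 : m 23 (entryIndex v) = 0
    · exact .inl h0
    · exact .inr fun y hy => ((hiff y).1 fun k hk => h1 k hk y hy).resolve_left h0

/-- Here a collaborative stage is required to exist, so the rank of the entry has to be positive and
the rank after it positive and smaller. -/
theorem holds_shortensExp (hm : StoresRanks G m)
    (h25 : ∀ v o, m 25 (edgeIndex v o) ≠ 0 ↔ G.Allowed v.1 v.2 o) (h : LookEnv n v o y ρ) :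
    shortensExp.Holds ρ m ↔ G.Shortens v.1 v.2 o y := by
  rw [shortensExp, Exp.holds_and, Exp.holds_not, Exp.holds_and, Exp.holds_and, Exp.holds_and,
    Exp.holds_and, Exp.holds_lt]
  simp only [Exp.holds_get]
  simp only [Exp.eval, h.var_v, eval_nextExp h.params hm.toStoresArena h.var_v h.var_o' h.var_y,
    eval_edgeExp h.params h.var_v h.var_o', hm.copy, h25, hm.calm, Arena.Shortens]
  refine and_congr_right fun hc => and_congr_right fun _ => and_congr_right fun _ => ?_
  have h1 := (hm.collab v).derived_iff
  have h2 : (∀ k, G.Col (k + 1) v.1 v.2 → G.Col k (G.move v.1 v.2 o) y) ↔ _ :=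
    (hm.collab v).forall_imp_iff (h0 := hc) (hm.collab (G.move v.1 v.2 o, y))
  change _ ↔ G.collab.Derived v ∧ _
  rw [h1, h2]
  omega

/-! ### The program: positions without an admissible continuation -/

/-- The allowed outputs are stored in array 25, the shortening combinations in array 22. -/
structure StoresOptions (G : Arena φ (Fin K)) (m : ℕ → ℕ → ℕ) : Prop extends StoresRanks G m where
  allowed : ∀ v o, m 25 (edgeIndex v o) ≠ 0 ↔ G.Allowed v.1 v.2 o
  shortens : ∀ v o y, m 22 (lookIndex v o y) ≠ 0 ↔ G.Shortens v.1 v.2 o y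

/-- Enter the optimal outputs into the arrays 25 and 22. -/
def optionsStmt : Stmt :=
  .seq (.tab 25 [11, 1, 2, 2] allowedExp) (.tab 22 [11, 1, 2, 2, 5] shortensExp)

theorem StoresRanks.run (hm : StoresRanks G m) {p : Stmt}
    (h : ∀ B ∈ [5, 6, 7, 21, 23, 24], p.writes B = false) : StoresRanks G (p.run ρ m) := by
  refine ⟨hm.toStoresArena.run (h _ (by decide)) (h _ (by decide)) (h _ (by decide)), ?_, ?_, ?_⟩ <;>
    rw [Stmt.run_of_not_writes (h _ (by decide))]
  exacts [hm.copy, hm.adverse, hm.collab]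

theorem run_optionsStmt (hρ : Params n a b K ρ) (hm : StoresRanks G m) :
    StoresOptions G (optionsStmt.run ρ m) := by
  simp only [optionsStmt, Stmt.run]
  have hm1 : StoresRanks G ((Stmt.tab 25 [11, 1, 2, 2] allowedExp).run ρ m) := hm.run (by decide)
  have h25 : ∀ v o, (Stmt.tab 25 [11, 1, 2, 2] allowedExp).run ρ m 25 (edgeIndex v o) ≠ 0 ↔
      G.Allowed v.1 v.2 o := by
    intro v o
    obtain ⟨ρ', h, he⟩ := run_tab_edge (m := m) hρ (A := 25) (e := allowedExp) rfl v o
    rw [he]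
    exact holds_allowedExp hm h
  refine ⟨hm1.run (by decide), ?_, ?_⟩
  · rw [Stmt.run_of_not_writes rfl]
    exact h25
  · intro v o y
    obtain ⟨ρ', h, he⟩ := run_tab_look (m := (Stmt.tab 25 [11, 1, 2, 2] allowedExp).run ρ m) hρ
      (A := 22) (e := shortensExp) rfl v o y
    rw [he]
    exact holds_shortensExp hm1 h25 h

theorem StoresOptions.run (hm : StoresOptions G m) {p : Stmt}
    (h : ∀ B ∈ [5, 6, 7, 21, 22, 23, 24, 25], p.writes B = false) :
    StoresOptions G (p.run ρ m) := by
  refine ⟨hm.toStoresRanks.run fun B hB => h B ?_, ?_, ?_⟩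
  · revert B; decide
  · rw [Stmt.run_of_not_writes (h _ (by decide))]
    exact hm.allowed
  · rw [Stmt.run_of_not_writes (h _ (by decide))]
    exact hm.shortens

/-- The number of an element of the clauses for the failure of admissibility. -/
def blockedIndex : (Fin K × Fin a × Fin b) ⊕ Fin K → ℕ :=
  Sum.elim entryIndex fun p => K * (a * b) + p

theorem encodes_blockedIndex (K a b : ℕ) :
    Encodes (blockedIndex (K := K) (a := a) (b := b)) (K * (a * b) + K) :=
  (encodes_entryIndex K a b).sum (.fin K)

/-- The body of a rule, where the variable 27 is the kind of the rule. -/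
def blockedBodyExp : Exp :=
  .ite (.var 27)
    -- Parameter 12, the number of entries, is the offset of the positions in the numbering of the
    -- elements.
    (.ite (.sub (.var 27) (.lit 1)) (.add (.add (.var 12) (.var 21)) (.lit 1))
      (.guard (.get 22 (lookExp 26 29 31)) (nextExp 26 29 31)))
    (.ite (.and (.not (.get 23 (.var 26))) (.get 24 (.var 26))) (.add (.var 26) (.lit 1))
      (.guard (.get 25 (edgeExp 26 29)) (.add (.var 12) (moveExp 26 29))))

/-- The facts. -/
def blockedBaseExp : Exp :=
  .ite (.lt (.var 21) (.var 12))
    (.and (.not (.get 21 (.var 21))) (.not (.any 27 2 (.any 29 5 (.get 22 (lookExp 21 27 29))))))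
    (.not (.get 7 (.sub (.var 21) (.var 12))))

/-- Enter the ranks of the clauses for the failure of admissibility into array 13. -/
def blockedStmt : Stmt :=
  .seq (.tab 10 [11, 1, 2, 8] (.ite (.var 27) (.var 26) (.add (.var 12) (.var 21))))
    (.seq (.tab 11 [11, 1, 2, 8, 2, 5] blockedBodyExp)
      (.seq (.tab 12 [16] blockedBaseExp) (propagate 16 15 6 17)))

theorem holds_blockedBaseExp (hρ : Params n a b K ρ) (hm : StoresOptions G m)
    (v : (Fin K × Fin a × Fin b) ⊕ Fin K) (h : ρ 21 = blockedIndex v) :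
    blockedBaseExp.Holds ρ m ↔ G.blocked.base v := by
  rcases v with v | p
  · have h' : ρ 21 = entryIndex v := h
    have hlt := (encodes_entryIndex K a b).lt v
    have he : (Exp.lt (.var 21) (.var 12)).Holds ρ m := by
      rw [Exp.holds_lt, Exp.eval, Exp.eval, h', hρ.p12]; exact hlt
    rw [blockedBaseExp, Exp.Holds, eval_ite_pos he]
    change Exp.Holds _ _ _ ↔ _
    rw [Exp.holds_and, Exp.holds_not, Exp.holds_not, Exp.holds_get, Exp.eval, h', hm.copy,
      Exp.holds_any, hρ.p2, (Encodes.fin b).exists_lt_iff]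
    have hs : ∀ (o : Fin b), (Exp.any 29 5 (.get 22 (lookExp 21 27 29))).Holds
        (Function.update ρ 27 o) m ↔ ∃ y, G.Shortens v.1 v.2 o y := by
      intro o
      rw [Exp.holds_any, Function.update_of_ne (by decide), hρ.p5,
        (encodes_letterIndex a b).exists_lt_iff]
      refine exists_congr fun y => ?_
      rw [Exp.holds_get, eval_lookExp (v := v) (o := o) (y := y)
        ((hρ.update (by decide)).update (by decide)) (by simpa using h') (by simp) (by simp)]
      exact hm.shortens v o y
    simp only [hs, Arena.blocked, Sum.elim_inl, not_exists]
  · have h' : ρ 21 = K * (a * b) + p := h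
    have he : ¬ (Exp.lt (.var 21) (.var 12)).Holds ρ m := by
      rw [Exp.holds_lt, Exp.eval, Exp.eval, h', hρ.p12]; omega
    rw [blockedBaseExp, Exp.Holds, eval_ite_neg he]
    change Exp.Holds _ _ _ ↔ _
    rw [Exp.holds_not, Exp.holds_get, Exp.eval, Exp.eval, Exp.eval, h', hρ.p12,
      Nat.add_sub_cancel_left, hm.win]
    rfl

/-- The variables of a loop over the rules. -/
structure RuleEnv (n : ℕ) (r : (Fin K × Fin a × Fin b) × Fin 3) (j : Fin b × Fin a × Fin b)
    (ρ : ℕ → ℕ) : Prop extends EntryEnv n r.1 ρ where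
  var_kind : ρ 27 = r.2
  var_o' : ρ 29 = j.1
  var_y : ρ 31 = letterIndex j.2

theorem eval_blockedBodyExp {r : (Fin K × Fin a × Fin b) × Fin 3} {j : Fin b × Fin a × Fin b}
    (hm : StoresOptions G m) (h : RuleEnv n r j ρ) :
    (G.blocked.used r j → blockedBodyExp.eval ρ m = blockedIndex (G.blocked.body r j) + 1) ∧
      (¬ G.blocked.used r j → blockedBodyExp.eval ρ m = 0) := by
  obtain ⟨v, k⟩ := r
  obtain ⟨o, y⟩ := j
  obtain ⟨⟨hρ, hp, ho, hv⟩, hk, ho', hy⟩ := h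
  have hneed : (Exp.and (.not (.get 23 (.var 26))) (.get 24 (.var 26))).Holds ρ m ↔
      G.NeedsHelp v.1 v.2 := by
    rw [Exp.holds_and, Exp.holds_not, Exp.holds_get, Exp.holds_get, Exp.eval, hv,
      ← (hm.adverse v).derived_iff, ← (hm.collab v).derived_iff]
    rfl
  have hshort : (Exp.get 22 (lookExp 26 29 31)).Holds ρ m ↔ G.Shortens v.1 v.2 o y := by
    rw [Exp.holds_get, eval_lookExp hρ hv ho' hy]
    exact hm.shortens v o y
  have hall : (Exp.get 25 (edgeExp 26 29)).Holds ρ m ↔ G.Allowed v.1 v.2 o := by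
    rw [Exp.holds_get, eval_edgeExp hρ hv ho']
    exact hm.allowed v o
  rw [blockedBodyExp]
  match k with
  | 0 =>
    rw [eval_ite_neg (by rw [Exp.Holds, Exp.eval, hk]; simp)]
    by_cases hn : G.NeedsHelp v.1 v.2
    · rw [eval_ite_pos (hneed.2 hn)]
      simp [Arena.blocked, hn, Exp.eval, hv, blockedIndex]
    · rw [eval_ite_neg (mt hneed.1 hn)]
      simp only [Arena.blocked, hn, if_true, false_or, if_false, ← hall]
      constructor
      · intro h
        rw [eval_guard_pos h, Exp.eval, eval_moveExp hρ hm.toStoresArena hv ho', Exp.eval, hρ.p12]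
        rfl
      · exact eval_guard_neg
  | 1 =>
    rw [eval_ite_pos (by rw [Exp.Holds, Exp.eval, hk]; simp),
      eval_ite_neg (by simp [Exp.Holds, Exp.eval, hk])]
    simp only [Arena.blocked, one_ne_zero, if_true, if_false, ← hshort]
    constructor
    · intro h
      rw [eval_guard_pos h, eval_nextExp hρ hm.toStoresArena hv ho' hy]
      rfl
    · exact eval_guard_neg
  | 2 =>
    rw [eval_ite_pos (by rw [Exp.Holds, Exp.eval, hk]; simp),
      eval_ite_pos (by simp [Exp.Holds, Exp.eval, hk])]
    simp [Arena.blocked, Exp.eval, hp, hρ.p12, blockedIndex]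

theorem run_blockedStmt (hρ : Params n a b K ρ) (hm : StoresOptions G m)
    (v : (Fin K × Fin a × Fin b) ⊕ Fin K) :
    G.blocked.IsRank v (blockedStmt.run ρ m 13 (blockedIndex v)) := by
  simp only [blockedStmt, Stmt.run]
  set s1 := Stmt.tab 10 [11, 1, 2, 8] (.ite (.var 27) (.var 26) (.add (.var 12) (.var 21))) with hs1
  set s2 := Stmt.tab 11 [11, 1, 2, 8, 2, 5] blockedBodyExp with hs2
  set s3 := Stmt.tab 12 [16] blockedBaseExp with hs3
  set m1 := s1.run ρ m with hm1
  set m2 := s2.run ρ m1 with hm2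
  set m3 := s3.run ρ m2 with hm3
  have g1 : StoresOptions G m1 := hm.run (by decide)
  have g2 : StoresOptions G m2 := g1.run (by decide)
  have h10 : ∀ r : (Fin K × Fin a × Fin b) × Fin 3,
      m3 10 (entryIndex r.1 * 3 + r.2) = blockedIndex (G.blocked.head r) := by
    intro r
    rw [hm3, Stmt.run_of_not_writes rfl, hm2, Stmt.run_of_not_writes rfl]
    have := Stmt.run_tab (A := 10) (e := .ite (.var 27) (.var 26) (.add (.var 12) (.var 21))) rfl
      (L := [11, 1, 2, 8]) (by decide) ρ m (vs := [r.1.1, r.1.2.1, r.1.2.2, r.2])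
      (by simp [hρ.p11, hρ.p1, hρ.p2, hρ.p8])
    rw [show tabPos ρ 0 _ _ = entryIndex r.1 * 3 + r.2 by
      simp [tabPos, hρ.p1, hρ.p2, hρ.p8, entryIndex, tableIndex]] at this
    rw [hm1, this]
    simp only [Arena.blocked]
    split_ifs with h0
    · simp [Exp.eval, tabEnv, h0, blockedIndex, hρ.p12]
    · have : (r.2 : ℕ) ≠ 0 := fun h => h0 (Fin.ext h)
      simp [Exp.eval, tabEnv, this, blockedIndex, hρ.p1, hρ.p2, entryIndex, tableIndex]
  have h11 : ∀ (r : (Fin K × Fin a × Fin b) × Fin 3) (j : Fin b × Fin a × Fin b),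
      (G.blocked.used r j → m3 11 ((entryIndex r.1 * 3 + r.2) * (b * (a * b)) +
        (j.1 * (a * b) + letterIndex j.2)) = blockedIndex (G.blocked.body r j) + 1) ∧
      (¬ G.blocked.used r j → m3 11 ((entryIndex r.1 * 3 + r.2) * (b * (a * b)) +
        (j.1 * (a * b) + letterIndex j.2)) = 0) := by
    intro r j
    rw [hm3, Stmt.run_of_not_writes rfl]
    have := Stmt.run_tab (A := 11) (e := blockedBodyExp) rfl
      (L := [11, 1, 2, 8, 2, 5]) (by decide) ρ m1
      (vs := [r.1.1, r.1.2.1, r.1.2.2, r.2, j.1, letterIndex j.2])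
      (by simp [hρ.p11, hρ.p1, hρ.p2, hρ.p8, hρ.p5, (encodes_letterIndex a b).lt])
    rw [show tabPos ρ 0 _ _ = (entryIndex r.1 * 3 + r.2) * (b * (a * b)) +
        (j.1 * (a * b) + letterIndex j.2) by
      simp only [tabPos, hρ.p1, hρ.p2, hρ.p8, hρ.p5, entryIndex, tableIndex]; ring] at this
    rw [hm2, this]
    refine eval_blockedBodyExp g1 ⟨⟨hρ.congr fun P hP => ?_, ?_, ?_, ?_⟩, ?_, ?_, ?_⟩
    · simp only [tabEnv]
      repeat rw [Function.update_of_ne (by omega)]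
    all_goals simp [tabEnv, hρ.p1, hρ.p2, entryIndex, tableIndex]
  have h12 : ∀ v, m3 12 (blockedIndex v) ≠ 0 ↔ G.blocked.base v := by
    intro v
    obtain ⟨ρ', h, h21, he⟩ := run_tab_single (m := m2) (A := 12) (e := blockedBaseExp) rfl
      (P := 16) (by decide) hρ (w := blockedIndex v)
      (by rw [hρ.p16]; exact (encodes_blockedIndex K a b).lt v)
    rw [hm3, he]
    exact holds_blockedBaseExp h g2 v h21
  exact run_propagate_horn G.blocked (NV := 16) (NR := 15) (D := 6) (IT := 17) (by decide)
    ρ m3 (eV := blockedIndex) (eR := fun r => entryIndex r.1 * 3 + r.2)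
    (eJ := fun j => j.1 * (a * b) + letterIndex j.2)
    (by rw [hρ.p16]; exact encodes_blockedIndex K a b)
    (by rw [hρ.p15]; exact (encodes_entryIndex K a b).prod (.fin 3))
    (by rw [hρ.p6]; exact (Encodes.fin b).prod (encodes_letterIndex a b))
    (by rw [hρ.p16, hρ.p15, hρ.p6, hρ.p17])
    h10 (fun r j h => by rw [hρ.p6]; exact (h11 r j).1 h)
    (fun r j h => by rw [hρ.p6]; exact (h11 r j).2 h) h12 v

/-! ### The program: the strategy -/

/-- The output continues a shortest way of ending the corrections. -/
def tightExp : Exp :=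
  .any 29 5 (.and (.get 22 (lookExp 26 27 29)) (.not (.get 13 (nextExp 26 27 29))))

/-- The output is optimal and has an admissible continuation. -/
def viableExp : Exp :=
  .and (.get 25 (edgeExp 26 27)) (.not (.get 13 (.add (.var 12) (moveExp 26 27))))

/-- The output of the shield. -/
def outExp : Exp :=
  -- A tight output is also allowed and viable. Preferring it wherever it exists makes the strategy
  -- positional: the shield need not remember whether it is committed to a path.
  .ite (.any 27 2 tightExp) (.find 27 28 2 tightExp)
    (.ite (.any 27 2 viableExp) (.find 27 28 2 viableExp) (.lit 0))

/-- Enter the shield into the arrays 0 and 1. -/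
def shieldStmt : Stmt :=
  .seq (.tab 1 [11, 1, 2] outExp)
    (.tab 0 [11, 1, 2] (.get 5 (.add (.mulv (.var 26) 2) (.get 1 (.var 26)))))

theorem eval_find_output {e : Exp} (h : EntryEnv n v ρ) {S : Fin b → Prop}
    (he : ∀ {ρ o}, EdgeEnv n v o ρ → (e.Holds ρ m ↔ S o)) (hex : (Exp.any 27 2 e).Holds ρ m) :
    ∃ o : Fin b, (Exp.find 27 28 2 e).eval ρ m = o ∧ S o := by
  obtain ⟨o, ho⟩ := h.holds_any.1 hex
  obtain ⟨h1, h2⟩ := Exp.eval_find (x := 27) (y := 28) (P := 2) (e := e) (ρ := ρ) (m := m)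
    (by decide) (by decide) (fun i hi j => by
      rw [h.params.p2] at hi
      rw [he ((h.update (x := 28) (by decide)).edge ⟨i, hi⟩), he (h.edge ⟨i, hi⟩)])
    (by rw [h.params.p2]; exact o.2) ho
  rw [h.params.p2] at h2
  exact ⟨⟨_, h2⟩, rfl, (he (h.edge ⟨_, h2⟩)).1 h1⟩

theorem holds_tightExp (hm : StoresOptions G m)
    (h13 : ∀ v, G.blocked.IsRank v (m 13 (blockedIndex v))) (h : EdgeEnv n v o ρ) :
    tightExp.Holds ρ m ↔ ∃ y, G.Shortens v.1 v.2 o y ∧ G.Tight (G.move v.1 v.2 o) y := by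
  rw [tightExp, h.holds_any]
  refine exists_congr fun y => ?_
  have h' := h.look y
  rw [Exp.holds_and, Exp.holds_not, Exp.holds_get, Exp.holds_get,
    eval_lookExp h'.params h'.var_v h'.var_o' h'.var_y,
    eval_nextExp h'.params hm.toStoresArena h'.var_v h'.var_o' h'.var_y, hm.shortens, Arena.Tight,
    (h13 (.inl _)).derived_iff]
  rfl

theorem holds_viableExp (hm : StoresOptions G m)
    (h13 : ∀ v, G.blocked.IsRank v (m 13 (blockedIndex v))) (h : EdgeEnv n v o ρ) :
    viableExp.Holds ρ m ↔ G.Allowed v.1 v.2 o ∧ G.Viable (G.move v.1 v.2 o) := by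
  rw [viableExp, Exp.holds_and, Exp.holds_not, Exp.holds_get, Exp.holds_get,
    eval_edgeExp h.params h.var_v h.var_o', Exp.eval,
    eval_moveExp h.params hm.toStoresArena h.var_v h.var_o', hm.allowed, Arena.Viable,
    (h13 (.inr _)).derived_iff, Exp.eval, h.params.p12]
  rfl

theorem run_shieldStmt (hρ : Params n a b K ρ) (ha : 0 < a) (hb : 0 < b) (hm : StoresOptions G m)
    (h13 : ∀ v, G.blocked.IsRank v (m 13 (blockedIndex v))) :
    ∃ f : Fin K → Fin a × Fin b → Fin b, G.IsAdmissibleStrategy f ∧ ∀ p x,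
      shieldStmt.run ρ m 0 (entryIndex (p, x)) = G.move p x (f p x) ∧
      shieldStmt.run ρ m 1 (entryIndex (p, x)) = f p x := by
  have : Nonempty (Fin a) := ⟨⟨0, ha⟩⟩
  have : Nonempty (Fin b) := ⟨⟨0, hb⟩⟩
  simp only [shieldStmt, Stmt.run]
  set m1 := (Stmt.tab 1 [11, 1, 2] outExp).run ρ m with hm1
  have key : ∀ p x, ∃ o : Fin b, m1 1 (entryIndex (p, x)) = o ∧
      (G.Viable p → G.Allowed p x o ∧ G.Viable (G.move p x o) ∧
        (G.Tight p x → ¬ G.Copy p x → ∃ y, G.Shortens p x o y ∧ G.Tight (G.move p x o) y)) := by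
    intro p x
    obtain ⟨ρ', h, he⟩ := run_tab_entry (m := m) hρ (A := 1) (e := outExp) rfl (p, x)
    rw [hm1, he, outExp]
    by_cases h1 : (Exp.any 27 2 tightExp).Holds ρ' m
    · rw [eval_ite_pos h1]
      obtain ⟨o, ho, hh⟩ := eval_find_output h (holds_tightExp hm h13) h1
      obtain ⟨y, hs, ht⟩ := hh
      exact ⟨o, ho, fun _ => ⟨hs.2.1, ht.viable, fun _ _ => ⟨y, hs, ht⟩⟩⟩
    · rw [eval_ite_neg h1]
      rw [h.holds_any] at h1
      simp only [holds_tightExp hm h13 (h.edge _)] at h1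
      by_cases h2 : (Exp.any 27 2 viableExp).Holds ρ' m
      · rw [eval_ite_pos h2]
        obtain ⟨o, ho, hh⟩ := eval_find_output h (holds_viableExp hm h13) h2
        exact ⟨o, ho, fun _ => ⟨hh.1, hh.2, fun ht hc => absurd (ht.exists_shortens hc) h1⟩⟩
      · rw [eval_ite_neg h2]
        -- The default output is taken only where the position is not viable. At a viable position
        -- an entry in need of help has a tight output, and any other entry has an allowed output
        -- with a viable successor.
        refine ⟨⟨0, hb⟩, rfl, fun hv => absurd ?_ h2⟩
        rw [h.holds_any]
        simp only [holds_viableExp hm h13 (h.edge _)]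
        refine hv.exists_allowed fun hn => ?_
        exact h1 ((hv.tight hn).exists_shortens fun hc => hn.1 ⟨0, hc⟩)
  choose f hf hf' using key
  refine ⟨f, fun p x hv => hf' p x hv, fun p x => ⟨?_, ?_⟩⟩
  · obtain ⟨ρ', h, he⟩ := run_tab_entry (m := m1) hρ (A := 0)
      (e := .get 5 (.add (.mulv (.var 26) 2) (.get 1 (.var 26)))) rfl (p, x)
    simp only [he, Exp.eval, h.var_v, hf, h.params.p2]
    rw [hm1, Stmt.run_of_not_writes rfl]
    exact hm.move p x _
  · rw [Stmt.run_of_not_writes rfl]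
    exact hf p x

end Shielding

namespace Shielding

open RAM

namespace RAM

/-! ### Programs that compute their parameters -/

/-- A statement, or the assignment of a parameter. -/
inductive Phase where
  | stmt (s : Stmt)
  | set (x : ℕ) (e : Exp)

namespace Phase

/-- The effect on the parameters and the memory. -/
def apply : Phase → (ℕ → ℕ) × (ℕ → ℕ → ℕ) → (ℕ → ℕ) × (ℕ → ℕ → ℕ)
  | stmt s, τ => (τ.1, s.run τ.1 τ.2)
  | set x e, τ => (Function.update τ.1 x (e.eval τ.1 τ.2), τ.2)

/-- The program of a phase. -/
def compile : Phase → Prog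
  | stmt s => s.compile
  | set x e => .seq (e.compile 60) (.seq (.op (.const x 0)) (.op (.add x x 60)))

/-- A bound for the number of steps. -/
def cost : Phase → (ℕ → ℕ) → ℕ
  | stmt s, ρ => s.cost ρ
  | set _ e, ρ => e.cost ρ + 2

/-- Well-formedness. -/
def wf : Phase → Bool
  | stmt s => s.wf []
  | set x e => decide (x < 20) && e.wf []

/-- The phase satisfies the syntactic criterion for linear cost. -/
def linear : Phase → Bool
  | stmt s => s.linear
  | set _ e => e.small

theorem exec_compile {p : Phase} (h : p.wf = true) {τ : (ℕ → ℕ) × (ℕ → ℕ → ℕ)} {σ : Store}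
    (hσ : σ.Holds [] τ.1 τ.2) : ∃ t σ', Exec p.compile σ t σ' ∧ t ≤ p.cost τ.1 ∧
      σ'.Holds [] (p.apply τ).1 (p.apply τ).2 := by
  cases p with
  | stmt s => exact s.exec_compile [] τ.1 τ.2 σ (by simp) h hσ
  | set x e =>
    simp only [wf, Bool.and_eq_true, decide_eq_true_eq] at h
    obtain ⟨t, σ', h1, ht, hh, hv, -⟩ := hσ.compile (by simp) h.2 le_rfl
    refine ⟨t + (1 + 1), _, .seq h1 (.seq (.op _ _) (.op _ _)), by simp only [cost]; omega, ?_, ?_⟩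
    · exact hh.1
    · intro y hy
      have hx : (60 : ℕ) ≠ x := by omega
      by_cases hyx : y = x
      · subst hyx
        simp [Instr.run, Store.setReg, apply, hx, hv]
      · simp [Instr.run, Store.setReg, apply, hyx, hh.2 y hy]

theorem linearCost {p : Phase} (h : p.linear = true) : LinearCost p.cost := by
  cases p with
  | stmt s => exact Stmt.linearCost h
  | set x e => exact ((Exp.polyCost h).add (.const 2)).linear

/-- The effect of a list of phases. -/
def applyAll : List Phase → (ℕ → ℕ) × (ℕ → ℕ → ℕ) → (ℕ → ℕ) × (ℕ → ℕ → ℕ)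
  | [], τ => τ
  | p :: l, τ => applyAll l (p.apply τ)

/-- The program of a list of phases. -/
def compileAll : List Phase → Prog
  | [] => .op (.const 60 0)
  | p :: l => .seq p.compile (compileAll l)

/-- The parameters are bounded by `Z`, and those from 10 on by `Z * B`. -/
def Bounded (Z B : ℕ) (ρ : ℕ → ℕ) : Prop := (∀ P < 10, ρ P ≤ Z) ∧ ∀ P < 20, ρ P ≤ Z * B

/-- The parameters that are assigned satisfy the bounds. -/
def BoundedAll (Z B : ℕ) : List Phase → (ℕ → ℕ) × (ℕ → ℕ → ℕ) → Prop
  | [], _ => True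
  | stmt s :: l, τ => BoundedAll Z B l ((stmt s).apply τ)
  | set x e :: l, τ =>
    e.eval τ.1 τ.2 ≤ (if x < 10 then Z else Z * B) ∧ BoundedAll Z B l ((set x e).apply τ)

/-- Parameters are constant within a phase and change only between phases. The bounds are preserved
by each assignment, so the costs of the phases add up to a bound whose constant depends on the list
of phases only. -/
theorem exec_compileAll {l : List Phase} (hw : ∀ p ∈ l, p.wf = true)
    (hl : ∀ p ∈ l, p.linear = true) : ∃ c, ∀ (Z B : ℕ) (τ : (ℕ → ℕ) × (ℕ → ℕ → ℕ)) (σ : Store),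
      1 ≤ B → Bounded Z B τ.1 → BoundedAll Z B l τ → σ.Holds [] τ.1 τ.2 →
      ∃ t σ', Exec (compileAll l) σ t σ' ∧ t ≤ c * (Z + 1) ^ c * B ∧
        σ'.Holds [] (applyAll l τ).1 (applyAll l τ).2 := by
  induction l with
  | nil =>
    refine ⟨1, fun Z B τ σ hB _ _ hσ => ⟨1, _, .op _ _, ?_, hσ.setReg (by simp) le_rfl⟩⟩
    exact Nat.mul_pos (by positivity) hB
  | cons p l ih =>
    obtain ⟨c, hc⟩ := linearCost (hl p (by simp))
    obtain ⟨c', hc'⟩ := ih (fun p hp => hw p (by simp [hp])) fun p hp => hl p (by simp [hp])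
    refine ⟨c + c', fun Z B τ σ hB hb hball hσ => ?_⟩
    obtain ⟨t, σ', h1, ht, hσ'⟩ := exec_compile (hw p (by simp)) hσ
    have hb' : Bounded Z B (p.apply τ).1 ∧ BoundedAll Z B l (p.apply τ) := by
      cases p with
      | stmt s => exact ⟨hb, hball⟩
      | set x e =>
        refine ⟨⟨fun P hP => ?_, fun P hP => ?_⟩, hball.2⟩ <;>
          simp only [apply, Function.update_apply] <;> split_ifs with h
        · subst h; simpa [hP] using hball.1
        · exact hb.1 P hP
        · have := hball.1
          split_ifs at this
          · exact this.trans (Nat.le_mul_of_pos_right _ hB)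
          · exact this
        · exact hb.2 P hP
    obtain ⟨t', σ'', h2, ht', hσ''⟩ := hc' Z B _ σ' hB hb'.1 hb'.2 hσ'
    refine ⟨t + t', σ'', .seq h1 h2, ?_, hσ''⟩
    have h3 : (Z + 1) ^ c ≤ (Z + 1) ^ (c + c') := Nat.pow_le_pow_right (by omega) (by omega)
    have h4 : (Z + 1) ^ c' ≤ (Z + 1) ^ (c + c') := Nat.pow_le_pow_right (by omega) (by omega)
    calc t + t' ≤ c * (Z + 1) ^ c * B + c' * (Z + 1) ^ c' * B :=
          add_le_add (ht.trans (hc _ Z B hb.1 hb.2 hB)) ht'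
      _ ≤ c * (Z + 1) ^ (c + c') * B + c' * (Z + 1) ^ (c + c') * B := by gcongr
      _ = _ := by ring

end Phase

end RAM

/-! ### The synthesis program -/

/-- The analysis and the construction of the shield. -/
def synthesisStmt : Stmt :=
  .seq arenaStmt (.seq copyStmt (.seq rankStmt (.seq optionsStmt (.seq blockedStmt shieldStmt))))

/-- The computation of the parameters, and the synthesis. -/
def synthesisPhases : List Phase :=
  [.stmt powStmt, .set 4 (.lit 1), .set 5 (.mulv (.var 1) 2), .set 6 (.mulv (.var 2) 5),
    -- The value `2 ^ n` is read from the table of powers, and each later product has a small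
    -- parameter as its second factor.
    .set 7 (.mulv (.var 0) 1), .set 8 (.lit 3), .set 10 (.get 2 (.var 0)),
    .set 11 (.mulv (.var 10) 0), .set 12 (.mulv (.var 11) 5), .set 13 (.mulv (.var 12) 2), .set 14 (.mulv (.var 13) 5),
    .set 15 (.mulv (.var 12) 8), .set 16 (.add (.var 12) (.var 11)),
    .set 17 (.add (.var 16) (.mulv (.var 15) 6)),
    -- The initial position: the mask of the singleton of the initial state is a power of two and is
    -- the leading digit.
    .set 18 (.add (.mulv (.get 2 (.var 3)) 0) (.var 3)), .stmt synthesisStmt]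

/-- The initial state of the shield. -/
def initPhase : Phase := .set 1 (.var 18)

/-- The number of states of the shield, or `0`. -/
def sizePhase : Phase := .set 0 (.ite (.get 13 (.add (.var 12) (.var 18))) (.lit 0) (.var 11))

/-- The synthesis program. -/
def synthesisProg : Prog :=
  .seq (Phase.compileAll synthesisPhases) (.seq initPhase.compile sizePhase.compile)

/-! ### Correctness and running time of the synthesis program -/

section

variable {n a b : ℕ} {φ : SafetyAutomaton (Fin n) (Fin a) (Fin b)} {ρ : ℕ → ℕ} {m : ℕ → ℕ → ℕ}

theorem run_synthesisStmt (hρ : Params n a b (2 ^ n * n) ρ) (ha : 0 < a) (hb : 0 < b)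
    (hm : StoresSpec φ m) (hpow : ∀ s ≤ n, m 2 s = 2 ^ s) :
    ∃ f : Fin (2 ^ n * n) → Fin a × Fin b → Fin b, φ.arena.IsAdmissibleStrategy f ∧
      (∀ p x, synthesisStmt.run ρ m 0 (entryIndex (p, x)) = φ.arena.move p x (f p x) ∧
        synthesisStmt.run ρ m 1 (entryIndex (p, x)) = f p x) ∧
      ∀ p : Fin (2 ^ n * n), synthesisStmt.run ρ m 13 (2 ^ n * n * (a * b) + p) = 0 ↔ φ.arena.Viable p := by
  simp only [synthesisStmt, Stmt.run]
  have h1 := run_arenaStmt hρ hb hm hpow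
  set m1 := arenaStmt.run ρ m
  have h2 : StoresArena φ.arena (copyStmt.run ρ m1) := h1.run rfl rfl rfl
  have hc := run_copyStmt hρ h1
  set m2 := copyStmt.run ρ m1
  have h3 : StoresRanks φ.arena (rankStmt.run ρ m2) :=
    { h2.run (p := rankStmt) rfl rfl rfl with
      copy := by rw [Stmt.run_of_not_writes rfl]; exact hc
      adverse := fun v => (run_rankStmt hρ h2 hc v).1
      collab := fun v => (run_rankStmt hρ h2 hc v).2 }
  have h4 := run_optionsStmt hρ h3
  set m4 := optionsStmt.run ρ (rankStmt.run ρ m2)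
  have h5 : StoresOptions φ.arena (blockedStmt.run ρ m4) := h4.run (by decide)
  have h13 := run_blockedStmt hρ h4
  obtain ⟨f, hf, hf'⟩ := run_shieldStmt hρ ha hb h5 h13
  refine ⟨f, hf, hf', fun p => ?_⟩
  rw [Stmt.run_of_not_writes rfl, Arena.Viable, (h13 (.inr p)).derived_iff, not_not]
  rfl

theorem storesSpec_inputStore (φ : SafetyAutomaton (Fin n) (Fin a) (Fin b)) :
    StoresSpec φ (inputStore φ).arr := by
  refine ⟨fun q => ?_, fun q i o => ?_⟩
  · simp [inputStore, Fin.val_inj]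
  · have : ∀ q' i' o', tableIndex a b (q' : Fin n) (i' : Fin a) (o' : Fin b) =
        tableIndex a b q i o ↔ q' = q ∧ i' = i ∧ o' = o := by
      intro q' i' o'
      have := (encodes_entryIndex n a b).inj.eq_iff (a := (q', i', o')) (b := (q, i, o))
      simpa [entryIndex] using this
    simp [inputStore, this, ite_and, Finset.sum_ite_eq']

theorem setCode_singleton (q : Fin n) : setCode {q} = 2 ^ (q : ℕ) := by
  classical
  simp [setCode]

theorem applyAll_synthesisPhases (h0 : ρ 0 = n) (h1 : ρ 1 = a) (h2 : ρ 2 = b)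
    (h3 : ρ 3 = φ.init) : ∃ ρ', Params n a b (2 ^ n * n) ρ' ∧ ρ' 18 = φ.arena.init ∧
      Phase.applyAll synthesisPhases (ρ, m) =
        (ρ', synthesisStmt.run ρ' (powStmt.run ρ m)) := by
  have hpow := run_powStmt ρ m
  rw [h0] at hpow
  have e1 := hpow n le_rfl
  have e2 := hpow φ.init φ.init.2.le
  simp only [synthesisPhases, Phase.applyAll, Phase.apply]
  generalize powStmt.run ρ m = m1 at *
  have h18 : (φ.arena.init : ℕ) = 2 ^ (φ.init : ℕ) * n + φ.init := by
    rw [φ.arena_val, φ.arena.pos_init, setCode_singleton]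
  simp [Exp.eval, h0, h1, h2, h3, e1, e2]
  exact ⟨by constructor <;> simp [h0, h1, h2], h18.symm⟩

/-- The exponent comes from parameter 17, whose value is at most `2 ^ n` times three terms, each at
most the seventh power of `n + a + b`; the factor three is absorbed by one more power, as `n`, `a`
and `b` are positive. -/
theorem boundedAll_synthesisPhases (ha : 0 < a) (hb : 0 < b) (h0 : ρ 0 = n) (h1 : ρ 1 = a)
    (h2 : ρ 2 = b) (h3 : ρ 3 = φ.init) :
    Phase.BoundedAll ((n + a + b) ^ 8) (2 ^ n) synthesisPhases (ρ, m) := by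
  have hn : 0 < n := φ.init.pos
  have hpow := run_powStmt ρ m
  rw [h0] at hpow
  have e1 := hpow n le_rfl
  have e2 := hpow φ.init φ.init.2.le
  have h18 : 2 ^ (φ.init : ℕ) * n + φ.init < 2 ^ n * n := by
    have := φ.arena.init.2
    rwa [φ.arena_val, φ.arena.pos_init, setCode_singleton] at this
  simp only [synthesisPhases, Phase.BoundedAll, Phase.apply]
  generalize powStmt.run ρ m = m1 at *
  obtain ⟨N, hN⟩ : ∃ N, n + a + b = N := ⟨_, rfl⟩
  have hnN : n ≤ N := by omega
  have haN : a ≤ N := by omega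
  have hbN : b ≤ N := by omega
  have h3N : 3 ≤ N := by omega
  have hp : ∀ k ≤ 8, N ^ k ≤ N ^ 8 := fun k hk => Nat.pow_le_pow_right (by omega) hk
  have hmax : 2 ^ n * n * (a * b) + 2 ^ n * n + 2 ^ n * n * (a * b) * 3 * (b * (a * b)) ≤
      N ^ 8 * 2 ^ n := by
    calc _ ≤ 2 ^ n * N * (N * N) + 2 ^ n * N + 2 ^ n * N * (N * N) * N * (N * (N * N)) := by
          gcongr
      _ = (N ^ 3 + N ^ 1 + N ^ 7) * 2 ^ n := by ring
      _ ≤ (N ^ 7 * 3) * 2 ^ n := by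
          have g1 : N ^ 3 ≤ N ^ 7 := Nat.pow_le_pow_right (by omega) (by omega)
          have g2 : N ^ 1 ≤ N ^ 7 := Nat.pow_le_pow_right (by omega) (by omega)
          exact Nat.mul_le_mul_right _ (by omega)
      _ ≤ (N ^ 7 * N) * 2 ^ n := by gcongr
      _ = _ := by ring
  have hK : 2 ^ n ≤ 2 ^ n * n := Nat.le_mul_of_pos_right _ hn
  have hM : 1 ≤ a * b := Nat.mul_pos ha hb
  generalize hKdef : 2 ^ n * n = K at *
  have hL : K * (a * b) * 3 ≤ K * (a * b) * 3 * (b * (a * b)) :=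
    Nat.le_mul_of_pos_right _ (Nat.mul_pos hb hM)
  have h13 : K * (a * b) * b ≤ K * (a * b) * b * (a * b) := Nat.le_mul_of_pos_right _ hM
  have h14 : K * (a * b) * b * (a * b) ≤ K * (a * b) * 3 * (b * (a * b)) := by
    rw [mul_assoc (K * (a * b)) b, mul_assoc (K * (a * b)) 3]
    exact Nat.mul_le_mul_left _ (by omega)
  have hmul : 2 ^ n * n = K := hKdef
  simp [Exp.eval, h0, h1, h2, e1, e2, h3, hN, hmul]
  refine ⟨Nat.one_le_pow _ _ (by omega), ?_, ?_, ?_, ?_, ?_, ?_, ?_, ?_, ?_, ?_, ?_, hmax, ?_⟩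
  · exact le_trans (by rw [pow_two]; gcongr) (hp 2 (by omega))
  · exact le_trans (by rw [pow_succ', pow_two]; gcongr) (hp 3 (by omega))
  · exact le_trans (by rw [pow_two]; gcongr) (hp 2 (by omega))
  · exact h3N.trans (by simpa using hp 1 (by omega))
  · exact Nat.one_le_pow _ _ (by omega)
  all_goals omega

/-- The synthesis program is correct. -/
theorem exists_exec_synthesisProg : ∃ c, ∀ (n a b : ℕ), 0 < a → 0 < b →
    ∀ φ : SafetyAutomaton (Fin n) (Fin a) (Fin b), ∃ (t : ℕ) (σ : Store),
      Exec synthesisProg (inputStore φ) t σ ∧ t ≤ c * (n + a + b) ^ c * 2 ^ n ∧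
      (φ.HasAdmissibleShield → ∃ M : Mealy (Fin (2 ^ n * n)) (Fin a × Fin b) (Fin b),
        φ.IsAdmissible M ∧ StoreDescribes σ M) ∧
      (¬ φ.HasAdmissibleShield → σ.reg 0 = 0) := by
  obtain ⟨c, hc⟩ := Phase.exec_compileAll (l := synthesisPhases) (by decide) (by decide)
  -- With `N = n + a + b`, the phases cost at most `c * (N ^ 8 + 1) ^ c * 2 ^ n`, and `N ^ 8 + 1 ≤ N
  -- ^ 9` since `N` is at least 3. The two final assignments take at most 16 steps, which the
  -- summand 20 absorbs.
  refine ⟨9 * c + 20, fun n a b ha hb φ => ?_⟩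
  have hn : 0 < n := φ.init.pos
  obtain ⟨ρ, hρ⟩ : ∃ ρ, (inputStore φ).reg = ρ := ⟨_, rfl⟩
  have h0 : ρ 0 = n := by simp [← hρ, inputStore]
  have h1 : ρ 1 = a := by simp [← hρ, inputStore]
  have h2 : ρ 2 = b := by simp [← hρ, inputStore]
  have h3 : ρ 3 = φ.init := by simp [← hρ, inputStore]
  have h4 : ∀ x, ρ x ≤ n + a + b := by
    intro x
    have := φ.init.2
    simp only [← hρ, inputStore]
    split_ifs <;> omega
  have hle : n + a + b ≤ (n + a + b) ^ 8 := Nat.le_self_pow (by decide) _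
  have hB : 1 ≤ 2 ^ n := Nat.one_le_two_pow
  obtain ⟨t₁, σ₁, hx₁, ht₁, hσ₁⟩ := hc ((n + a + b) ^ 8) (2 ^ n) (ρ, (inputStore φ).arr)
    (inputStore φ) hB ⟨fun P _ => (h4 P).trans hle, fun P _ => ((h4 P).trans hle).trans
      (Nat.le_mul_of_pos_right _ hB)⟩ (boundedAll_synthesisPhases ha hb h0 h1 h2 h3)
    ⟨rfl, fun y _ => by rw [hρ]⟩
  obtain ⟨ρ', hρ', h18, happ⟩ := applyAll_synthesisPhases (φ := φ) (m := (inputStore φ).arr) h0 h1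
    h2 h3
  rw [happ] at hσ₁
  have hpow := run_powStmt ρ (inputStore φ).arr
  rw [h0] at hpow
  obtain ⟨f, hf, hf', hv⟩ := run_synthesisStmt (m := powStmt.run ρ (inputStore φ).arr) hρ' ha hb
    (by
      have := storesSpec_inputStore φ
      rw [StoresSpec, Stmt.run_of_not_writes rfl, Stmt.run_of_not_writes rfl]
      exact this) hpow
  set m := synthesisStmt.run ρ' (powStmt.run ρ (inputStore φ).arr)
  obtain ⟨t₂, σ₂, hx₂, ht₂, hσ₂⟩ := Phase.exec_compile (p := initPhase) (by decide) hσ₁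
  obtain ⟨t₃, σ₃, hx₃, ht₃, hσ₃⟩ := Phase.exec_compile (p := sizePhase) (by decide) hσ₂
  have hinit := hv φ.arena.init
  have hreg0 : σ₃.reg 0 = if m 13 (2 ^ n * n * (a * b) + φ.arena.init) ≠ 0 then 0
      else 2 ^ n * n := by
    rw [hσ₃.2 0 (.inl (by decide))]
    simp [Phase.apply, initPhase, sizePhase, Exp.eval, hρ'.p12, hρ'.p11, h18]
  have hreg1 : σ₃.reg 1 = φ.arena.init := by
    rw [hσ₃.2 1 (.inl (by decide))]
    simp [Phase.apply, initPhase, sizePhase, Exp.eval, h18]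
  have harr : σ₃.arr = m := hσ₃.1
  refine ⟨_, σ₃, .seq hx₁ (.seq hx₂ hx₃), ?_, ?_, ?_⟩
  · obtain ⟨N, hN⟩ : ∃ N, n + a + b = N := ⟨_, rfl⟩
    rw [hN] at ht₁ ⊢
    have h3N : 3 ≤ N := by omega
    change t₂ ≤ 4 at ht₂
    change t₃ ≤ 12 at ht₃
    have g1 : N ^ 8 + 1 ≤ N ^ 9 := by
      have : 1 ≤ N ^ 8 := Nat.one_le_pow _ _ (by omega)
      have : N ^ 8 * 3 ≤ N ^ 8 * N := Nat.mul_le_mul_left _ h3N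
      have : N ^ 9 = N ^ 8 * N := pow_succ _ _
      omega
    have g2 : (N ^ 8 + 1) ^ c ≤ N ^ (9 * c + 20) := by
      calc _ ≤ (N ^ 9) ^ c := Nat.pow_le_pow_left g1 c
        _ = N ^ (9 * c) := (pow_mul _ _ _).symm
        _ ≤ _ := Nat.pow_le_pow_right (by omega) (by omega)
    have g3 : 1 ≤ N ^ (9 * c + 20) * 2 ^ n :=
      Nat.mul_pos (Nat.pow_pos (by omega)) (by positivity)
    calc t₁ + (t₂ + t₃) ≤ c * (N ^ 8 + 1) ^ c * 2 ^ n + 16 * 1 := by omega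
      _ ≤ c * N ^ (9 * c + 20) * 2 ^ n + 16 * (N ^ (9 * c + 20) * 2 ^ n) := by gcongr
      _ = (c + 16) * N ^ (9 * c + 20) * 2 ^ n := by ring
      _ ≤ _ := by gcongr <;> omega
  · rintro ⟨S, _, M, hM⟩
    have : Nonempty (Fin a) := ⟨⟨0, ha⟩⟩
    have : Nonempty (Fin b) := ⟨⟨0, hb⟩⟩
    have hvi : φ.arena.Viable φ.arena.init := Arena.viable_of_isAdmissible hM
    refine ⟨φ.arena.machine f, Arena.isAdmissible_machine hf hvi, ?_, hreg1, fun s i o => ?_⟩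
    · rw [hreg0, if_neg (by rw [not_not]; exact hinit.2 hvi)]
    · rw [harr]
      exact hf' s (i, o)
  · intro hno
    rw [hreg0, if_pos]
    intro h
    have : Nonempty (Fin a) := ⟨⟨0, ha⟩⟩
    have : Nonempty (Fin b) := ⟨⟨0, hb⟩⟩
    exact hno ⟨_, inferInstance, _, Arena.isAdmissible_machine hf (hinit.1 h)⟩

end

end Shielding

theorem mainTheorem8 :
    ∃ (P : Shielding.RAM.Prog) (c : ℕ), ∀ (n a b : ℕ), 0 < a → 0 < b →
      ∀ φ : Shielding.SafetyAutomaton (Fin n) (Fin a) (Fin b),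
        ∃ (t : ℕ) (σ : Shielding.RAM.Store),
          Shielding.RAM.Exec P (Shielding.inputStore φ) t σ ∧
          t ≤ c * (n + a + b) ^ c * 2 ^ n ∧
          (φ.HasAdmissibleShield →
            ∃ (K : ℕ) (M : Shielding.Mealy (Fin K) (Fin a × Fin b) (Fin b)),
              K ≤ (2 * 2 ^ n + n) * 2 * n ∧ φ.IsAdmissible M ∧ Shielding.StoreDescribes σ M) ∧
          (¬ φ.HasAdmissibleShield → σ.reg 0 = 0) := by
  obtain ⟨c, hc⟩ := Shielding.exists_exec_synthesisProg
  refine ⟨Shielding.synthesisProg, c, fun n a b ha hb φ => ?_⟩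
  obtain ⟨t, σ, h1, h2, h3, h4⟩ := hc n a b ha hb φ
  refine ⟨t, σ, h1, h2, fun h => ?_, h4⟩
  obtain ⟨M, hM, hσ⟩ := h3 h
  -- The shield has one state for each position, and `2 ^ n` is at most `(2 * 2 ^ n + n) * 2`.
  exact ⟨_, M, Nat.mul_le_mul_right _ (by omega), hM, hσ⟩
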